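/- **Setting.** Let $n\ge 3$, let $\Omega\subset\mathbb R^n$ be an open bounded convex set with $C^1$ boundary, outer unit normal $n(x)$, and surface measure $d\mu$ on $\partial\Omega$; let $d\theta$ be the normalized (total mass $1$) surface measure on $\mathbb S^{n-1}$, and $|\mathbb S^{n-1}|$ the (unnormalized) area of the sphere. Put $\Gamma_-=\{(x,\theta)\in\partial\Omega\times\mathbb S^{n-1}: n(x)\cdot\theta<0\}$, $d\xi=|n(x)\cdot\theta|\,d\mu(x)\,d\theta$, $\tau_\pm(x,\theta)=\min\{t\ge0: x\pm t\theta\in\partial\Omega\}$, $\tau=\tau_-+\tau_+$, $\langle u\rangle(x)=\int_{\mathbb S^{n-1}}u(x,\theta)\,d\theta$, $Ku(x,\theta)=\int_{\mathbb S^{n-1}}k(x,\theta',\theta)u(x,\theta')\,d\theta'$, and $\|f\|_*=\big\|\int_{\mathbb S^{n-1}}|f(x-\tau_-(x,\theta)\theta,\theta)|\,d\theta\big\|_{L^\infty(\Omega)}$. Consider the boundary value problem $$\theta\cdot\nabla_xu+(\sigma_a+\sigma_b|\langle u\rangle|)u-Ku=0\ \text{ in }\Omega\times\mathbb S^{n-1},\qquad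 u=f_-\ \text{ on }\Gamma_-,\tag{1}$$ for $u\in L^1(\Omega\times\mathbb S^{n-1})$ with weak derivative $\theta\cdot\nabla_xu\in L^1(\Omega\times\mathbb S^{n-1})$; the boundary values of $u$ are its traces along the chords of $\Omega$. The tuple $(\sigma_a,\sigma_b,k,f_-)$ is *admissible* if $0\le\sigma_a,\sigma_b\in L^\infty(\Omega\times\mathbb S^{n-1})$, $0\le k\in L^\infty(\Omega\times\mathbb S^{n-1}\times\mathbb S^{n-1})$, $f_-\in L^1(\Gamma_-,d\xi)$, $\|f_-\|_*<\infty$, and there are $\mu_0,\nu\in[0,1)$ with $\|\tau\|_{L^\infty}\|k\|_{L^\infty}\le\mu_0$ and $\|\tau\|_{L^\infty}\|\sigma_b\|_{L^\infty}\|f_-\|_*\le\nu(1-\mu_0)^2$. **Sources and test functions.** Let $h\in C_0^\infty(B_1)$, $B_1\subset\mathbb R^n$ the unit ball, $0\le h\le1$, $h\equiv1$ near $0$, be such that $\omega=\lim_{\varepsilon\to0}\int_{\mathbb S^{n-1}}\varepsilon^{-(n-1)}h\big(\frac{\theta-\theta'}{\varepsilon}\big)d\theta$ is the same for all $\theta'\in\mathbb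 S^{n-1}$ (for example, $h$ radial), and let $\tilde\omega=|\mathbb S^{n-1}|\,\omega$ be the same constant for the unnormalized surface measure. For $\varepsilon,\varepsilon',\delta>0$, $x'\in\partial\Omega$, $\theta'\in\mathbb S^{n-1}$ set $$f_-^{\varepsilon,\varepsilon',\delta}(x,\theta;x',\theta')=\frac{\delta}{\omega\,\tilde\omega\,\varepsilon^{n-1}}\,h\Big(\frac{x-x'}{\varepsilon'}\Big)h\Big(\frac{\theta-\theta'}{\varepsilon}\Big).$$ Let $\varphi\in C_0^\infty(-1,1)$, $0\le\varphi\le1$, $\int\varphi=1$. For $\theta,\theta'$ not parallel, let $\pi_{\theta,\theta'}$ be the orthogonal projection onto $\operatorname{span}(\theta,\theta')$, let $\theta'_\perp$ be a unit vector of this plane orthogonal to $\theta'$, and for $\gamma_1,\gamma_2>0$ set $$\phi_{\gamma_1,\gamma_2}(x,\theta,\theta')=\frac1{\gamma_1}\,\varphi\Big(\frac{x\cdot\theta'_\perp}{\gamma_1\,\theta\cdot\theta'_\perp}\Big)h\Big(\frac{x-\pi_{\theta,\theta'}(x)}{\gamma_2}\Big).$$ **Theorem.** Assume that for all $\varepsilon,\varepsilon'>0$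 and all sufficiently small $\delta>0$ (depending on $\varepsilon,\varepsilon'$) the tuple $(\sigma_a,\sigma_b,k,f_-^{\varepsilon,\varepsilon',\delta}(\cdot\,;x',\theta'))$ is admissible for all $x'\in\partial\Omega$, $\theta'\in\mathbb S^{n-1}$, and let $u^{\varepsilon,\varepsilon',\delta}(\cdot\,;x',\theta')$ be the solution of (1) with $f_-=f_-^{\varepsilon,\varepsilon',\delta}(\cdot\,;x',\theta')$, with outgoing values $u^{\varepsilon,\varepsilon',\delta}(x+\tau_+(x,\theta)\theta,\theta;x',\theta')$ jointly measurable in $(x,\theta,x',\theta')$. Then $$\begin{aligned}&\lim_{\gamma_1\to0}\lim_{\gamma_2\to0}\lim_{\varepsilon'\to0}\lim_{\varepsilon\to0}\lim_{\delta\to0}\int_{\partial\Omega}\frac{u^{\varepsilon,\varepsilon',\delta}(x+\tau_+(x,\theta)\theta,\theta;x',\theta')}{\varepsilon'^{\,n-1}\delta}\,\phi_{\gamma_1,\gamma_2}\big(x'-x+\tau_-(x,\theta')\theta',\theta,\theta'\big)\,d\mu(x')\\&\quad=\exp\Big(-\int_0^{\tau_+(x,\theta)}\sigma_a(x+s\theta,\theta)\,ds\Big)\exp\Big(-\int_0^{\tau_-(x,\theta')}\sigma_a(x-s\theta',\theta')\,ds\Big)\,k(x,\theta',\theta),\end{aligned}$$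 where each of the five successive one-sided limits ($\downarrow 0$) exists in $L^1_{\rm loc}\big(\Omega\times((\mathbb S^{n-1}\times\mathbb S^{n-1})\setminus D)\big)$ as functions of $(x,\theta,\theta')$, with $D=\{(\theta,\theta'):\theta\parallel\theta'\}$. -/

import Mathlib

open MeasureTheory Filter Topology Set
open scoped ENNReal RealInnerProductSpace

noncomputable section

namespace RTE

/-- Euclidean space `ℝⁿ`. -/
abbrev Space (n : ℕ) := EuclideanSpace ℝ (Fin n)

/-- The unit sphere `𝕊ⁿ⁻¹` of `ℝⁿ`, the set of directions. -/
abbrev Dir (n : ℕ) := Metric.sphere (0 : Space n) 1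

/-! ### Geometry of the domain -/

/-- `Ω` has a `C¹` boundary: near each boundary point `Ω` is the sublevel set `{g < 0}` of a `C¹`
function `g` whose differential does not vanish at that point. -/
def HasC1Boundary {n : ℕ} (Ω : Set (Space n)) : Prop :=
  ∀ p ∈ frontier Ω, ∃ U : Set (Space n), IsOpen U ∧ p ∈ U ∧
    ∃ g : Space n → ℝ, ContDiffOn ℝ 1 g U ∧ fderiv ℝ g p ≠ 0 ∧ Ω ∩ U = {x ∈ U | g x < 0}

/-- `τ₊(x, θ)`: distance from `x` to `∂Ω` in the direction `θ`. -/
def tauPlus {n : ℕ} (Ω : Set (Space n)) (x : Space n) (θ : Dir n) : ℝ :=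
  sInf {t : ℝ | 0 ≤ t ∧ x + t • (θ : Space n) ∈ frontier Ω}

/-- `τ₋(x, θ)`: distance from `x` to `∂Ω` in the direction `-θ`. -/
def tauMinus {n : ℕ} (Ω : Set (Space n)) (x : Space n) (θ : Dir n) : ℝ :=
  sInf {t : ℝ | 0 ≤ t ∧ x - t • (θ : Space n) ∈ frontier Ω}

/-- `τ = τ₋ + τ₊`. -/
def tau {n : ℕ} (Ω : Set (Space n)) (x : Space n) (θ : Dir n) : ℝ :=
  tauMinus Ω x θ + tauPlus Ω x θ

/-- The outer unit normal at a boundary point of a convex set: the unit vector `ν` such that `Ω`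
lies in the half space `{y | (y - x) · ν ≤ 0}` (it is unique if the boundary is `C¹`). -/
def outerNormal {n : ℕ} (Ω : Set (Space n)) (x : Space n) : Space n :=
  Classical.epsilon fun ν : Space n => ‖ν‖ = 1 ∧ ∀ y ∈ Ω, ⟪y - x, ν⟫ ≤ 0

/-! ### Measures -/

/-- The total surface area `|𝕊ⁿ⁻¹|` of the unit sphere. -/
def sphereArea (n : ℕ) : ℝ := (volume : Measure (Space n)).toSphere.real univ

/-- The normalized surface measure `dθ` on the unit sphere. -/
def sphereMeasure (n : ℕ) : Measure (Dir n) :=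
  ((volume : Measure (Space n)).toSphere univ)⁻¹ • (volume : Measure (Space n)).toSphere

/-- The Lebesgue (surface) measure `dμ` on `∂Ω`: the `(n-1)`-dimensional Hausdorff measure,
normalized so as to agree with Lebesgue measure on hyperplanes. -/
def boundaryMeasure {n : ℕ} (Ω : Set (Space n)) : Measure (Space n) :=
  (Measure.euclideanHausdorffMeasure (n - 1)).restrict (frontier Ω)

/-- The measure `dx dθ` on `Ω × 𝕊ⁿ⁻¹`. -/
def phaseMeasure {n : ℕ} (Ω : Set (Space n)) : Measure (Space n × Dir n) :=
  (volume.restrict Ω).prod (sphereMeasure n)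

/-- `Γ₋`, the set of incoming boundary points and directions. -/
def gammaMinus {n : ℕ} (Ω : Set (Space n)) : Set (Space n × Dir n) :=
  {p | p.1 ∈ frontier Ω ∧ ⟪outerNormal Ω p.1, (p.2 : Space n)⟫ < 0}

/-- The measure `dξ = |n(x) · θ| dμ(x) dθ` on `Γ₋`. -/
def xiMinus {n : ℕ} (Ω : Set (Space n)) : Measure (Space n × Dir n) :=
  (((boundaryMeasure Ω).prod (sphereMeasure n)).restrict (gammaMinus Ω)).withDensity
    fun p => ENNReal.ofReal |⟪outerNormal Ω p.1, (p.2 : Space n)⟫|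

/-! ### The transport equation -/

/-- The angular average `⟨u⟩(x) = ∫ u(x, θ) dθ`. -/
def angularAvg {n : ℕ} (u : Space n → Dir n → ℝ) (x : Space n) : ℝ :=
  ∫ θ, u x θ ∂(sphereMeasure n)

/-- The scattering operator `Ku(x, θ) = ∫ k(x, θ', θ) u(x, θ') dθ'`. -/
def scatter {n : ℕ} (k : Space n → Dir n → Dir n → ℝ) (u : Space n → Dir n → ℝ)
    (x : Space n) (θ : Dir n) : ℝ :=
  ∫ θ', k x θ' θ * u x θ' ∂(sphereMeasure n)

/-- `g = θ · ∇ₓ u` on `Ω × 𝕊ⁿ⁻¹` in the sense of distributions. Test functions are the restrictions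
to `Ω × 𝕊ⁿ⁻¹` of the smooth functions on `ℝⁿ × ℝⁿ` with compact support in `Ω × ℝⁿ`. -/
def HasTransportDeriv {n : ℕ} (Ω : Set (Space n)) (u g : Space n → Dir n → ℝ) : Prop :=
  ∀ ψ : Space n × Space n → ℝ, ContDiff ℝ ((⊤ : ℕ∞) : WithTop ℕ∞) ψ → HasCompactSupport ψ →
    tsupport ψ ⊆ Ω ×ˢ univ →
    ∫ p, u p.1 p.2 * fderiv ℝ (fun y => ψ (y, (p.2 : Space n))) p.1 (p.2 : Space n)
        ∂(phaseMeasure Ω) =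
      -∫ p, g p.1 p.2 * ψ (p.1, (p.2 : Space n)) ∂(phaseMeasure Ω)

/-- `u` is a solution in `ℋ¹(Ω × 𝕊ⁿ⁻¹)` of
`θ · ∇ₓ u + (σ_a + σ_b |⟨u⟩|) u - K u = 0` in `Ω × 𝕊ⁿ⁻¹`, `u = f` on `Γ₋`.
A function of class `ℋ¹` is represented by a function on `closure Ω × 𝕊ⁿ⁻¹` that is continuous, up
to both end points, along almost every chord `{x + t θ}` of `Ω`; its values at the end points of
the chords are its traces on `Γ₋` and `Γ₊`. -/
structure IsSolution {n : ℕ} (Ω : Set (Space n)) (σa σb : Space n → Dir n → ℝ)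
    (k : Space n → Dir n → Dir n → ℝ) (f u : Space n → Dir n → ℝ) : Prop where
  integrable : Integrable (fun p : Space n × Dir n => u p.1 p.2) (phaseMeasure Ω)
  equation : ∃ g : Space n → Dir n → ℝ,
    Integrable (fun p : Space n × Dir n => g p.1 p.2) (phaseMeasure Ω) ∧
    HasTransportDeriv Ω u g ∧
    ∀ᵐ p ∂(phaseMeasure Ω),
      g p.1 p.2 + (σa p.1 p.2 + σb p.1 p.2 * |angularAvg u p.1|) * u p.1 p.2
        - scatter k u p.1 p.2 = 0
  continuous_chord : ∀ᵐ p ∂(phaseMeasure Ω),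
    ContinuousOn (fun t : ℝ => u (p.1 + t • (p.2 : Space n)) p.2)
      (Icc (-tauMinus Ω p.1 p.2) (tauPlus Ω p.1 p.2))
  boundary : ∀ᵐ p ∂(phaseMeasure Ω),
    u (p.1 - tauMinus Ω p.1 p.2 • (p.2 : Space n)) p.2 =
      f (p.1 - tauMinus Ω p.1 p.2 • (p.2 : Space n)) p.2

/-- The norm `‖f‖_* = ‖∫ |f(x - τ₋(x, θ) θ, θ)| dθ‖_{L^∞(Ω)}`, with values in `[0, ∞]`. -/
def starNorm {n : ℕ} (Ω : Set (Space n)) (f : Space n → Dir n → ℝ) : ℝ≥0∞ :=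
  essSup (fun x => ∫⁻ θ, ‖f (x - tauMinus Ω x θ • (θ : Space n)) θ‖ₑ ∂(sphereMeasure n))
    (volume.restrict Ω)

/-- Admissible tuples `(σ_a, σ_b, k, f)`. All the norms are `[0, ∞]`-valued `L^∞` norms. -/
structure Admissible {n : ℕ} (Ω : Set (Space n)) (σa σb : Space n → Dir n → ℝ)
    (k : Space n → Dir n → Dir n → ℝ) (f : Space n → Dir n → ℝ) : Prop where
  sigma_a_mem : MemLp (fun p : Space n × Dir n => σa p.1 p.2) ∞ (phaseMeasure Ω)
  sigma_a_nonneg : ∀ᵐ p ∂(phaseMeasure Ω), 0 ≤ σa p.1 p.2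
  sigma_b_mem : MemLp (fun p : Space n × Dir n => σb p.1 p.2) ∞ (phaseMeasure Ω)
  sigma_b_nonneg : ∀ᵐ p ∂(phaseMeasure Ω), 0 ≤ σb p.1 p.2
  k_mem : MemLp (fun p : Space n × Dir n × Dir n => k p.1 p.2.1 p.2.2) ∞
    ((volume.restrict Ω).prod ((sphereMeasure n).prod (sphereMeasure n)))
  k_nonneg : ∀ᵐ p ∂((volume.restrict Ω).prod ((sphereMeasure n).prod (sphereMeasure n))),
    0 ≤ k p.1 p.2.1 p.2.2
  f_integrable : Integrable (fun p : Space n × Dir n => f p.1 p.2) (xiMinus Ω)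
  f_star : starNorm Ω f < ∞
  small : ∃ μ ν : ℝ, 0 ≤ μ ∧ μ < 1 ∧ 0 ≤ ν ∧ ν < 1 ∧
    eLpNorm (fun p : Space n × Dir n => tau Ω p.1 p.2) ∞ (phaseMeasure Ω) *
      eLpNorm (fun p : Space n × Dir n × Dir n => k p.1 p.2.1 p.2.2) ∞
        ((volume.restrict Ω).prod ((sphereMeasure n).prod (sphereMeasure n)))
      ≤ ENNReal.ofReal μ ∧
    eLpNorm (fun p : Space n × Dir n => tau Ω p.1 p.2) ∞ (phaseMeasure Ω) *
      eLpNorm (fun p : Space n × Dir n => σb p.1 p.2) ∞ (phaseMeasure Ω) * starNorm Ω f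
      ≤ ENNReal.ofReal (ν * (1 - μ) ^ 2)

/-! ### Sources and test functions -/

/-- A cut-off function `h ∈ C₀^∞(B₁)` with `0 ≤ h ≤ 1` and `h = 1` near the origin. -/
structure IsCutoff {n : ℕ} (h : Space n → ℝ) : Prop where
  smooth : ContDiff ℝ ((⊤ : ℕ∞) : WithTop ℕ∞) h
  compact : HasCompactSupport h
  support : tsupport h ⊆ Metric.ball 0 1
  nonneg : ∀ x, 0 ≤ h x
  le_one : ∀ x, h x ≤ 1
  eq_one : ∀ᶠ x in 𝓝 0, h x = 1

/-- A profile `φ ∈ C₀^∞(-1, 1)` with `0 ≤ φ ≤ 1` and `∫ φ = 1`. -/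
structure IsProfile (φ : ℝ → ℝ) : Prop where
  smooth : ContDiff ℝ ((⊤ : ℕ∞) : WithTop ℕ∞) φ
  compact : HasCompactSupport φ
  support : tsupport φ ⊆ Ioo (-1) 1
  nonneg : ∀ t, 0 ≤ φ t
  le_one : ∀ t, φ t ≤ 1
  integral : ∫ t, φ t = 1

/-- `ω` is the constant `lim_{ε → 0} ∫ ε^{-(n-1)} h((θ - θ') / ε) dθ`, for every `θ'`, where `dθ` is
the normalized surface measure. -/
def IsMollifierConstant {n : ℕ} (h : Space n → ℝ) (ω : ℝ) : Prop :=
  ∀ θ' : Dir n, Tendsto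
    (fun ε : ℝ => ∫ θ : Dir n, 1 / ε ^ (n - 1) * h (ε⁻¹ • ((θ : Space n) - (θ' : Space n)))
      ∂(sphereMeasure n))
    (𝓝[>] 0) (𝓝 ω)

/-- The source
`f₋(x, θ; x', θ') = δ / (ω ω̃ ε^{n-1}) h((x - x') / ε') h((θ - θ') / ε)`. Here `ω` normalizes the
angular mollifier with respect to the normalized measure `dθ` and `ω̃ = |𝕊ⁿ⁻¹| ω`, the same constant
for the unnormalized surface measure, normalizes the boundary mollifier with respect to `dμ`. -/
def source {n : ℕ} (h : Space n → ℝ) (ω ε ε' δ : ℝ) (x' : Space n) (θ' : Dir n)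
    (x : Space n) (θ : Dir n) : ℝ :=
  δ / (ω * (sphereArea n * ω) * ε ^ (n - 1)) * h (ε'⁻¹ • (x - x')) *
    h (ε⁻¹ • ((θ : Space n) - (θ' : Space n)))

/-- The unit vector `θ'_⊥` of `span {θ, θ'}` orthogonal to `θ'` (for linearly independent `θ`, `θ'`;
its sign is chosen so that `θ · θ'_⊥ > 0`). -/
def perpDir {n : ℕ} (θ θ' : Dir n) : Space n :=
  ‖(θ : Space n) - ⟪(θ : Space n), (θ' : Space n)⟫ • (θ' : Space n)‖⁻¹ •
    ((θ : Space n) - ⟪(θ : Space n), (θ' : Space n)⟫ • (θ' : Space n))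

/-- The orthogonal projection `π_{θ,θ'}` of `ℝⁿ` onto `span {θ, θ'}`. -/
def planeProj {n : ℕ} (θ θ' : Dir n) (x : Space n) : Space n :=
  (Submodule.span ℝ {(θ : Space n), (θ' : Space n)}).starProjection x

/-- The test function
`φ_{γ₁,γ₂}(x, θ, θ') = γ₁⁻¹ φ((x · θ'_⊥) / (γ₁ θ · θ'_⊥)) h((x - π_{θ,θ'} x) / γ₂)`. -/
def testFun {n : ℕ} (φ : ℝ → ℝ) (h : Space n → ℝ) (γ₁ γ₂ : ℝ) (x : Space n) (θ θ' : Dir n) : ℝ :=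
  1 / γ₁ * φ (⟪x, perpDir θ θ'⟫ / (γ₁ * ⟪(θ : Space n), perpDir θ θ'⟫)) *
    h (γ₂⁻¹ • (x - planeProj θ θ' x))

/-- The rescaled outgoing data of a family `u x' θ'` of solutions, tested against `φ_{γ₁,γ₂}`, as a
function of `(x, θ, θ')`. -/
def testedData {n : ℕ} (Ω : Set (Space n)) (φ : ℝ → ℝ) (h : Space n → ℝ)
    (γ₁ γ₂ ε' δ : ℝ) (u : Space n → Dir n → Space n → Dir n → ℝ)
    (p : Space n × Dir n × Dir n) : ℝ :=
  ∫ x', u x' p.2.2 (p.1 + tauPlus Ω p.1 p.2.1 • (p.2.1 : Space n)) p.2.1 / (ε' ^ (n - 1) * δ) *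
      testFun φ h γ₁ γ₂ (x' - p.1 + tauMinus Ω p.1 p.2.2 • (p.2.2 : Space n)) p.2.1 p.2.2
    ∂(boundaryMeasure Ω)

/-! ### Convergence in `L¹_loc` -/

/-- The set of `(x, θ, θ')` such that `x ∈ Ω` and `θ`, `θ'` are not parallel. -/
def nonparallelSet {n : ℕ} (Ω : Set (Space n)) : Set (Space n × Dir n × Dir n) :=
  {p | p.1 ∈ Ω ∧ LinearIndependent ℝ ![(p.2.1 : Space n), (p.2.2 : Space n)]}

/-- The measure `dx dθ dθ'`. -/
def tripleMeasure (n : ℕ) : Measure (Space n × Dir n × Dir n) :=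
  (volume : Measure (Space n)).prod ((sphereMeasure n).prod (sphereMeasure n))

/-- `F t → G` in `L¹_loc` of the nonparallel set as `t ↓ 0`. -/
def TendstoL1Loc {n : ℕ} (Ω : Set (Space n)) (F : ℝ → Space n × Dir n × Dir n → ℝ)
    (G : Space n × Dir n × Dir n → ℝ) : Prop :=
  (∀ᶠ t in 𝓝[>] (0 : ℝ), LocallyIntegrableOn (F t) (nonparallelSet Ω) (tripleMeasure n)) ∧
  LocallyIntegrableOn G (nonparallelSet Ω) (tripleMeasure n) ∧
  ∀ K : Set (Space n × Dir n × Dir n), K ⊆ nonparallelSet Ω → IsCompact K →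
    Tendsto (fun t => ∫ p in K, |F t p - G p| ∂(tripleMeasure n)) (𝓝[>] 0) (𝓝 0)

end RTE

end

open RTE

/-! ### Chords of a bounded open convex set. -/

namespace RTE
variable {n : ℕ} {Ω : Set (Space n)}

/-! Integrate the equation along chords. By Duhamel's formula the solution is the attenuated
boundary value (the ballistic part) plus the attenuated integral of the scattered source over the
chord. Applying `K` to this formula gives a fixed point equation for the scattered source. Since the
sup of `τ` times the sup of `k` is below one, its Neumann series converges: the outgoing value of
the linear problem (`linExit`) is the ballistic part plus the integral of `K(ballistic part)`
against `totalKernel`, a sum over the number of collisions of positive measures on backward paths.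
The end point of such a path is the place of the first collision in time. Both the mass of
`totalKernel` and its action on `L¹` of phase space are bounded by a geometric series, so it can be
used with coefficients that are only bounded and measurable. Each of the five limits then removes
one feature.

For `δ`: the source has size `δ`, and the contraction bounds the angular averages of `|u|` by a
multiple of `δ` almost everywhere (`lintegral_angle_le`). The nonlinear term is therefore of order
`δ²` in `L¹`, and after division by `δ` only the linear response is left
(`lintegral_exit_sub_linExit_le`, `tendstoL1Loc_linearize`).

For `ε`: on a compact set of non-parallel directions the ballistic part vanishes as soon as `ε` is
below the distance of `θ` and `θ'`. What remains is a mollification in the incoming direction, which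
converges in `L¹` of the sphere (`tendsto_moll`, `tendstoL1Loc_angular`).

For `ε'`: the boundary mollifier forces `x'` to be the entry point of the particle that collides
first. A `C¹` boundary looks like its tangent plane at small scales, so the normalizing constant is
the integral of `h` over a tangent plane. Blowing up the sphere in the same way identifies this
integral with `ω̃` (`HasC1Boundary.tendsto_blowup`, `IsMollifierConstant.integral_tangent`,
`tendstoL1Loc_smear`).

For `γ₂`: the cut-off in the test function confines the first collision to the plane through `x`
spanned by `θ` and `θ'`. Paths with one collision lie in that plane. After two or more collisions
the first one is almost surely off it, because two directions do not span `ℝⁿ` when `n ≥ 3`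
(`collKernel_plane`, `tendstoL1Loc_thin`).

For `γ₁`: on singly scattered paths the test function is an approximate identity in the position of
the collision along the chord, so the limit is the single scattering amplitude at `x`; the
convergence is the continuity of translations in `L¹` (`tendstoL1Loc_short`). -/

lemma norm_dir (θ : Dir n) : ‖(θ : Space n)‖ = 1 := by simp

lemma tauMinus_eq_tauPlus_neg (x : Space n) (θ : Dir n) :
    tauMinus Ω x θ = tauPlus Ω x (-θ) := by
  simp [tauMinus, tauPlus, sub_eq_add_neg]

lemma continuous_chord_point (x : Space n) (θ : Dir n) :
    Continuous fun t : ℝ => x + t • (θ : Space n) := by fun_prop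

/-- A ray is connected and unbounded, so it cannot stay in `Ω` and has to meet the frontier;
closedness makes the infimum attained. Hence the default value `sInf ∅ = 0` never occurs for points
of `Ω`. -/
lemma isLeast_tauPlus (ho : IsOpen Ω) (hb : Bornology.IsBounded Ω) {x : Space n} (hx : x ∈ Ω)
    (θ : Dir n) :
    IsLeast {t : ℝ | 0 ≤ t ∧ x + t • (θ : Space n) ∈ frontier Ω} (tauPlus Ω x θ) := by
  have hcl : IsClosed {t : ℝ | 0 ≤ t ∧ x + t • (θ : Space n) ∈ frontier Ω} :=
    isClosed_Ici.inter (isClosed_frontier.preimage (continuous_chord_point x θ))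
  refine ⟨hcl.csInf_mem ?_ ⟨0, fun t ht => ht.1⟩, fun t ht => csInf_le ⟨0, fun t ht => ht.1⟩ ht⟩
  obtain ⟨R, hR⟩ := hb.subset_closedBall x
  by_contra hne
  rw [Set.not_nonempty_iff_eq_empty] at hne
  have hpre : IsPreconnected ((fun t : ℝ => x + t • (θ : Space n)) '' Ici 0) :=
    isPreconnected_Ici.image _ (continuous_chord_point x θ).continuousOn
  have hsub : ((fun t : ℝ => x + t • (θ : Space n)) '' Ici 0) ⊆ Ω := by
    have h1 : ((fun t : ℝ => x + t • (θ : Space n)) '' Ici 0) ⊆ Ω ∪ (closure Ω)ᶜ := by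
      rintro _ ⟨t, ht, rfl⟩
      by_contra hcon
      rw [mem_union, not_or, notMem_compl_iff] at hcon
      have : t ∈ {t : ℝ | 0 ≤ t ∧ x + t • (θ : Space n) ∈ frontier Ω} :=
        ⟨ht, by rw [ho.frontier_eq]; exact ⟨hcon.2, hcon.1⟩⟩
      rw [hne] at this
      exact this
    refine hpre.subset_left_of_subset_union ho isClosed_closure.isOpen_compl
      (disjoint_left.2 fun y hy hy' => hy' (subset_closure hy)) h1 ⟨x, ⟨0, by simp, by simp⟩, hx⟩
  have h2 := hR (hsub ⟨|R| + 1, by simp; positivity, rfl⟩)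
  simp [norm_smul] at h2
  rw [abs_of_nonneg (by positivity)] at h2
  linarith [le_abs_self R]

lemma tauPlus_nonneg (x : Space n) (θ : Dir n) : 0 ≤ tauPlus Ω x θ :=
  Real.sInf_nonneg fun _ ht => ht.1

lemma exit_mem_frontier (ho : IsOpen Ω) (hb : Bornology.IsBounded Ω) {x : Space n} (hx : x ∈ Ω)
    (θ : Dir n) : x + tauPlus Ω x θ • (θ : Space n) ∈ frontier Ω :=
  (isLeast_tauPlus ho hb hx θ).1.2

/-- Beyond the first frontier point convexity forbids a return to `Ω`, since that frontier point
would lie on a segment joining two points of `Ω`. Before it, connectedness keeps the segment inside.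
-/
lemma chord_nonneg_mem_iff (ho : IsOpen Ω) (hb : Bornology.IsBounded Ω) (hc : Convex ℝ Ω)
    {x : Space n} (hx : x ∈ Ω) (θ : Dir n) {t : ℝ} (ht : 0 ≤ t) :
    x + t • (θ : Space n) ∈ Ω ↔ t < tauPlus Ω x θ := by
  have hl := isLeast_tauPlus ho hb hx θ
  constructor
  · intro hmem
    by_contra hlt
    rw [not_lt] at hlt
    have hfr := hl.1.2
    rw [ho.frontier_eq] at hfr
    apply hfr.2
    rcases ht.eq_or_lt with h0 | h0
    · subst h0
      have : tauPlus Ω x θ = 0 := le_antisymm hlt hl.1.1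
      simpa [this] using hx
    · have := hc hx hmem (a := 1 - tauPlus Ω x θ / t) (b := tauPlus Ω x θ / t)
        (by rw [sub_nonneg, div_le_one h0]; exact hlt) (div_nonneg hl.1.1 ht) (by ring)
      convert this using 1
      rw [smul_add, smul_smul, div_mul_cancel₀ _ h0.ne', sub_smul, one_smul]
      abel
  · intro hlt
    have hpre : IsPreconnected ((fun t : ℝ => x + t • (θ : Space n)) '' Icc 0 t) :=
      isPreconnected_Icc.image _ (continuous_chord_point x θ).continuousOn
    have hsub : ((fun t : ℝ => x + t • (θ : Space n)) '' Icc 0 t) ⊆ Ω := by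
      have h1 : ((fun t : ℝ => x + t • (θ : Space n)) '' Icc 0 t) ⊆ Ω ∪ (closure Ω)ᶜ := by
        rintro _ ⟨s, hs, rfl⟩
        by_contra hcon
        rw [mem_union, not_or, notMem_compl_iff] at hcon
        have := hl.2 (show s ∈ {t : ℝ | 0 ≤ t ∧ x + t • (θ : Space n) ∈ frontier Ω} from
          ⟨hs.1, by rw [ho.frontier_eq]; exact ⟨hcon.2, hcon.1⟩⟩)
        linarith [hs.2]
      exact hpre.subset_left_of_subset_union ho isClosed_closure.isOpen_compl
        (disjoint_left.2 fun y hy hy' => hy' (subset_closure hy)) h1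
        ⟨x, ⟨0, by simp [ht], by simp⟩, hx⟩
    exact hsub ⟨t, ⟨ht, le_rfl⟩, rfl⟩

/-- The parameters of the points of `Ω` on the line through `x` in the direction `θ`. -/
lemma chord_mem_iff (ho : IsOpen Ω) (hb : Bornology.IsBounded Ω) (hc : Convex ℝ Ω)
    {x : Space n} (hx : x ∈ Ω) (θ : Dir n) {t : ℝ} :
    x + t • (θ : Space n) ∈ Ω ↔ t ∈ Ioo (-tauMinus Ω x θ) (tauPlus Ω x θ) := by
  rcases le_total 0 t with ht | ht
  · rw [chord_nonneg_mem_iff ho hb hc hx θ ht, mem_Ioo]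
    refine ⟨fun h => ⟨?_, h⟩, fun h => h.2⟩
    have : (0:ℝ) < tauMinus Ω x θ := by
      rw [tauMinus_eq_tauPlus_neg, ← chord_nonneg_mem_iff ho hb hc hx _ le_rfl]; simpa using hx
    linarith
  · have h1 := chord_nonneg_mem_iff ho hb hc hx (-θ) (t := -t) (by linarith)
    have h0 : (0:ℝ) < tauPlus Ω x θ := by
      rw [← chord_nonneg_mem_iff ho hb hc hx _ le_rfl]; simpa using hx
    rw [← tauMinus_eq_tauPlus_neg] at h1
    have h2 : x + -t • ((-θ : Dir n) : Space n) = x + t • (θ : Space n) := by simp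
    rw [h2] at h1
    rw [h1, mem_Ioo]
    constructor
    · intro h; constructor <;> linarith
    · intro h; linarith [h.1]

lemma tauPlus_pos (ho : IsOpen Ω) (hb : Bornology.IsBounded Ω) (hc : Convex ℝ Ω)
    {x : Space n} (hx : x ∈ Ω) (θ : Dir n) : 0 < tauPlus Ω x θ := by
  rw [← chord_nonneg_mem_iff ho hb hc hx _ le_rfl]; simpa using hx

lemma tauMinus_pos (ho : IsOpen Ω) (hb : Bornology.IsBounded Ω) (hc : Convex ℝ Ω)
    {x : Space n} (hx : x ∈ Ω) (θ : Dir n) : 0 < tauMinus Ω x θ := by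
  rw [tauMinus_eq_tauPlus_neg]; exact tauPlus_pos ho hb hc hx _

lemma entry_mem_frontier (ho : IsOpen Ω) (hb : Bornology.IsBounded Ω) {x : Space n} (hx : x ∈ Ω)
    (θ : Dir n) : x - tauMinus Ω x θ • (θ : Space n) ∈ frontier Ω := by
  have := exit_mem_frontier ho hb hx (-θ)
  rw [tauMinus_eq_tauPlus_neg]
  simpa [sub_eq_add_neg] using this


lemma setOf_chord_mem (ho : IsOpen Ω) (hb : Bornology.IsBounded Ω) (hc : Convex ℝ Ω)
    {x : Space n} (hx : x ∈ Ω) (θ : Dir n) :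
    {t : ℝ | x + t • (θ : Space n) ∈ Ω} = Ioo (-tauMinus Ω x θ) (tauPlus Ω x θ) :=
  Set.ext fun _ => chord_mem_iff ho hb hc hx θ

/-- The length of the part of `Ω` ahead of `x` in the direction `θ`, as a measurable function. -/
noncomputable def lenPlus (Ω : Set (Space n)) (p : Space n × Dir n) : ℝ :=
  (volume {t : ℝ | 0 < t ∧ p.1 + t • (p.2 : Space n) ∈ Ω}).toReal

/-- Section measures of a measurable set depend measurably on the base point, which is not apparent
for an infimum over frontier points. The two quantities agree at points of `Ω`. -/
lemma measurable_lenPlus (ho : IsOpen Ω) : Measurable (lenPlus Ω) := by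
  have : MeasurableSet
      {q : (Space n × Dir n) × ℝ | 0 < q.2 ∧ q.1.1 + q.2 • (q.1.2 : Space n) ∈ Ω} :=
    (measurableSet_lt measurable_const measurable_snd).inter
      (ho.preimage (by fun_prop : Continuous fun q : (Space n × Dir n) × ℝ =>
        q.1.1 + q.2 • (q.1.2 : Space n))).measurableSet
  exact (measurable_measure_prodMk_left this).ennreal_toReal

lemma lenPlus_eq (ho : IsOpen Ω) (hb : Bornology.IsBounded Ω) (hc : Convex ℝ Ω)
    {x : Space n} (hx : x ∈ Ω) (θ : Dir n) : lenPlus Ω (x, θ) = tauPlus Ω x θ := by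
  have : {t : ℝ | 0 < t ∧ x + t • (θ : Space n) ∈ Ω} = Ioo 0 (tauPlus Ω x θ) := by
    ext t
    simp only [mem_ofPred_eq, mem_Ioo]
    exact and_congr_right fun ht => chord_nonneg_mem_iff ho hb hc hx θ ht.le
  simp [lenPlus, this, Real.volume_Ioo, ENNReal.toReal_ofReal (tauPlus_nonneg x θ)]

/-- The length of the part of `Ω` behind `x` in the direction `θ`, as a measurable function. -/
noncomputable def lenMinus (Ω : Set (Space n)) (p : Space n × Dir n) : ℝ := lenPlus Ω (p.1, -p.2)

lemma measurable_lenMinus (ho : IsOpen Ω) : Measurable (lenMinus Ω) :=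
  (measurable_lenPlus ho).comp (by
    refine measurable_fst.prodMk ?_
    exact (continuous_neg.comp continuous_snd :
      Continuous fun p : Space n × Dir n => -p.2).measurable)

lemma lenMinus_eq (ho : IsOpen Ω) (hb : Bornology.IsBounded Ω) (hc : Convex ℝ Ω)
    {x : Space n} (hx : x ∈ Ω) (θ : Dir n) : lenMinus Ω (x, θ) = tauMinus Ω x θ := by
  rw [lenMinus, lenPlus_eq ho hb hc hx, tauMinus_eq_tauPlus_neg]

lemma volume_chord (ho : IsOpen Ω) (hb : Bornology.IsBounded Ω) (hc : Convex ℝ Ω)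
    {x : Space n} (hx : x ∈ Ω) (θ : Dir n) :
    volume {t : ℝ | x + t • (θ : Space n) ∈ Ω} = ENNReal.ofReal (tau Ω x θ) := by
  rw [setOf_chord_mem ho hb hc hx, Real.volume_Ioo, tau]; congr 1; ring

lemma tauPlus_le (ho : IsOpen Ω) (hb : Bornology.IsBounded Ω) {R : ℝ}
    (hR : Ω ⊆ Metric.closedBall 0 R) {x : Space n} (hx : x ∈ Ω) (θ : Dir n) :
    tauPlus Ω x θ ≤ 2 * R := by
  have h1 := exit_mem_frontier ho hb hx θ
  have h2 : ∀ y ∈ closure Ω, ‖y‖ ≤ R := fun y hy => by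
    simpa using closure_minimal hR Metric.isClosed_closedBall hy
  have h3 := h2 _ (frontier_subset_closure h1)
  have h4 := h2 _ (subset_closure hx)
  calc tauPlus Ω x θ = ‖(x + tauPlus Ω x θ • (θ : Space n)) - x‖ := by
        simp [norm_smul, abs_of_nonneg (tauPlus_nonneg (Ω := Ω) x θ)]
    _ ≤ R + R := (norm_sub_le _ _).trans (add_le_add h3 h4)
    _ = 2 * R := by ring

/-! ### The sphere measure and the phase space measure. -/

instance [NeZero n] : Nontrivial (Space n) := by
  have : Nonempty (Fin n) := ⟨0⟩
  infer_instance

instance [NeZero n] : IsProbabilityMeasure (sphereMeasure n) := by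
  constructor
  have h0 : (volume : Measure (Space n)).toSphere univ ≠ 0 := by
    rw [Ne, Measure.measure_univ_eq_zero]; exact Measure.toSphere_ne_zero _
  simp only [sphereMeasure, Measure.smul_apply, smul_eq_mul]
  exact ENNReal.inv_mul_cancel h0 (measure_ne_top _ _)

instance : SFinite (sphereMeasure n) := by unfold sphereMeasure; infer_instance

instance [NeZero n] : (sphereMeasure n).IsOpenPosMeasure := by
  constructor
  intro U hU hne
  simp only [sphereMeasure, Measure.smul_apply, smul_eq_mul]
  exact mul_ne_zero (ENNReal.inv_ne_zero.2 (measure_ne_top _ _)) (hU.measure_ne_zero _ hne)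

lemma phaseMeasure_eq (Ω : Set (Space n)) :
    phaseMeasure Ω =
      ((volume : Measure (Space n)).prod (sphereMeasure n)).restrict (Ω ×ˢ univ) := by
  rw [phaseMeasure, ← Measure.prod_restrict, Measure.restrict_univ]

lemma isFiniteMeasure_restrict (hb : Bornology.IsBounded Ω) :
    IsFiniteMeasure ((volume : Measure (Space n)).restrict Ω) :=
  ⟨by simpa using hb.measure_lt_top⟩

lemma isFiniteMeasure_phase [NeZero n] (hb : Bornology.IsBounded Ω) :
    IsFiniteMeasure (phaseMeasure Ω) := by
  have := isFiniteMeasure_restrict hb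
  unfold phaseMeasure; infer_instance

lemma ae_phase_mem (ho : IsOpen Ω) : ∀ᵐ p ∂phaseMeasure Ω, p.1 ∈ Ω := by
  rw [phaseMeasure_eq]
  filter_upwards [ae_restrict_mem (ho.measurableSet.prod MeasurableSet.univ)] with p hp using hp.1

/-- An almost sure bound on the chord lengths holds everywhere, as they are lower semicontinuous. -/
lemma tau_le_of_ae [NeZero n] (ho : IsOpen Ω) (hb : Bornology.IsBounded Ω) (hc : Convex ℝ Ω) {M : ℝ}
    (hM : ∀ᵐ p ∂phaseMeasure Ω, tau Ω p.1 p.2 ≤ M) {x : Space n} (hx : x ∈ Ω) (θ : Dir n) :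
    tau Ω x θ ≤ M := by
  -- Two points of `Ω` on the chord at distance more than `M` stay in `Ω` when `(x, θ)` is moved
  -- slightly. The chords would then be too long on a nonempty open set, which has positive measure.
  by_contra! hlt
  obtain ⟨t1, t2, h1, h2, h12⟩ : ∃ t1 t2 : ℝ, t1 ∈ Ioo (-tauMinus Ω x θ) (tauPlus Ω x θ) ∧
      t2 ∈ Ioo (-tauMinus Ω x θ) (tauPlus Ω x θ) ∧ M < t2 - t1 := by
    have ha := tauMinus_pos ho hb hc hx θ
    have hb := tauPlus_pos ho hb hc hx θ
    rw [tau] at hlt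
    obtain ⟨η, hη0, hη⟩ : ∃ η > 0, η < min (min (tauMinus Ω x θ) (tauPlus Ω x θ))
        ((tauMinus Ω x θ + tauPlus Ω x θ - M) / 2) :=
      exists_between (lt_min (lt_min ha hb) (by linarith))
    rw [lt_min_iff, lt_min_iff] at hη
    exact ⟨-tauMinus Ω x θ + η, tauPlus Ω x θ - η, ⟨by linarith, by linarith⟩,
      ⟨by linarith, by linarith⟩, by linarith⟩
  rw [← chord_mem_iff ho hb hc hx] at h1 h2
  let W : Set (Space n × Dir n) := {p | p.1 ∈ Ω ∧ p.1 + t1 • (p.2 : Space n) ∈ Ω ∧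
    p.1 + t2 • (p.2 : Space n) ∈ Ω}
  have hW : IsOpen W := (ho.preimage continuous_fst).inter
    ((ho.preimage (by fun_prop : Continuous fun p : Space n × Dir n =>
      p.1 + t1 • (p.2 : Space n))).inter
    (ho.preimage (by fun_prop : Continuous fun p : Space n × Dir n => p.1 + t2 • (p.2 : Space n))))
  have hpos : phaseMeasure Ω W ≠ 0 := by
    rw [phaseMeasure_eq, Measure.restrict_apply hW.measurableSet,
      inter_eq_self_of_subset_left (show W ⊆ Ω ×ˢ univ from fun p hp => ⟨hp.1, trivial⟩)]
    exact hW.measure_ne_zero _ ⟨(x, θ), hx, h1, h2⟩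
  apply hpos
  refine measure_mono_null (fun p hp => ?_) hM
  have e1 := (chord_mem_iff ho hb hc hp.1 p.2).1 hp.2.1
  have e2 := (chord_mem_iff ho hb hc hp.1 p.2).1 hp.2.2
  simp only [mem_compl_iff, mem_ofPred_eq, not_le, tau]
  linarith [e1.1, e2.2]

end RTE

/-! ### Media, attenuation, and the kernels of exit and collision. -/

namespace RTE
open ProbabilityTheory

section WeightedKernel
variable {Z T Z' : Type*} [MeasurableSpace Z] [MeasurableSpace T] [MeasurableSpace Z']

/-- The kernel `z ↦ ∫ r(z, t) δ_{m(z, t)} dl(t)`. -/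
noncomputable def weightedKernel (l : Measure T) [SFinite l] (r : Z × T → ℝ) (hr : Measurable r)
    (m : Z × T → Z') (hm : Measurable m) : Kernel Z Z' where
  toFun z := (l.withDensity fun t => ENNReal.ofReal (r (z, t))).map fun t => m (z, t)
  measurable' := by
    refine Measure.measurable_of_measurable_coe _ fun s hs => ?_
    have : ∀ z, ((l.withDensity fun t => ENNReal.ofReal (r (z, t))).map fun t => m (z, t)) s =
        ∫⁻ t, (m ⁻¹' s).indicator (fun q => ENNReal.ofReal (r q)) (z, t) ∂l := by
      intro z
      have hm' : Measurable fun t => m (z, t) := hm.comp measurable_prodMk_left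
      rw [Measure.map_apply hm' hs, withDensity_apply _ (hm' hs), ← lintegral_indicator (hm' hs)]
      rfl
    simp_rw [this]
    exact (hr.ennreal_ofReal.indicator (hm hs)).lintegral_prod_right'

variable {l : Measure T} [SFinite l] {r : Z × T → ℝ} {hr : Measurable r}
  {m : Z × T → Z'} {hm : Measurable m}

lemma weightedKernel_apply (z : Z) : weightedKernel l r hr m hm z =
    (l.withDensity fun t => ENNReal.ofReal (r (z, t))).map fun t => m (z, t) := rfl

lemma lintegral_weightedKernel (z : Z) {f : Z' → ℝ≥0∞} (hf : Measurable f) :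
    ∫⁻ y, f y ∂(weightedKernel l r hr m hm z) =
      ∫⁻ t, ENNReal.ofReal (r (z, t)) * f (m (z, t)) ∂l := by
  have hm' : Measurable fun t => m (z, t) := hm.comp measurable_prodMk_left
  have hr' : Measurable fun t => ENNReal.ofReal (r (z, t)) :=
    (hr.comp measurable_prodMk_left).ennreal_ofReal
  have hf' : Measurable fun t => f (m (z, t)) := hf.comp hm'
  rw [weightedKernel_apply, lintegral_map hf hm', lintegral_withDensity_eq_lintegral_mul _ hr' hf']
  rfl

lemma integral_weightedKernel (h0 : ∀ q, 0 ≤ r q) (z : Z) {f : Z' → ℝ} (hf : Measurable f) :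
    ∫ y, f y ∂(weightedKernel l r hr m hm z) = ∫ t, r (z, t) * f (m (z, t)) ∂l := by
  have hm' : Measurable fun t => m (z, t) := hm.comp measurable_prodMk_left
  have hr' : Measurable fun t => ENNReal.ofReal (r (z, t)) :=
    (hr.comp measurable_prodMk_left).ennreal_ofReal
  rw [weightedKernel_apply, integral_map hm'.aemeasurable
    hf.aestronglyMeasurable, integral_withDensity_eq_integral_toReal_smul hr' (by simp)]
  simp [h0, ENNReal.toReal_ofReal]

lemma ae_weightedKernel (z : Z) {p : Z' → Prop} (hp : MeasurableSet {y | p y})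
    (h : ∀ᵐ t ∂l, p (m (z, t))) : ∀ᵐ y ∂(weightedKernel l r hr m hm z), p y := by
  have hm' : Measurable fun t => m (z, t) := hm.comp measurable_prodMk_left
  rw [weightedKernel_apply, ae_map_iff hm'.aemeasurable hp]
  exact (withDensity_absolutelyContinuous _ _).ae_le h
end WeightedKernel

/-- The coefficients of the linear transport equation: measurable bounded representatives that
vanish off `Ω`, with a bound `M` on the chord lengths such that scattering is a contraction. -/
structure Medium {n : ℕ} (Ω : Set (Space n)) where
  isOpen : IsOpen Ω
  bounded : Bornology.IsBounded Ω
  convex : Convex ℝ Ω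
  sg : Space n × Dir n → ℝ
  kk : Space n × Dir n × Dir n → ℝ
  Cs : ℝ
  Ck : ℝ
  M : ℝ
  sg_meas : Measurable sg
  sg_nonneg : ∀ p, 0 ≤ sg p
  sg_le : ∀ p, sg p ≤ Cs
  sg_zero : ∀ p, p.1 ∉ Ω → sg p = 0
  kk_meas : Measurable kk
  kk_nonneg : ∀ p, 0 ≤ kk p
  kk_le : ∀ p, kk p ≤ Ck
  kk_zero : ∀ p, p.1 ∉ Ω → kk p = 0
  Ck_nonneg : 0 ≤ Ck
  M_nonneg : 0 ≤ M
  tau_le : ∀ x ∈ Ω, ∀ θ : Dir n, tau Ω x θ ≤ M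
  lt_one : Ck * M < 1

namespace Medium
variable {n : ℕ} {Ω : Set (Space n)} (A : Medium Ω)

/-- Attenuation along the segment from `x - sθ` to `x`. -/
noncomputable def seg (q : (Space n × Dir n) × ℝ) : ℝ :=
  Real.exp (-∫ r, (Ioc 0 q.2).indicator (fun r => A.sg (q.1.1 - r • (q.1.2 : Space n), q.1.2)) r)

/-- Attenuation from `x` to the boundary in the direction `θ`. -/
noncomputable def fwd (p : Space n × Dir n) : ℝ :=
  Real.exp (-∫ r in Ioi (0 : ℝ), A.sg (p.1 + r • (p.2 : Space n), p.2))

/-- Attenuation from the boundary to `x` in the direction `θ`. -/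
noncomputable def bwd (p : Space n × Dir n) : ℝ :=
  Real.exp (-∫ r in Ioi (0 : ℝ), A.sg (p.1 - r • (p.2 : Space n), p.2))

lemma measurable_seg : Measurable A.seg := by
  have h : Measurable fun w : ((Space n × Dir n) × ℝ) × ℝ =>
      (Ioc 0 w.1.2).indicator (fun r => A.sg (w.1.1.1 - r • (w.1.1.2 : Space n), w.1.1.2)) w.2 := by
    have h1 : Measurable fun w : ((Space n × Dir n) × ℝ) × ℝ =>
        A.sg (w.1.1.1 - w.2 • (w.1.1.2 : Space n), w.1.1.2) := A.sg_meas.comp (by fun_prop)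
    have h2 : MeasurableSet {w : ((Space n × Dir n) × ℝ) × ℝ | 0 < w.2 ∧ w.2 ≤ w.1.2} :=
      (measurableSet_lt measurable_const measurable_snd).inter
        (measurableSet_le measurable_snd measurable_fst.snd)
    exact h1.indicator h2
  exact Real.measurable_exp.comp (h.stronglyMeasurable.integral_prod_right').measurable.neg

/-- Because `sg` vanishes off `Ω`, the integral may run over the whole half line instead of stopping
at `τ₊`; joint measurability is then that of a parameter integral. -/
lemma measurable_fwd : Measurable A.fwd := by
  have h1 : Measurable fun w : (Space n × Dir n) × ℝ =>
        A.sg (w.1.1 + w.2 • (w.1.2 : Space n), w.1.2) := A.sg_meas.comp (by fun_prop)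
  exact Real.measurable_exp.comp (h1.stronglyMeasurable.integral_prod_right').measurable.neg

lemma measurable_bwd : Measurable A.bwd := by
  have h1 : Measurable fun w : (Space n × Dir n) × ℝ =>
        A.sg (w.1.1 - w.2 • (w.1.2 : Space n), w.1.2) := A.sg_meas.comp (by fun_prop)
  exact Real.measurable_exp.comp (h1.stronglyMeasurable.integral_prod_right').measurable.neg

lemma seg_nonneg (q) : 0 ≤ A.seg q := (Real.exp_pos _).le
lemma fwd_nonneg (q) : 0 ≤ A.fwd q := (Real.exp_pos _).le
lemma bwd_nonneg (q) : 0 ≤ A.bwd q := (Real.exp_pos _).le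

lemma seg_le_one (q) : A.seg q ≤ 1 := Real.exp_le_one_iff.2 <| neg_nonpos.2 <|
  integral_nonneg fun _ => indicator_nonneg (fun _ _ => A.sg_nonneg _) _
lemma fwd_le_one (q) : A.fwd q ≤ 1 := Real.exp_le_one_iff.2 <| neg_nonpos.2 <|
  integral_nonneg fun _ => A.sg_nonneg _
lemma bwd_le_one (q) : A.bwd q ≤ 1 := Real.exp_le_one_iff.2 <| neg_nonpos.2 <|
  integral_nonneg fun _ => A.sg_nonneg _

/-- The indicator function of `Ω`. -/
noncomputable def ind (Ω : Set (Space n)) (x : Space n) : ℝ := Ω.indicator 1 x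

lemma measurable_ind (ho : IsOpen Ω) : Measurable (ind Ω) :=
  measurable_one.indicator ho.measurableSet
lemma ind_nonneg (x : Space n) : 0 ≤ ind Ω x := indicator_nonneg (fun _ _ => zero_le_one) _
lemma ind_le_one (x : Space n) : ind Ω x ≤ 1 := indicator_le_self' (by simp) x
lemma ind_mem {x : Space n} (hx : x ∈ Ω) : ind Ω x = 1 := indicator_of_mem hx _
lemma ind_notMem {x : Space n} (hx : x ∉ Ω) : ind Ω x = 0 := indicator_of_notMem hx _

/-- The density of the kernel `exitKernel`. -/
noncomputable def exitDensity (q : (Space n × Dir n) × ℝ) : ℝ :=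
  ind Ω q.1.1 * ind Ω (q.1.1 + q.2 • (q.1.2 : Space n)) *
    A.fwd (q.1.1 + q.2 • (q.1.2 : Space n), q.1.2)

lemma measurable_exitDensity : Measurable A.exitDensity :=
  (((measurable_ind A.isOpen).comp (by fun_prop)).mul
    ((measurable_ind A.isOpen).comp (by fun_prop))).mul (A.measurable_fwd.comp (by fun_prop))

lemma exitDensity_nonneg (q) : 0 ≤ A.exitDensity q :=
  mul_nonneg (mul_nonneg (ind_nonneg _) (ind_nonneg _)) (A.fwd_nonneg _)

lemma exitDensity_le (q : (Space n × Dir n) × ℝ) :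
    A.exitDensity q ≤ ind Ω (q.1.1 + q.2 • (q.1.2 : Space n)) := by
  have := mul_le_mul (mul_le_mul (ind_le_one (Ω := Ω) q.1.1)
    (le_refl (ind Ω (q.1.1 + q.2 • (q.1.2 : Space n)))) (ind_nonneg _) zero_le_one)
    (A.fwd_le_one (q.1.1 + q.2 • (q.1.2 : Space n), q.1.2)) (A.fwd_nonneg _)
    (by rw [one_mul]; exact ind_nonneg _)
  simpa [exitDensity] using this

/-- Integration along the chord through `x` in the direction `θ`, attenuated up to the exit. -/
noncomputable def exitKernel : Kernel (Space n × Dir n) (Space n × Dir n) :=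
  -- The parameter runs over all of `ℝ`: the value at the exit point collects the sources on the
  -- whole chord, behind `x` as well as ahead of it.
  weightedKernel volume A.exitDensity A.measurable_exitDensity
    (fun q => (q.1.1 + q.2 • (q.1.2 : Space n), q.1.2)) (by fun_prop)

/-- The density of the kernel `collKernel`. -/
noncomputable def collDensity (q : (Space n × Dir n) × (Dir n × ℝ)) : ℝ :=
  A.kk (q.1.1, q.2.1, q.1.2) * ind Ω (q.1.1 - q.2.2 • (q.2.1 : Space n)) *
    A.seg ((q.1.1, q.2.1), q.2.2)

lemma measurable_collDensity : Measurable A.collDensity :=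
  ((A.kk_meas.comp (by fun_prop)).mul
    ((measurable_ind A.isOpen).comp (by fun_prop))).mul (A.measurable_seg.comp (by fun_prop))

lemma collDensity_nonneg (q) : 0 ≤ A.collDensity q :=
  mul_nonneg (mul_nonneg (A.kk_nonneg _) (ind_nonneg _)) (A.seg_nonneg _)

lemma collDensity_le (q : (Space n × Dir n) × (Dir n × ℝ)) :
    A.collDensity q ≤ A.Ck * ind Ω (q.1.1 - q.2.2 • (q.2.1 : Space n)) := by
  have := mul_le_mul (mul_le_mul (A.kk_le (q.1.1, q.2.1, q.1.2))
    (le_refl (ind Ω (q.1.1 - q.2.2 • (q.2.1 : Space n)))) (ind_nonneg _) A.Ck_nonneg)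
    (A.seg_le_one ((q.1.1, q.2.1), q.2.2)) (A.seg_nonneg _)
    (mul_nonneg A.Ck_nonneg (ind_nonneg _))
  simpa [collDensity] using this

/-- One collision followed by free transport (backwards). -/
noncomputable def collKernel : Kernel (Space n × Dir n) (Space n × Dir n) :=
  weightedKernel ((sphereMeasure n).prod (volume.restrict (Ioi (0 : ℝ)))) A.collDensity
    A.measurable_collDensity (fun q => (q.1.1 - q.2.2 • (q.2.1 : Space n), q.2.1)) (by fun_prop)

lemma lintegral_ind_chord_le {x : Space n} (hx : x ∈ Ω) (θ : Dir n) :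
    ∫⁻ t : ℝ, ENNReal.ofReal (ind Ω (x + t • (θ : Space n))) ≤ ENNReal.ofReal A.M := by
  have : ∀ t : ℝ, ENNReal.ofReal (ind Ω (x + t • (θ : Space n))) =
      {t : ℝ | x + t • (θ : Space n) ∈ Ω}.indicator 1 t := by
    intro t
    by_cases ht : x + t • (θ : Space n) ∈ Ω
    · rw [ind_mem ht, indicator_of_mem (by exact ht)]; simp
    · rw [ind_notMem ht, indicator_of_notMem (by exact ht)]; simp
  simp_rw [this]
  rw [lintegral_indicator_one (s := {t : ℝ | x + t • (θ : Space n) ∈ Ω})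
    (A.isOpen.preimage (continuous_chord_point x θ)).measurableSet,
    volume_chord A.isOpen A.bounded A.convex hx]
  exact ENNReal.ofReal_le_ofReal (A.tau_le x hx θ)

lemma lintegral_ind_chord_sub_le {x : Space n} (hx : x ∈ Ω) (θ : Dir n) :
    ∫⁻ t in Ioi (0:ℝ), ENNReal.ofReal (ind Ω (x - t • (θ : Space n))) ≤ ENNReal.ofReal A.M := by
  refine (setLIntegral_le_lintegral _ _).trans ?_
  simpa [sub_eq_add_neg] using A.lintegral_ind_chord_le hx (-θ)

lemma exitKernel_univ_le (z : Space n × Dir n) :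
    A.exitKernel z univ ≤ ENNReal.ofReal A.M := by
  rw [← lintegral_one, exitKernel, lintegral_weightedKernel _ measurable_const]
  by_cases hz : z.1 ∈ Ω
  · refine (lintegral_mono fun t => ?_).trans (A.lintegral_ind_chord_le hz z.2)
    rw [mul_one]
    exact ENNReal.ofReal_le_ofReal (A.exitDensity_le _)
  · simp [exitDensity, ind_notMem hz]

/-- A collision costs the factor `Ck * M`: scattering is at most `Ck`, the directions have total
mass one, and a backward segment in `Ω` has length at most `M`. As this is below one, the series
over the number of collisions is geometric. -/
lemma collKernel_univ_le [NeZero n] (z : Space n × Dir n) :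
    A.collKernel z univ ≤ ENNReal.ofReal (A.Ck * A.M) := by
  rw [← lintegral_one, collKernel, lintegral_weightedKernel _ measurable_const]
  by_cases hz : z.1 ∈ Ω
  · calc _ ≤ ∫⁻ q, ENNReal.ofReal A.Ck * ENNReal.ofReal (ind Ω (z.1 - q.2 • (q.1 : Space n)))
          ∂((sphereMeasure n).prod (volume.restrict (Ioi (0 : ℝ)))) := by
          refine lintegral_mono fun q => ?_
          rw [mul_one, ← ENNReal.ofReal_mul A.Ck_nonneg]
          exact ENNReal.ofReal_le_ofReal (A.collDensity_le (z, q))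
      _ = ∫⁻ θ, (∫⁻ s in Ioi (0:ℝ), ENNReal.ofReal A.Ck *
            ENNReal.ofReal (ind Ω (z.1 - s • (θ : Space n)))) ∂(sphereMeasure n) := by
          rw [lintegral_prod _ (by
            exact (((measurable_ind A.isOpen).comp
              (by fun_prop)).ennreal_ofReal.const_mul _).aemeasurable)]
      _ ≤ ∫⁻ _, ENNReal.ofReal A.Ck * ENNReal.ofReal A.M ∂(sphereMeasure n) := by
          refine lintegral_mono fun θ => ?_
          rw [lintegral_const_mul' _ _ ENNReal.ofReal_ne_top]
          gcongr
          exact A.lintegral_ind_chord_sub_le hz θ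
      _ = _ := by simp [ENNReal.ofReal_mul A.Ck_nonneg]
  · simp [collDensity, A.kk_zero _ (show ((z.1, _, z.2) : Space n × Dir n × Dir n).1 ∉ Ω from hz)]

/-- Integrating a function along all the chords. -/
lemma lintegral_chord_le [NeZero n] {g : Space n × Dir n → ℝ≥0∞} (hg : Measurable g) :
    ∫⁻ p, (∫⁻ t : ℝ, ENNReal.ofReal (ind Ω (p.1 + t • (p.2 : Space n))) *
      g (p.1 + t • (p.2 : Space n), p.2)) ∂(phaseMeasure Ω) ≤
    ENNReal.ofReal A.M * ∫⁻ p, g p ∂(phaseMeasure Ω) := by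
  have hm1 : Measurable fun q : (Space n × Dir n) × ℝ =>
      ENNReal.ofReal (ind Ω (q.1.1 + q.2 • (q.1.2 : Space n))) *
        g (q.1.1 + q.2 • (q.1.2 : Space n), q.1.2) :=
    ((measurable_ind A.isOpen).comp (by fun_prop)).ennreal_ofReal.mul (hg.comp (by fun_prop))
  -- For fixed `θ`, translation by `tθ` rewrites the double integral with the far point as the space
  -- variable. The base points that lead to a given far point fill its own chord, whose length is at
  -- most `M`.
  rw [phaseMeasure, lintegral_prod_symm' _ hm1.lintegral_prod_right', lintegral_prod_symm' _ hg,
    ← lintegral_const_mul' _ _ ENNReal.ofReal_ne_top]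
  refine lintegral_mono fun θ => ?_
  have hΩ := A.isOpen.measurableSet
  calc ∫⁻ x in Ω, ∫⁻ t : ℝ, ENNReal.ofReal (ind Ω (x + t • (θ : Space n))) *
        g (x + t • (θ : Space n), θ)
      = ∫⁻ t : ℝ, ∫⁻ x in Ω, ENNReal.ofReal (ind Ω (x + t • (θ : Space n))) *
        g (x + t • (θ : Space n), θ) := by
        refine lintegral_lintegral_swap ?_
        exact (hm1.comp (by fun_prop : Measurable fun q : Space n × ℝ =>
          (((q.1, θ), q.2) : (Space n × Dir n) × ℝ))).aemeasurable
    _ = ∫⁻ t : ℝ, ∫⁻ x, ENNReal.ofReal (ind Ω (x - t • (θ : Space n))) *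
          (ENNReal.ofReal (ind Ω x) * g (x, θ)) := by
        refine lintegral_congr fun t => ?_
        rw [← lintegral_indicator hΩ,
          ← lintegral_add_right_eq_self (fun x => ENNReal.ofReal (ind Ω (x - t • (θ : Space n))) *
          (ENNReal.ofReal (ind Ω x) * g (x, θ))) (t • (θ : Space n))]
        refine lintegral_congr fun x => ?_
        rw [add_sub_cancel_right]
        by_cases hx : x ∈ Ω
        · simp [hx, ind_mem hx]
        · simp [hx, ind_notMem hx]
    _ = ∫⁻ x, ∫⁻ t : ℝ, ENNReal.ofReal (ind Ω (x - t • (θ : Space n))) *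
          (ENNReal.ofReal (ind Ω x) * g (x, θ)) := by
        refine lintegral_lintegral_swap ?_
        refine Measurable.aemeasurable ?_
        refine ((measurable_ind A.isOpen).comp (by fun_prop)).ennreal_ofReal.mul
          (((measurable_ind A.isOpen).comp (by fun_prop)).ennreal_ofReal.mul
            (hg.comp (by fun_prop)))
    _ ≤ ∫⁻ x, Ω.indicator (fun x => ENNReal.ofReal A.M * g (x, θ)) x := by
        refine lintegral_mono fun x => ?_
        by_cases hx : x ∈ Ω
        · rw [indicator_of_mem hx, lintegral_mul_const]
          · simp only [ind_mem hx, ENNReal.ofReal_one, one_mul]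
            gcongr
            simpa [sub_eq_add_neg] using A.lintegral_ind_chord_le hx (-θ)
          · exact ((measurable_ind A.isOpen).comp (by fun_prop)).ennreal_ofReal
        · simp [ind_notMem hx]
    _ = ∫⁻ x in Ω, ENNReal.ofReal A.M * g (x, θ) := by rw [lintegral_indicator hΩ]
    _ = ENNReal.ofReal A.M * ∫⁻ x in Ω, g (x, θ) :=
        lintegral_const_mul' _ _ ENNReal.ofReal_ne_top

lemma lintegral_chord_sub_le [NeZero n] {g : Space n × Dir n → ℝ≥0∞} (hg : Measurable g) :
    ∫⁻ p, (∫⁻ t in Ioi (0:ℝ), ENNReal.ofReal (ind Ω (p.1 - t • (p.2 : Space n))) *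
      g (p.1 - t • (p.2 : Space n), p.2)) ∂(phaseMeasure Ω) ≤
    ENNReal.ofReal A.M * ∫⁻ p, g p ∂(phaseMeasure Ω) := by
  refine le_trans (lintegral_mono fun p => ?_) (A.lintegral_chord_le hg)
  refine (setLIntegral_le_lintegral _ _).trans (le_of_eq ?_)
  rw [← lintegral_neg_eq_self]
  simp

lemma lintegral_exitKernel_le [NeZero n] {g : Space n × Dir n → ℝ≥0∞} (hg : Measurable g) :
    ∫⁻ p, (∫⁻ z, g z ∂(A.exitKernel p)) ∂(phaseMeasure Ω) ≤
      ENNReal.ofReal A.M * ∫⁻ p, g p ∂(phaseMeasure Ω) := by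
  refine le_trans (lintegral_mono fun p => ?_) (A.lintegral_chord_le hg)
  rw [exitKernel, lintegral_weightedKernel _ hg]
  refine lintegral_mono fun t => ?_
  gcongr
  exact A.exitDensity_le (p, t)

/-- Once the scattering coefficient is replaced by `Ck`, the outgoing direction integrates to one
and the incoming direction takes its place as the phase space variable. The factor is the same as in
the mass bound: that bound serves bounded functions, this one serves integrable functions and null
sets. -/
lemma lintegral_collKernel_le [NeZero n] {g : Space n × Dir n → ℝ≥0∞} (hg : Measurable g) :
    ∫⁻ p, (∫⁻ z, g z ∂(A.collKernel p)) ∂(phaseMeasure Ω) ≤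
      ENNReal.ofReal (A.Ck * A.M) * ∫⁻ p, g p ∂(phaseMeasure Ω) := by
  have hm1 : Measurable fun q : Space n × Dir n × ℝ =>
      ENNReal.ofReal (ind Ω (q.1 - q.2.2 • (q.2.1 : Space n))) *
        g (q.1 - q.2.2 • (q.2.1 : Space n), q.2.1) :=
    ((measurable_ind A.isOpen).comp (by fun_prop)).ennreal_ofReal.mul (hg.comp (by fun_prop))
  let F : Space n × Dir n × ℝ → ℝ≥0∞ := fun q =>
      ENNReal.ofReal (ind Ω (q.1 - q.2.2 • (q.2.1 : Space n))) *
        g (q.1 - q.2.2 • (q.2.1 : Space n), q.2.1)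
  have hF : Measurable F := hm1
  let L := (sphereMeasure n).prod ((volume : Measure ℝ).restrict (Ioi (0 : ℝ)))
  have hF1 : Measurable fun p : Space n × Dir n => ∫⁻ q, F (p.1, q) ∂L :=
    (hF.lintegral_prod_right' (ν := L)).comp measurable_fst
  have hF2 : Measurable fun p : Space n × Dir n =>
      ∫⁻ t in Ioi (0:ℝ), F (p.1, p.2, t) :=
    Measurable.lintegral_prod_right' (f := fun q : (Space n × Dir n) × ℝ => F (q.1.1, q.1.2, q.2))
      (hF.comp (by fun_prop))
  have step1 : ∀ p, ∫⁻ z, g z ∂(A.collKernel p) ≤ ENNReal.ofReal A.Ck * ∫⁻ q, F (p.1, q) ∂L := by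
    intro p
    rw [collKernel, lintegral_weightedKernel _ hg,
      ← lintegral_const_mul' _ _ ENNReal.ofReal_ne_top]
    refine lintegral_mono fun q => ?_
    change _ ≤ ENNReal.ofReal A.Ck * (_ * _)
    rw [← mul_assoc, ← ENNReal.ofReal_mul A.Ck_nonneg]
    gcongr
    exact A.collDensity_le (p, q)
  have step2 : ∫⁻ p, (∫⁻ q, F (p.1, q) ∂L) ∂(phaseMeasure Ω) =
      ∫⁻ p, (∫⁻ t in Ioi (0:ℝ), F (p.1, p.2, t)) ∂(phaseMeasure Ω) := by
    rw [phaseMeasure, lintegral_prod _ hF1.aemeasurable, lintegral_prod _ hF2.aemeasurable]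
    refine lintegral_congr fun x => ?_
    dsimp only
    rw [lintegral_const, measure_univ, mul_one]
    exact lintegral_prod (fun q => F (x, q)) (hF.comp measurable_prodMk_left).aemeasurable
  calc _ ≤ ∫⁻ p, ENNReal.ofReal A.Ck * (∫⁻ q, F (p.1, q) ∂L) ∂(phaseMeasure Ω) :=
        lintegral_mono step1
    _ = ENNReal.ofReal A.Ck * ∫⁻ p, (∫⁻ t in Ioi (0:ℝ), F (p.1, p.2, t)) ∂(phaseMeasure Ω) := by
        rw [lintegral_const_mul' _ _ ENNReal.ofReal_ne_top, step2]
    _ ≤ ENNReal.ofReal A.Ck * (ENNReal.ofReal A.M * ∫⁻ p, g p ∂(phaseMeasure Ω)) := by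
        gcongr
        exact A.lintegral_chord_sub_le hg
    _ = _ := by rw [← mul_assoc, ← ENNReal.ofReal_mul A.Ck_nonneg]

end Medium
end RTE

/-! ### The collision series, and null sets along paths and chords. -/

namespace RTE
open ProbabilityTheory

/-- The measure on the sphere is defined through the volume of cones, and here the cone is contained
in a proper subspace. -/
lemma sphereMeasure_submodule_eq_zero {n : ℕ} {V : Submodule ℝ (Space n)} (hV : V ≠ ⊤) :
    sphereMeasure n {θ | (θ : Space n) ∈ V} = 0 := by
  have hm : MeasurableSet {θ : Dir n | (θ : Space n) ∈ V} :=
    (V.closed_of_finiteDimensional.preimage continuous_subtype_val).measurableSet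
  simp only [sphereMeasure, Measure.smul_apply, smul_eq_mul, mul_eq_zero]
  right
  rw [Measure.toSphere_apply' _ hm, mul_eq_zero]
  right
  refine measure_mono_null ?_ (Measure.addHaar_submodule volume V hV)
  rintro _ ⟨r, -, _, ⟨θ, hθ, rfl⟩, rfl⟩
  exact V.smul_mem _ hθ

/-- The dimension `n ≥ 3` enters here: the plane of the two observed directions is a null set for a
third direction. -/
lemma span_pair_ne_top {n : ℕ} (hn : 3 ≤ n) (a b : Space n) : Submodule.span ℝ {a, b} ≠ ⊤ := by
  intro h
  have h1 := finrank_span_le_card (R := ℝ) ({a, b} : Set (Space n))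
  rw [h, finrank_top, finrank_euclideanSpace_fin] at h1
  have h2 : ({a, b} : Set (Space n)).toFinset.card ≤ 2 := by
    simpa using Finset.card_le_two (a := a) (b := b)
  omega

namespace Medium
variable {n : ℕ} {Ω : Set (Space n)} (A : Medium Ω)

/-- The paths from the exit with exactly `m` intermediate collisions. -/
noncomputable def pathKernel : ℕ → Kernel (Space n × Dir n) (Space n × Dir n)
  | 0 => A.exitKernel
  | m + 1 => A.collKernel ∘ₖ pathKernel m

/-- The kernel that maps a source of first collisions to the outgoing values. -/
noncomputable def totalKernel : Kernel (Space n × Dir n) (Space n × Dir n) :=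
  Kernel.sum A.pathKernel

/-- Splitting off the term `m = 0`: a backward path either stops at its first collision point or
ends with one more collision step. This renewal identity replaces the summation of the series in
what follows. -/
lemma totalKernel_eq : A.totalKernel = A.exitKernel + A.collKernel ∘ₖ A.totalKernel := by
  rw [totalKernel, Kernel.comp_sum_right]
  ext z s hs
  rw [Kernel.sum_apply' _ _ hs, FunLike.coe_add, Pi.add_apply, Measure.add_apply,
    Kernel.sum_apply' _ _ hs, tsum_eq_zero_add' ENNReal.summable]
  rfl

/-- A bound for the mass of `totalKernel`. -/
noncomputable def bound : ℝ≥0∞ := ENNReal.ofReal A.M * (1 - ENNReal.ofReal (A.Ck * A.M))⁻¹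

lemma bound_ne_top : A.bound ≠ ∞ := by
  refine ENNReal.mul_ne_top ENNReal.ofReal_ne_top (ENNReal.inv_ne_top.2 ?_)
  rw [Ne, tsub_eq_zero_iff_le, not_le]
  simpa using A.lt_one

lemma tsum_bound : ∑' m : ℕ, ENNReal.ofReal A.M * ENNReal.ofReal (A.Ck * A.M) ^ m = A.bound := by
  rw [ENNReal.tsum_mul_left, ENNReal.tsum_geometric, bound]

lemma pathKernel_univ_le [NeZero n] (m : ℕ) (z : Space n × Dir n) :
    A.pathKernel m z univ ≤ ENNReal.ofReal A.M * ENNReal.ofReal (A.Ck * A.M) ^ m := by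
  induction m generalizing z with
  | zero => simpa [pathKernel] using A.exitKernel_univ_le z
  | succ m ih =>
    rw [pathKernel, Kernel.comp_apply' _ _ _ MeasurableSet.univ]
    calc _ ≤ ∫⁻ _, ENNReal.ofReal (A.Ck * A.M) ∂(A.pathKernel m z) :=
          lintegral_mono fun y => A.collKernel_univ_le y
      _ ≤ _ := by
        rw [lintegral_const, pow_succ, mul_comm, ← mul_assoc]
        gcongr
        exact ih z

lemma totalKernel_univ_le [NeZero n] (z : Space n × Dir n) : A.totalKernel z univ ≤ A.bound := by
  rw [totalKernel, Kernel.sum_apply' _ _ MeasurableSet.univ, ← tsum_bound]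
  exact ENNReal.tsum_le_tsum fun m => A.pathKernel_univ_le m z

instance [NeZero n] : IsFiniteKernel A.totalKernel :=
  ⟨⟨A.bound, A.bound_ne_top.lt_top, A.totalKernel_univ_le⟩⟩
instance : IsFiniteKernel A.exitKernel :=
  ⟨⟨ENNReal.ofReal A.M, ENNReal.ofReal_lt_top, A.exitKernel_univ_le⟩⟩
instance [NeZero n] : IsFiniteKernel A.collKernel :=
  ⟨⟨ENNReal.ofReal (A.Ck * A.M), ENNReal.ofReal_lt_top, A.collKernel_univ_le⟩⟩

lemma lintegral_pathKernel_le [NeZero n] (m : ℕ) {g : Space n × Dir n → ℝ≥0∞} (hg : Measurable g) :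
    ∫⁻ p, (∫⁻ z, g z ∂(A.pathKernel m p)) ∂(phaseMeasure Ω) ≤
      ENNReal.ofReal A.M * ENNReal.ofReal (A.Ck * A.M) ^ m * ∫⁻ p, g p ∂(phaseMeasure Ω) := by
  induction m generalizing g with
  | zero => simpa [pathKernel] using A.lintegral_exitKernel_le hg
  | succ m ih =>
    simp_rw [pathKernel, Kernel.lintegral_comp _ _ _ hg]
    refine (ih (hg.lintegral_kernel (κ := A.collKernel))).trans ?_
    rw [pow_succ, ← mul_assoc, mul_assoc (_ * _)]
    gcongr
    exact A.lintegral_collKernel_le hg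

lemma lintegral_totalKernel_le [NeZero n] {g : Space n × Dir n → ℝ≥0∞} (hg : Measurable g) :
    ∫⁻ p, (∫⁻ z, g z ∂(A.totalKernel p)) ∂(phaseMeasure Ω) ≤
      A.bound * ∫⁻ p, g p ∂(phaseMeasure Ω) := by
  simp_rw [totalKernel, Kernel.sum_apply, lintegral_sum_measure]
  rw [lintegral_tsum fun m => (hg.lintegral_kernel (κ := A.pathKernel m)).aemeasurable,
    ← tsum_bound,
    ← ENNReal.tsum_mul_right]
  exact ENNReal.tsum_le_tsum fun m => A.lintegral_pathKernel_le m hg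

/-- Almost every direction avoids `V`, and a line whose direction is not in `V` meets the affine
subspace `x + V` in at most one point, so the path lengths that end in it form a null set. This is
what eliminates multiple scattering as `γ₂ → 0`. -/
lemma collKernel_plane {V : Submodule ℝ (Space n)} (hV : V ≠ ⊤) (x : Space n)
    (z : Space n × Dir n) : ∀ᵐ y ∂(A.collKernel z), y.1 - x ∉ V := by
  have hm0 : IsClosed {y : Space n | y - x ∈ V} :=
    V.closed_of_finiteDimensional.preimage (by fun_prop : Continuous fun y : Space n => y - x)
  refine ae_weightedKernel z (p := fun y : Space n × Dir n => y.1 - x ∉ V)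
    (hm0.measurableSet.compl.preimage measurable_fst) ?_
  have hm : MeasurableSet {q : Dir n × ℝ | z.1 - q.2 • (q.1 : Space n) - x ∈ V} :=
    (hm0.preimage (by fun_prop : Continuous fun q : Dir n × ℝ =>
      z.1 - q.2 • (q.1 : Space n))).measurableSet
  rw [ae_iff]
  simp only [not_not]
  rw [Measure.measure_prod_null hm]
  have h0 : ∀ᵐ θ : Dir n ∂(sphereMeasure n), (θ : Space n) ∉ V := by
    rw [ae_iff]; simp only [not_not]; exact sphereMeasure_submodule_eq_zero hV
  filter_upwards [h0] with θ hθ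
  change ((volume : Measure ℝ).restrict (Ioi 0)) {s | z.1 - s • (θ : Space n) - x ∈ V} = 0
  refine Set.Subsingleton.measure_zero ?_ _
  intro s hs t ht
  by_contra hst
  apply hθ
  have h1 : (z.1 - s • (θ : Space n) - x) - (z.1 - t • (θ : Space n) - x) ∈ V := V.sub_mem hs ht
  have h2 : (z.1 - s • (θ : Space n) - x) - (z.1 - t • (θ : Space n) - x)
      = (t - s) • (θ : Space n) := by rw [sub_smul]; abel
  rw [h2] at h1
  have h3 := V.smul_mem (t - s)⁻¹ h1
  rwa [smul_smul, inv_mul_cancel₀ (sub_ne_zero.2 (Ne.symm hst)), one_smul] at h3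

/-- If `P` holds almost everywhere, it holds at almost every point of almost every chord. -/
lemma ae_chord (A : Medium Ω) [NeZero n] {P : Space n × Dir n → Prop}
    (h : ∀ᵐ p ∂phaseMeasure Ω, P p) :
    ∀ᵐ p ∂phaseMeasure Ω, ∀ᵐ t : ℝ, p.1 + t • (p.2 : Space n) ∈ Ω →
      P (p.1 + t • (p.2 : Space n), p.2) := by
  obtain ⟨N, hN, hNm, hN0⟩ := exists_measurable_superset_of_null (ae_iff.1 h)
  have hg : Measurable (N.indicator (1 : Space n × Dir n → ℝ≥0∞)) := measurable_one.indicator hNm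
  have h1 := A.lintegral_chord_le hg
  rw [lintegral_indicator_one hNm, hN0, mul_zero, nonpos_iff_eq_zero] at h1
  have hm1 : Measurable fun q : (Space n × Dir n) × ℝ =>
      ENNReal.ofReal (ind Ω (q.1.1 + q.2 • (q.1.2 : Space n))) *
        N.indicator 1 (q.1.1 + q.2 • (q.1.2 : Space n), q.1.2) :=
    ((measurable_ind A.isOpen).comp (by fun_prop)).ennreal_ofReal.mul (hg.comp (by fun_prop))
  rw [lintegral_eq_zero_iff hm1.lintegral_prod_right'] at h1
  filter_upwards [h1] with p hp
  have hp' := (lintegral_eq_zero_iff (hm1.comp measurable_prodMk_left)).1 hp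
  filter_upwards [hp'] with t ht hmem
  by_contra hP
  have : (p.1 + t • (p.2 : Space n), p.2) ∈ N := hN hP
  simp [ind_mem hmem, this] at ht

/-- Integrable functions are integrable along almost every chord. -/
lemma integrable_chord (A : Medium Ω) [NeZero n] {g : Space n × Dir n → ℝ}
    (hg : Integrable g (phaseMeasure Ω)) :
    ∀ᵐ p ∂phaseMeasure Ω, Integrable fun t : ℝ => ind Ω (p.1 + t • (p.2 : Space n)) *
      g (p.1 + t • (p.2 : Space n), p.2) := by
  have hgm := hg.1.stronglyMeasurable_mk.measurable
  have hb := A.lintegral_chord_le hgm.enorm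
  have hm1 : Measurable fun q : (Space n × Dir n) × ℝ =>
      ind Ω (q.1.1 + q.2 • (q.1.2 : Space n)) *
        hg.1.mk g (q.1.1 + q.2 • (q.1.2 : Space n), q.1.2) :=
    ((measurable_ind A.isOpen).comp (by fun_prop)).mul (hgm.comp (by fun_prop))
  have hfin : ∫⁻ p, (∫⁻ t : ℝ, ‖ind Ω (p.1 + t • (p.2 : Space n)) *
      hg.1.mk g (p.1 + t • (p.2 : Space n), p.2)‖ₑ) ∂(phaseMeasure Ω) ≠ ∞ := by
    refine ne_top_of_le_ne_top (ENNReal.mul_ne_top ENNReal.ofReal_ne_top ?_)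
      (le_trans (le_of_eq ?_) hb)
    · exact ((hg.congr hg.1.ae_eq_mk).2).ne
    · simp_rw [enorm_mul, Real.enorm_of_nonneg (ind_nonneg _)]
  filter_upwards [A.ae_chord hg.1.ae_eq_mk,
    ae_lt_top hm1.enorm.lintegral_prod_right' hfin] with p hp1 hp2
  have h1 : Integrable fun t : ℝ => ind Ω (p.1 + t • (p.2 : Space n)) *
      hg.1.mk g (p.1 + t • (p.2 : Space n), p.2) :=
    ⟨(hm1.comp measurable_prodMk_left).aestronglyMeasurable, hp2⟩
  refine h1.congr ?_
  filter_upwards [hp1] with t ht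
  by_cases hmem : p.1 + t • (p.2 : Space n) ∈ Ω
  · rw [ht hmem]
  · simp [ind_notMem hmem]

end Medium
end RTE

/-! ### The weak derivative as a derivative along chords. -/

namespace RTE
variable {n : ℕ} {Ω : Set (Space n)}

/-- The free transport `(x, θ) ↦ (x + tθ, θ)`. -/
noncomputable def shear (n : ℕ) (t : ℝ) : (Space n × Dir n) ≃ᵐ (Space n × Dir n) where
  toFun p := (p.1 + t • (p.2 : Space n), p.2)
  invFun p := (p.1 - t • (p.2 : Space n), p.2)
  left_inv p := by simp
  right_inv p := by simp
  measurable_toFun := by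
    change Measurable fun p : Space n × Dir n => (p.1 + t • (p.2 : Space n), p.2)
    fun_prop
  measurable_invFun := by
    change Measurable fun p : Space n × Dir n => (p.1 - t • (p.2 : Space n), p.2)
    fun_prop

@[simp] lemma shear_apply (t : ℝ) (p : Space n × Dir n) :
    shear n t p = (p.1 + t • (p.2 : Space n), p.2) := rfl

/-- The measure `dx dθ` on the whole phase space. -/
noncomputable abbrev fullMeasure (n : ℕ) : Measure (Space n × Dir n) :=
  (volume : Measure (Space n)).prod (sphereMeasure n)

lemma measurePreserving_shear [NeZero n] (t : ℝ) :
    MeasurePreserving (shear n t) (fullMeasure n) (fullMeasure n) := by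
  have h1 : MeasurePreserving (fun p : Dir n × Space n => (p.1, p.2 + t • (p.1 : Space n)))
      ((sphereMeasure n).prod volume) ((sphereMeasure n).prod volume) :=
    (MeasurePreserving.id (sphereMeasure n)).skew_product
      (g := fun θ x => x + t • (θ : Space n)) (by
        change Measurable fun p : Dir n × Space n => p.2 + t • (p.1 : Space n)
        fun_prop)
      (ae_of_all _ fun θ => (measurePreserving_add_right volume _).map_eq)
  exact (Measure.measurePreserving_swap.comp h1).comp Measure.measurePreserving_swap

lemma integrable_full_indicator (ho : IsOpen Ω) {u : Space n → Dir n → ℝ}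
    (hu : Integrable (fun p : Space n × Dir n => u p.1 p.2) (phaseMeasure Ω)) :
    Integrable ((Ω ×ˢ univ).indicator fun p : Space n × Dir n => u p.1 p.2) (fullMeasure n) := by
  rw [phaseMeasure_eq] at hu
  exact (integrable_indicator_iff (ho.measurableSet.prod MeasurableSet.univ)).2 hu

/-- The weak transport equation, tested against the translates of a test function. -/
lemma integral_translate_sub [NeZero n] (hc : Convex ℝ Ω) {u g : Space n × Dir n → ℝ}
    (hu : Integrable u (fullMeasure n)) (hg : Integrable g (fullMeasure n))
    (hw : ∀ ψ : Space n × Space n → ℝ, ContDiff ℝ ((⊤ : ℕ∞) : WithTop ℕ∞) ψ → HasCompactSupport ψ →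
      tsupport ψ ⊆ Ω ×ˢ univ →
      ∫ p, u p * fderiv ℝ (fun y => ψ (y, (p.2 : Space n))) p.1 (p.2 : Space n) ∂(fullMeasure n) =
        -∫ p, g p * ψ (p.1, (p.2 : Space n)) ∂(fullMeasure n))
    (t : ℝ) {ψ : Space n × Space n → ℝ} (hψ : ContDiff ℝ ((⊤ : ℕ∞) : WithTop ℕ∞) ψ)
    (hψc : HasCompactSupport ψ)
    (hψs : tsupport ψ ⊆ {q | q.1 ∈ Ω ∧ q.1 + t • q.2 ∈ Ω}) :
    ∫ p, (u (shear n t p) - u p - ∫ s in (0 : ℝ)..t, g (shear n s p)) * ψ (p.1, (p.2 : Space n))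
      ∂(fullMeasure n) = 0 := by
  -- The derivative of `ψ` in the direction of its own second argument. Evaluated at the moved
  -- point, it is both the directional derivative of the moved test function and minus its
  -- derivative in the amount of the move.
  set D : Space n × Space n → ℝ := fun q => fderiv ℝ ψ q (q.2, 0) with hD
  have hDc : Continuous D := by
    have h1 : Continuous (fderiv ℝ ψ) := hψ.continuous_fderiv (by simp)
    exact h1.clm_apply (by fun_prop)
  have hDs : HasCompactSupport D := by
    refine (hψc.fderiv (𝕜 := ℝ)).mono' ?_
    intro q hq
    refine subset_tsupport _ ?_
    intro h0
    exact hq (by simp [hD, h0])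
  obtain ⟨CD, hCD⟩ := hDs.exists_bound_of_continuous hDc
  obtain ⟨Cψ, hCψ⟩ := hψc.exists_bound_of_continuous hψ.continuous
  have hCD0 : 0 ≤ CD := (norm_nonneg _).trans (hCD 0)
  -- the translated test functions
  have hder : ∀ (s : ℝ) (x v : Space n),
      HasDerivAt (fun s : ℝ => ψ (x - s • v, v)) (-D (x - s • v, v)) s := by
    intro s x v
    have h1 : HasDerivAt (fun s : ℝ => (x - s • v, v)) ((-v, 0) : Space n × Space n) s := by
      refine HasDerivAt.prodMk ?_ (hasDerivAt_const s v)
      simpa using ((hasDerivAt_id s).smul_const v).const_sub x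
    have h2 := ((hψ.differentiable (by simp)) (x - s • v, v)).hasFDerivAt.comp_hasDerivAt s h1
    have h3 : ((-v, 0) : Space n × Space n) = -(v, 0) := by simp
    rw [h3, map_neg] at h2
    exact h2
  have hfd : ∀ (s : ℝ) (x v : Space n),
      fderiv ℝ (fun y => ψ (y - s • v, v)) x v = D (x - s • v, v) := by
    intro s x v
    have h1 : HasFDerivAt (fun y : Space n => (y - s • v, v))
        ((ContinuousLinearMap.id ℝ (Space n)).prod 0) x := by
      refine HasFDerivAt.prodMk ?_ (hasFDerivAt_const v x)
      exact (hasFDerivAt_id x).sub_const _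
    have h2 := ((hψ.differentiable (by simp)) (x - s • v, v)).hasFDerivAt.comp x h1
    have h3 : fderiv ℝ (fun y => ψ (y - s • v, v)) x = _ := h2.fderiv
    rw [h3]
    simp [hD]
  -- `F` pairs `u` with the test function moved by `s`. The weak equation turns `F'` into an
  -- integral of `g`, and `F t - F 0` is the claimed identity after a change of variables by the
  -- shear.
  set F : ℝ → ℝ := fun s => ∫ p, u p * ψ (p.1 - s • (p.2 : Space n), p.2) ∂(fullMeasure n) with hF
  set F' : ℝ → ℝ := fun s =>
    ∫ p, u p * -D (p.1 - s • (p.2 : Space n), p.2) ∂(fullMeasure n) with hF'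
  have hmψ : ∀ s : ℝ, AEStronglyMeasurable (fun p : Space n × Dir n =>
      ψ (p.1 - s • (p.2 : Space n), p.2)) (fullMeasure n) := fun s =>
    (hψ.continuous.comp (by fun_prop)).aestronglyMeasurable
  have hmD : ∀ s : ℝ, AEStronglyMeasurable (fun p : Space n × Dir n =>
      -D (p.1 - s • (p.2 : Space n), p.2)) (fullMeasure n) := fun s =>
    (hDc.comp (by fun_prop)).neg.aestronglyMeasurable
  have hbd : ∀ (s : ℝ) (p : Space n × Dir n),
      ‖u p * -D (p.1 - s • (p.2 : Space n), p.2)‖ ≤ ‖u p‖ * CD := fun s p => by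
    rw [norm_mul, norm_neg]; gcongr; exact hCD _
  have hFd : ∀ s, HasDerivAt F (F' s) s := by
    intro s
    refine (hasDerivAt_integral_of_dominated_loc_of_deriv_le (bound := fun p => ‖u p‖ * CD)
      (F' := fun s p => u p * -D (p.1 - s • (p.2 : Space n), p.2)) univ_mem
      (Eventually.of_forall fun s => hu.1.mul (hmψ s)) ?_ (hu.1.mul (hmD s))
      (ae_of_all _ fun p s _ => hbd s p) (hu.norm.mul_const _)
      (ae_of_all _ fun p s _ => (hder s p.1 p.2).const_mul _)).2
    exact hu.mul_bdd (c := Cψ) (hmψ s) (ae_of_all _ fun p => hCψ _)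
  have hF'c : Continuous F' := by
    refine continuous_of_dominated (bound := fun p => ‖u p‖ * CD) (fun s => hu.1.mul (hmD s))
      (fun s => ae_of_all _ fun p => hbd s p) (hu.norm.mul_const _) (ae_of_all _ fun p => ?_)
    exact continuous_const.mul (hDc.comp (by fun_prop)).neg
  have hftc := intervalIntegral.integral_eq_sub_of_hasDerivAt (a := 0) (b := t)
    (fun s _ => hFd s) (hF'c.intervalIntegrable _ _)
  have hF'g : ∀ s ∈ uIcc 0 t,
      F' s = ∫ p, g (shear n s p) * ψ (p.1, (p.2 : Space n)) ∂(fullMeasure n) := by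
    intro s hs
    let e : Space n × Space n → Space n × Space n := fun q => (q.1 - s • q.2, q.2)
    have he : Topology.IsClosedEmbedding e :=
      Homeomorph.isClosedEmbedding ⟨⟨e, fun q => (q.1 + s • q.2, q.2), fun q => by simp [e],
        fun q => by simp [e]⟩, by fun_prop, by fun_prop⟩
    have h1 := hw (fun q => ψ (q.1 - s • q.2, q.2)) (hψ.comp (by fun_prop))
      (hψc.comp_isClosedEmbedding he) (by
        intro q hq
        have h2 : e q ∈ tsupport ψ := by
          have := tsupport_comp_subset_preimage ψ (f := e) (by fun_prop) hq
          exact this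
        have h3 := hψs h2
        refine ⟨?_, trivial⟩
        simp only [e, mem_ofPred_eq] at h3
        have h4 := h3.2
        rcases eq_or_ne t 0 with ht | ht
        · subst ht
          simp only [uIcc_self, mem_singleton_iff] at hs
          subst hs
          simpa using h3.1
        have h5 : 0 ≤ s / t ∧ s / t ≤ 1 := by
          rcases le_total 0 t with h | h
          · rw [uIcc_of_le h] at hs
            exact ⟨div_nonneg hs.1 h, div_le_one_of_le₀ hs.2 h⟩
          · rw [uIcc_of_ge h] at hs
            refine ⟨div_nonneg_of_nonpos hs.2 h, ?_⟩
            rw [← neg_div_neg_eq]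
            exact div_le_one_of_le₀ (by linarith [hs.1]) (by linarith)
        -- The point `q.1` lies on the segment between two points of `Ω`, so by convexity every
        -- intermediate translate of the test function is still supported in `Ω`.
        have h6 := hc h3.1 h4 (a := 1 - s / t) (b := s / t) (by linarith [h5.2]) h5.1 (by ring)
        have h7 : (1 - s / t) • (q.1 - s • q.2) + (s / t) • (q.1 - s • q.2 + t • q.2) = q.1 := by
          rw [smul_add (s / t), smul_smul, div_mul_cancel₀ _ ht, ← add_assoc, ← add_smul]
          simp
        rwa [h7] at h6)
    have h2 : F' s = ∫ p, g p * ψ (p.1 - s • (p.2 : Space n), (p.2 : Space n))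
        ∂(fullMeasure n) := by
      rw [← neg_neg (∫ p, g p * _ ∂_), ← h1, ← integral_neg]
      refine integral_congr_ae (ae_of_all _ fun p => ?_)
      simp only [hfd]
      ring
    rw [h2, ← (measurePreserving_shear s).integral_comp']
    simp
  have hint : Integrable (fun q : ℝ × (Space n × Dir n) => g (shear n q.1 q.2))
      ((volume.restrict (uIoc 0 t)).prod (fullMeasure n)) := by
    have hmp : MeasurePreserving (fun q : ℝ × (Space n × Dir n) => (q.1, shear n q.1 q.2))
        ((volume.restrict (uIoc 0 t)).prod (fullMeasure n))
        ((volume.restrict (uIoc 0 t)).prod (fullMeasure n)) :=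
      (MeasurePreserving.id _).skew_product (g := fun s p => shear n s p) (by
        change Measurable fun q : ℝ × (Space n × Dir n) =>
          (q.2.1 + q.1 • (q.2.2 : Space n), q.2.2)
        fun_prop) (ae_of_all _ fun s => (measurePreserving_shear s).map_eq)
    have hfin : IsFiniteMeasure ((volume : Measure ℝ).restrict (uIoc 0 t)) :=
      ⟨by simp [uIoc]⟩
    exact hmp.integrable_comp_of_integrable (hg.comp_snd _)
  have hshu : Integrable (fun p => u (shear n t p)) (fullMeasure n) :=
    (measurePreserving_shear t).integrable_comp_of_integrable hu
  have hψm : AEStronglyMeasurable (fun p : Space n × Dir n => ψ (p.1, (p.2 : Space n)))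
      (fullMeasure n) := by simpa using hmψ 0
  have hmulψ : ∀ {f : Space n × Dir n → ℝ}, Integrable f (fullMeasure n) →
      Integrable (fun p => f p * ψ (p.1, (p.2 : Space n))) (fullMeasure n) := fun hf =>
    hf.mul_bdd (c := Cψ) hψm (ae_of_all _ fun p => hCψ _)
  have hsw : ∫ s in (0 : ℝ)..t, (∫ p, g (shear n s p) * ψ (p.1, (p.2 : Space n)) ∂(fullMeasure n)) =
      ∫ p, (∫ s in (0 : ℝ)..t, g (shear n s p)) * ψ (p.1, (p.2 : Space n)) ∂(fullMeasure n) := by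
    rw [intervalIntegral_integral_swap (f := fun s p => g (shear n s p) * ψ (p.1, (p.2 : Space n)))
      (hint.mul_bdd (c := Cψ) (hψm.comp_snd) (ae_of_all _ fun p => hCψ _))]
    simp_rw [intervalIntegral.integral_mul_const]
  have hintg : Integrable (fun p => ∫ s in (0 : ℝ)..t, g (shear n s p)) (fullMeasure n) := by
    simp_rw [intervalIntegral.intervalIntegral_eq_integral_uIoc]
    exact Integrable.smul (c := (if (0:ℝ) ≤ t then (1 : ℝ) else -1)) hint.integral_prod_right
  rw [intervalIntegral.integral_congr hF'g, hsw] at hftc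
  have hFt : F t = ∫ p, u (shear n t p) * ψ (p.1, (p.2 : Space n)) ∂(fullMeasure n) := by
    rw [hF]
    dsimp only
    rw [← (measurePreserving_shear t).integral_comp' (g := fun p =>
      u p * ψ (p.1 - t • (p.2 : Space n), p.2))]
    simp
  have hF0 : F 0 = ∫ p, u p * ψ (p.1, (p.2 : Space n)) ∂(fullMeasure n) := by simp [hF]
  simp_rw [sub_mul]
  rw [integral_sub (f := fun p => u (shear n t p) * ψ (p.1, (p.2 : Space n)) -
    u p * ψ (p.1, (p.2 : Space n))) ((hmulψ hshu).sub (hmulψ hu)) (hmulψ hintg),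
    integral_sub (hmulψ hshu) (hmulψ hu),
    hftc, hFt, hF0, sub_self]

end RTE

namespace RTE
variable {n : ℕ} {Ω : Set (Space n)}

/-- The increments of `u` along almost every chord are the integrals of `θ · ∇ₓ u`. -/
lemma ae_chord_increment [NeZero n] (ho : IsOpen Ω) (hc : Convex ℝ Ω) {u g : Space n → Dir n → ℝ}
    (hu : Integrable (fun p : Space n × Dir n => u p.1 p.2) (phaseMeasure Ω))
    (hg : Integrable (fun p : Space n × Dir n => g p.1 p.2) (phaseMeasure Ω))
    (hw : HasTransportDeriv Ω u g) (t : ℝ) :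
    ∀ᵐ p ∂phaseMeasure Ω, p.1 + t • (p.2 : Space n) ∈ Ω →
      u (p.1 + t • (p.2 : Space n)) p.2 - u p.1 p.2 =
        ∫ s in (0 : ℝ)..t, g (p.1 + s • (p.2 : Space n)) p.2 := by
  have hms : MeasurableSet (Ω ×ˢ (univ : Set (Dir n))) := ho.measurableSet.prod MeasurableSet.univ
  set u' := (Ω ×ˢ univ).indicator fun p : Space n × Dir n => u p.1 p.2 with hu'
  set g' := (Ω ×ˢ univ).indicator fun p : Space n × Dir n => g p.1 p.2 with hg'
  have hui : Integrable u' (fullMeasure n) := integrable_full_indicator ho hu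
  have hgi : Integrable g' (fullMeasure n) := integrable_full_indicator ho hg
  have hw' : ∀ ψ : Space n × Space n → ℝ, ContDiff ℝ ((⊤ : ℕ∞) : WithTop ℕ∞) ψ →
      HasCompactSupport ψ →
      tsupport ψ ⊆ Ω ×ˢ univ →
      ∫ p, u' p * fderiv ℝ (fun y => ψ (y, (p.2 : Space n))) p.1 (p.2 : Space n) ∂(fullMeasure n) =
        -∫ p, g' p * ψ (p.1, (p.2 : Space n)) ∂(fullMeasure n) := by
    intro ψ h1 h2 h3
    have := hw ψ h1 h2 h3
    rw [phaseMeasure_eq, ← integral_indicator hms, ← integral_indicator hms] at this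
    convert this using 2
    · ext p
      by_cases hp : p ∈ Ω ×ˢ (univ : Set (Dir n)) <;> simp [hu', hp]
    · refine integral_congr_ae (ae_of_all _ fun p => ?_)
      by_cases hp : p ∈ Ω ×ˢ (univ : Set (Dir n)) <;> simp [hg', hp]
  let U : Space n × Dir n → ℝ := fun p =>
    u' (shear n t p) - u' p - ∫ s in (0 : ℝ)..t, g' (shear n s p)
  have hUi : Integrable U (fullMeasure n) := by
    refine (((measurePreserving_shear t).integrable_comp_of_integrable hui).sub hui).sub ?_
    have hmp : MeasurePreserving (fun q : ℝ × (Space n × Dir n) => (q.1, shear n q.1 q.2))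
        ((volume.restrict (uIoc 0 t)).prod (fullMeasure n))
        ((volume.restrict (uIoc 0 t)).prod (fullMeasure n)) :=
      (MeasurePreserving.id _).skew_product (g := fun s p => shear n s p) (by
        change Measurable fun q : ℝ × (Space n × Dir n) =>
          (q.2.1 + q.1 • (q.2.2 : Space n), q.2.2)
        fun_prop) (ae_of_all _ fun s => (measurePreserving_shear s).map_eq)
    have hfin : IsFiniteMeasure ((volume : Measure ℝ).restrict (uIoc 0 t)) :=
      ⟨by simp [uIoc]⟩
    have hint := hmp.integrable_comp_of_integrable (hgi.comp_snd _)
    simp_rw [intervalIntegral.intervalIntegral_eq_integral_uIoc]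
    exact Integrable.smul (c := (if (0:ℝ) ≤ t then (1 : ℝ) else -1)) hint.integral_prod_right
  -- The fundamental lemma of the calculus of variations is applied on `ℝⁿ × ℝⁿ` to the image
  -- measure under the inclusion of the sphere. The extension of `U` off the sphere is irrelevant
  -- for that measure, and the test functions are those of the weak formulation.
  let ι : Space n × Dir n → Space n × Space n := fun p => (p.1, (p.2 : Space n))
  have hι : MeasurableEmbedding ι :=
    (MeasurableEmbedding.id.prodMap (MeasurableEmbedding.subtype_coe
      (Metric.isClosed_sphere (x := (0 : Space n)) (ε := 1)).measurableSet))
  have hO : IsOpen {q : Space n × Space n | q.1 ∈ Ω ∧ q.1 + t • q.2 ∈ Ω} :=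
    (ho.preimage continuous_fst).inter (ho.preimage (by fun_prop :
      Continuous fun q : Space n × Space n => q.1 + t • q.2))
  have hext : ∀ p, Function.extend ι U 0 (ι p) = U p := fun p => hι.injective.extend_apply _ _ _
  have hloc : Integrable (Function.extend ι U 0) ((fullMeasure n).map ι) := by
    rw [hι.integrable_map_iff]
    exact hUi.congr (ae_of_all _ fun p => (hext p).symm)
  have key := hO.ae_eq_zero_of_integral_contDiff_smul_eq_zero
    (hloc.locallyIntegrable.locallyIntegrableOn _) (fun ψ h1 h2 h3 => by
      rw [hι.integral_map]
      simp_rw [hext]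
      rw [← integral_translate_sub hc hui hgi hw' t h1 h2 h3]
      refine integral_congr_ae (ae_of_all _ fun p => ?_)
      simp only [smul_eq_mul, U, ι]
      ring)
  rw [hι.ae_map_iff] at key
  rw [phaseMeasure_eq]
  filter_upwards [ae_restrict_of_ae key, ae_restrict_mem hms] with p hp hpΩ ht
  have h1 := hp ⟨hpΩ.1, ht⟩
  rw [hext] at h1
  have h2 : ∀ s ∈ uIcc 0 t, p.1 + s • (p.2 : Space n) ∈ Ω := by
    intro s hs
    have h5 : 0 ≤ s / t ∧ s / t ≤ 1 := by
      rcases le_total 0 t with h | h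
      · rw [uIcc_of_le h] at hs
        exact ⟨div_nonneg hs.1 h, div_le_one_of_le₀ hs.2 h⟩
      · rw [uIcc_of_ge h] at hs
        refine ⟨div_nonneg_of_nonpos hs.2 h, ?_⟩
        rw [← neg_div_neg_eq]
        exact div_le_one_of_le₀ (by linarith [hs.1]) (by linarith)
    rcases eq_or_ne t 0 with h0 | h0
    · subst h0
      simp only [uIcc_self, mem_singleton_iff] at hs
      subst hs
      exact ht
    have h6 := hc hpΩ.1 ht (a := 1 - s / t) (b := s / t) (by linarith [h5.2]) h5.1 (by ring)
    have h7 : (1 - s / t) • p.1 + (s / t) • (p.1 + t • (p.2 : Space n)) =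
        p.1 + s • (p.2 : Space n) := by
      rw [smul_add (s / t), smul_smul, div_mul_cancel₀ _ h0, ← add_assoc, ← add_smul]
      simp
    rwa [h7] at h6
  have h3 : ∫ s in (0 : ℝ)..t, g' (shear n s p) =
      ∫ s in (0 : ℝ)..t, g (p.1 + s • (p.2 : Space n)) p.2 := by
    refine intervalIntegral.integral_congr fun s hs => ?_
    simp [hg', h2 s hs]
  have h4 : u' (shear n t p) = u (p.1 + t • (p.2 : Space n)) p.2 := by simp [hu', ht]
  have h5 : u' p = u p.1 p.2 := by simp [hu', show p.1 ∈ Ω from hpΩ.1]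
  simp only [U, h3, h4, h5] at h1
  linarith

/-- An absolutely continuous function is bounded, and the exponential is Lipschitz on bounded
intervals. -/
lemma absolutelyContinuousOnInterval_exp {f : ℝ → ℝ} {a b : ℝ}
    (hf : AbsolutelyContinuousOnInterval f a b) :
    AbsolutelyContinuousOnInterval (fun t => Real.exp (f t)) a b := by
  obtain ⟨C, hC⟩ := hf.exists_bound
  obtain ⟨K, hK⟩ := (Real.contDiff_exp (n := 1)).contDiffOn.exists_lipschitzOnWith
    (s := Icc (-C) C) (by decide) (convex_Icc _ _) isCompact_Icc
  have hmem : ∀ x ∈ uIcc a b, f x ∈ Icc (-C) C := fun x hx => abs_le.1 (hC x hx)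
  have hlim := Tendsto.const_mul (K : ℝ) hf
  rw [mul_zero] at hlim
  refine squeeze_zero' (Eventually.of_forall fun E => Finset.sum_nonneg fun _ _ => dist_nonneg) ?_
    hlim
  filter_upwards [mem_inf_of_right (mem_principal_self _)] with E hE
  rw [Finset.mul_sum]
  refine Finset.sum_le_sum fun i hi => ?_
  exact hK.dist_le_mul _ (hmem _ (hE.left i hi).left) _ (hmem _ (hE.left i hi).right)

/-- Variation of constants for `v' = q - a v`. -/
lemma integral_factor {v a q : ℝ → ℝ} {c α β : ℝ} (hαβ : α ≤ β)
    (ha : IntervalIntegrable a volume α β)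
    (hq : IntervalIntegrable (fun t => q t - a t * v t) volume α β)
    (hv : ∀ t ∈ Icc α β, v t = c + ∫ s in α..t, (q s - a s * v s)) :
    v β = c * Real.exp (-∫ s in α..β, a s) + ∫ s in α..β, Real.exp (-∫ r in s..β, a r) * q s := by
  have hu : uIcc α β = Icc α β := uIcc_of_le hαβ
  have hαm : α ∈ uIcc α β := left_mem_uIcc
  set w : ℝ → ℝ := fun t => c + ∫ s in α..t, (q s - a s * v s) with hw
  set I : ℝ → ℝ := fun t => ∫ s in α..t, a s with hI
  have hwac : AbsolutelyContinuousOnInterval w α β :=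
    AbsolutelyContinuousOnInterval.add (contDiffOn_const (c := c)).absolutelyContinuousOnInterval
      (hq.absolutelyContinuousOnInterval_intervalIntegral hαm)
  have hIac : AbsolutelyContinuousOnInterval I α β :=
    ha.absolutelyContinuousOnInterval_intervalIntegral hαm
  have hEac : AbsolutelyContinuousOnInterval (fun t => Real.exp (I t)) α β :=
    absolutelyContinuousOnInterval_exp hIac
  -- The coefficient `a` is merely integrable, so the integrating factor is absolutely continuous
  -- rather than `C¹`; the product rule holds almost everywhere, which is enough to integrate it.
  have hmain := hEac.integral_deriv_mul_eq_sub hwac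
  have hderiv : ∀ᵐ t, t ∈ uIoc α β → deriv (fun t => Real.exp (I t)) t * w t +
      Real.exp (I t) * deriv w t = Real.exp (I t) * q t := by
    have h1 := ha.ae_hasDerivAt_integral
    have h2 := hq.ae_hasDerivAt_integral
    filter_upwards [h1, h2] with t h1 h2 ht
    have ht' := uIoc_subset_uIcc ht
    have d1 : HasDerivAt I (a t) t := h1 ht' α hαm
    have d2 : HasDerivAt w (q t - a t * v t) t := (h2 ht' α hαm).const_add c
    have hvt : v t = w t := hv t (hu ▸ ht')
    rw [d1.exp.deriv, d2.deriv, hvt]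
    ring
  rw [intervalIntegral.integral_congr_ae hderiv] at hmain
  have hwβ : w β = v β := (hv β ⟨hαβ, le_rfl⟩).symm
  have hIα : I α = 0 := by simp [hI]
  have hwα : w α = c := by simp [hw]
  simp only [hIα, hwα, hwβ, Real.exp_zero, one_mul] at hmain
  have h3 : ∫ s in α..β, Real.exp (-∫ r in s..β, a r) * q s =
      Real.exp (-I β) * ∫ s in α..β, Real.exp (I s) * q s := by
    rw [← intervalIntegral.integral_const_mul]
    refine intervalIntegral.integral_congr fun s hs => ?_
    have h4 : I s + ∫ r in s..β, a r = I β :=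
      intervalIntegral.integral_add_adjacent_intervals
        (ha.mono_set (uIcc_subset_uIcc_left hs)) (ha.mono_set (uIcc_subset_uIcc_right hs))
    rw [show -∫ r in s..β, a r = -I β + I s by linarith, Real.exp_add, mul_assoc]
  rw [h3, hmain]
  have h5 : Real.exp (-I β) * Real.exp (I β) = 1 := by rw [← Real.exp_add]; simp
  linear_combination (-(v β)) * h5

end RTE

/-! ### Duhamel's formula along chords. -/

namespace RTE
variable {n : ℕ} {Ω : Set (Space n)}

/-- The restriction to a chord, extended by zero. -/
noncomputable def onChord (Ω : Set (Space n)) (a : Space n × Dir n → ℝ) (p : Space n × Dir n)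
    (t : ℝ) : ℝ :=
  Medium.ind Ω (p.1 + t • (p.2 : Space n)) * a (p.1 + t • (p.2 : Space n), p.2)

/-- Duhamel's formula along almost every chord. -/
lemma Medium.ae_duhamel (A : Medium Ω) [NeZero n] {u g f : Space n → Dir n → ℝ}
    {a q : Space n × Dir n → ℝ}
    (hu : Integrable (fun p : Space n × Dir n => u p.1 p.2) (phaseMeasure Ω))
    (hg : Integrable (fun p : Space n × Dir n => g p.1 p.2) (phaseMeasure Ω))
    (hw : HasTransportDeriv Ω u g)
    (hcont : ∀ᵐ p ∂(phaseMeasure Ω),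
      ContinuousOn (fun t : ℝ => u (p.1 + t • (p.2 : Space n)) p.2)
        (Icc (-tauMinus Ω p.1 p.2) (tauPlus Ω p.1 p.2)))
    (hbd : ∀ᵐ p ∂(phaseMeasure Ω),
      u (p.1 - tauMinus Ω p.1 p.2 • (p.2 : Space n)) p.2 =
        f (p.1 - tauMinus Ω p.1 p.2 • (p.2 : Space n)) p.2)
    (ha : Integrable a (phaseMeasure Ω))
    (heq : ∀ᵐ p ∂(phaseMeasure Ω), g p.1 p.2 = q p - a p * u p.1 p.2) :
    ∀ᵐ p ∂(phaseMeasure Ω), ∀ β ∈ Icc (-tauMinus Ω p.1 p.2) (tauPlus Ω p.1 p.2),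
      u (p.1 + β • (p.2 : Space n)) p.2 =
        f (p.1 - tauMinus Ω p.1 p.2 • (p.2 : Space n)) p.2 *
          Real.exp (-∫ s in (-tauMinus Ω p.1 p.2)..β, onChord Ω a p s) +
        ∫ s in (-tauMinus Ω p.1 p.2)..β,
          Real.exp (-∫ r in s..β, onChord Ω a p r) * onChord Ω q p s := by
  -- The exceptional set of `ae_chord_increment` depends on the increment, so only rational
  -- increments are used. Continuity along the chord then gives all the others, including those that
  -- reach the end points.
  have hrat : ∀ᵐ p ∂phaseMeasure Ω, ∀ r : ℚ, p.1 + (r : ℝ) • (p.2 : Space n) ∈ Ω →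
      u (p.1 + (r : ℝ) • (p.2 : Space n)) p.2 - u p.1 p.2 =
        ∫ s in (0 : ℝ)..r, g (p.1 + s • (p.2 : Space n)) p.2 :=
    ae_all_iff.2 fun r => ae_chord_increment A.isOpen A.convex hu hg hw r
  filter_upwards [hrat, hcont, hbd, A.integrable_chord hg, A.integrable_chord ha,
    A.ae_chord heq, ae_phase_mem A.isOpen] with p hr hc hb hgi hai hae hp β hβ
  have hmem := fun t : ℝ => chord_mem_iff A.isOpen A.bounded A.convex hp p.2 (t := t)
  have hτm := tauMinus_pos A.isOpen A.bounded A.convex hp p.2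
  have hτp := tauPlus_pos A.isOpen A.bounded A.convex hp p.2
  set α := -tauMinus Ω p.1 p.2 with hα
  set T := tauPlus Ω p.1 p.2 with hT
  have hα0 : α < 0 := by linarith
  set v : ℝ → ℝ := fun t => u (p.1 + t • (p.2 : Space n)) p.2 with hv
  set G : ℝ → ℝ := fun t => Medium.ind Ω (p.1 + t • (p.2 : Space n)) *
    g (p.1 + t • (p.2 : Space n)) p.2 with hG
  have hGi : Integrable G := hgi
  have hGint : ∀ x y, IntervalIntegrable G volume x y := fun x y => hGi.intervalIntegrable
  have hH : EqOn v (fun t => u p.1 p.2 + ∫ s in (0 : ℝ)..t, G s) (Icc α T) := by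
    have hs : EqOn v (fun t => u p.1 p.2 + ∫ s in (0 : ℝ)..t, G s)
        (Ioo α T ∩ range ((↑) : ℚ → ℝ)) := by
      rintro _ ⟨ht, r, rfl⟩
      have h1 := hr r ((hmem r).2 ht)
      have h2 : ∫ s in (0 : ℝ)..r, G s = ∫ s in (0 : ℝ)..r, g (p.1 + s • (p.2 : Space n)) p.2 := by
        refine intervalIntegral.integral_congr fun s hs => ?_
        have h3 : p.1 + s • (p.2 : Space n) ∈ Ω := by
          rw [hmem]
          exact (ordConnected_Ioo.uIcc_subset ⟨hα0, hτp⟩ ht) hs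
        simp [hG, Medium.ind_mem h3]
      simp only [hv, h2]
      linarith
    refine hs.of_subset_closure hc ?_ (inter_subset_left.trans Ioo_subset_Icc_self) ?_
    · exact (continuous_const.add (intervalIntegral.continuous_primitive hGint 0)).continuousOn
    · rw [← closure_Ioo (by linarith : α ≠ T)]
      refine closure_minimal ?_ isClosed_closure
      exact (Rat.isDenseEmbedding_coe_real.dense).open_subset_closure_inter isOpen_Ioo
  have hvα : v α = f (p.1 - tauMinus Ω p.1 p.2 • (p.2 : Space n)) p.2 := by
    rw [← hb]; simp only [hv, hα, neg_smul, ← sub_eq_add_neg]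
  have hv2 : ∀ t ∈ Icc α T, v t = v α + ∫ s in α..t, G s := by
    intro t ht
    rw [hH ht, hH ⟨le_rfl, by linarith⟩, add_assoc,
      intervalIntegral.integral_add_adjacent_intervals (hGint _ _) (hGint _ _)]
  have hGae : ∀ᵐ s : ℝ, G s = onChord Ω q p s - onChord Ω a p s * v s := by
    filter_upwards [hae] with s hs
    by_cases h1 : p.1 + s • (p.2 : Space n) ∈ Ω
    · simp [hG, onChord, Medium.ind_mem h1, hs h1, hv]
    · simp [hG, onChord, Medium.ind_notMem h1]
  rw [← hvα]
  refine integral_factor (v := v) (c := v α) (α := α) (β := β) hβ.1 ?_ ?_ ?_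
  · exact Integrable.intervalIntegrable hai
  · exact (hGint α β).congr_ae (ae_restrict_of_ae hGae)
  · intro t ht
    rw [hv2 t ⟨ht.1, ht.2.trans hβ.2⟩]
    congr 1
    exact intervalIntegral.integral_congr_ae (hGae.mono fun s hs _ => hs)

end RTE

/-! ### Attenuation factors and Duhamel integrals in terms of the kernels. -/

namespace RTE

lemma setIntegral_Ioi_eq_intervalIntegral {F : ℝ → ℝ} {s T : ℝ} (hs : s ≤ T)
    (hF : ∀ t, T ≤ t → F t = 0) : ∫ r in Ioi s, F r = ∫ r in s..T, F r := by
  rw [intervalIntegral.integral_of_le hs]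
  refine setIntegral_eq_of_subset_of_forall_sdiff_eq_zero measurableSet_Ioi Ioc_subset_Ioi_self ?_
  intro t ht
  refine hF t ?_
  by_contra hlt
  exact ht.2 ⟨ht.1, (not_le.1 hlt).le⟩

lemma setIntegral_Ioi_comp_add (F : ℝ → ℝ) (s : ℝ) :
    ∫ r in Ioi 0, F (s + r) = ∫ r in Ioi s, F r := by
  rw [← integral_indicator measurableSet_Ioi, ← integral_indicator measurableSet_Ioi,
    ← integral_add_left_eq_self ((Ioi s).indicator F) s]
  refine integral_congr_ae (ae_of_all _ fun r => ?_)
  simp [indicator]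

variable {n : ℕ} {Ω : Set (Space n)}
namespace Medium
variable (A : Medium Ω)

lemma onChord_sg (p : Space n × Dir n) (t : ℝ) :
    onChord Ω A.sg p t = A.sg (p.1 + t • (p.2 : Space n), p.2) := by
  by_cases h : p.1 + t • (p.2 : Space n) ∈ Ω
  · simp [onChord, ind_mem h]
  · rw [onChord, ind_notMem h, A.sg_zero _ h, zero_mul]

lemma integrable_sg_chord {p : Space n × Dir n} (hp : p.1 ∈ Ω) :
    Integrable fun t : ℝ => A.sg (p.1 + t • (p.2 : Space n), p.2) := by
  have hm : Measurable fun t : ℝ => A.sg (p.1 + t • (p.2 : Space n), p.2) :=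
    A.sg_meas.comp (by fun_prop)
  have h1 : IntegrableOn (fun t : ℝ => A.sg (p.1 + t • (p.2 : Space n), p.2))
      (Ioo (-tauMinus Ω p.1 p.2) (tauPlus Ω p.1 p.2)) :=
    Integrable.of_bound hm.aestronglyMeasurable A.Cs
      (ae_of_all _ fun t => by rw [Real.norm_of_nonneg (A.sg_nonneg _)]; exact A.sg_le _)
  refine h1.integrable_of_forall_notMem_eq_zero fun t ht => A.sg_zero _ ?_
  rwa [chord_mem_iff A.isOpen A.bounded A.convex hp]

/-- Attenuation along the part of the chord in front of one of its points. -/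
lemma fwd_eq {p : Space n × Dir n} (hp : p.1 ∈ Ω) {s : ℝ} (hs : s ≤ tauPlus Ω p.1 p.2) :
    A.fwd (p.1 + s • (p.2 : Space n), p.2) =
      Real.exp (-∫ r in s..tauPlus Ω p.1 p.2, onChord Ω A.sg p r) := by
  simp_rw [onChord_sg]
  rw [fwd]
  congr 2
  rw [← setIntegral_Ioi_eq_intervalIntegral hs,
    ← setIntegral_Ioi_comp_add (fun r => A.sg (p.1 + r • (p.2 : Space n), p.2))]
  · simp only [add_smul, add_assoc]
  · intro t ht
    refine A.sg_zero _ ?_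
    rw [chord_mem_iff A.isOpen A.bounded A.convex hp]
    exact fun h => absurd h.2 (not_lt.2 ht)

lemma bwd_eq {p : Space n × Dir n} (hp : p.1 ∈ Ω) :
    A.bwd p = Real.exp (-∫ r in (-tauMinus Ω p.1 p.2)..0, onChord Ω A.sg p r) := by
  simp_rw [onChord_sg]
  rw [bwd]
  congr 2
  have h := intervalIntegral.integral_comp_neg (a := 0) (b := tauMinus Ω p.1 p.2)
    (f := fun r => A.sg (p.1 + r • (p.2 : Space n), p.2))
  rw [neg_zero] at h
  rw [← h, ← setIntegral_Ioi_eq_intervalIntegral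
    (by rw [tauMinus_eq_tauPlus_neg]; exact tauPlus_nonneg _ _)]
  · simp only [neg_smul, sub_eq_add_neg]
  · intro t ht
    refine A.sg_zero _ ?_
    rw [chord_mem_iff A.isOpen A.bounded A.convex hp]
    exact fun h => absurd h.1 (by linarith)

lemma seg_eq (p : Space n × Dir n) {s : ℝ} (hs : 0 ≤ s) :
    A.seg (p, s) = Real.exp (-∫ r in (-s)..0, onChord Ω A.sg p r) := by
  simp_rw [onChord_sg]
  rw [seg]
  congr 2
  have h := intervalIntegral.integral_comp_neg (a := 0) (b := s)
    (f := fun r => A.sg (p.1 + r • (p.2 : Space n), p.2))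
  rw [neg_zero] at h
  rw [← h, integral_indicator measurableSet_Ioc, intervalIntegral.integral_of_le hs]
  simp only [neg_smul, sub_eq_add_neg]

lemma fwd_mul_bwd {p : Space n × Dir n} (hp : p.1 ∈ Ω) :
    A.bwd p * A.fwd p = Real.exp
      (-∫ r in (-tauMinus Ω p.1 p.2)..(tauPlus Ω p.1 p.2), onChord Ω A.sg p r) := by
  have h1 := A.fwd_eq hp (tauPlus_nonneg p.1 p.2)
  rw [zero_smul, add_zero] at h1
  have hi : Integrable (onChord Ω A.sg p) := by
    refine (A.integrable_sg_chord hp).congr (ae_of_all _ fun t => (A.onChord_sg p t).symm)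
  rw [A.bwd_eq hp, h1, ← Real.exp_add, ← neg_add,
    intervalIntegral.integral_add_adjacent_intervals hi.intervalIntegrable hi.intervalIntegrable]

/-- The exit integral of Duhamel's formula. -/
lemma integral_exitKernel_eq {p : Space n × Dir n} (hp : p.1 ∈ Ω) {q : Space n × Dir n → ℝ}
    (hq : Measurable q) :
    ∫ z, q z ∂(A.exitKernel p) = ∫ s in (-tauMinus Ω p.1 p.2)..(tauPlus Ω p.1 p.2),
      Real.exp (-∫ r in s..(tauPlus Ω p.1 p.2), onChord Ω A.sg p r) * onChord Ω q p s := by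
  have h0 : -tauMinus Ω p.1 p.2 ≤ tauPlus Ω p.1 p.2 := by
    linarith [tauMinus_pos A.isOpen A.bounded A.convex hp p.2, tauPlus_nonneg (Ω := Ω) p.1 p.2]
  rw [exitKernel, integral_weightedKernel A.exitDensity_nonneg _ hq,
    intervalIntegral.integral_of_le h0, ← setIntegral_eq_integral_of_forall_compl_eq_zero
      (s := Ioc (-tauMinus Ω p.1 p.2) (tauPlus Ω p.1 p.2))]
  · refine setIntegral_congr_fun measurableSet_Ioc fun s hs => ?_
    dsimp only
    rw [← A.fwd_eq hp hs.2, exitDensity, onChord, ind_mem hp]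
    ring
  · intro s hs
    have : p.1 + s • (p.2 : Space n) ∉ Ω := by
      rw [chord_mem_iff A.isOpen A.bounded A.convex hp]
      exact fun h => hs (Ioo_subset_Ioc_self h)
    simp [exitDensity, ind_notMem this]

/-- Free transport from behind. -/
noncomputable def backInt (q : Space n × Dir n → ℝ) (p : Space n × Dir n) : ℝ :=
  ∫ s in Ioi (0 : ℝ), ind Ω (p.1 - s • (p.2 : Space n)) * A.seg (p, s) *
    q (p.1 - s • (p.2 : Space n), p.2)

lemma backInt_eq {p : Space n × Dir n} (hp : p.1 ∈ Ω) (q : Space n × Dir n → ℝ) :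
    A.backInt q p = ∫ s in (-tauMinus Ω p.1 p.2)..0,
      Real.exp (-∫ r in s..0, onChord Ω A.sg p r) * onChord Ω q p s := by
  have h0 : 0 ≤ tauMinus Ω p.1 p.2 := (tauMinus_pos A.isOpen A.bounded A.convex hp p.2).le
  have h := intervalIntegral.integral_comp_neg (a := 0) (b := tauMinus Ω p.1 p.2)
    (f := fun s => Real.exp (-∫ r in s..0, onChord Ω A.sg p r) * onChord Ω q p s)
  rw [neg_zero] at h
  rw [← h, backInt, setIntegral_Ioi_eq_intervalIntegral h0]
  · refine intervalIntegral.integral_congr fun s hs => ?_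
    rw [uIcc_of_le h0] at hs
    simp only [A.seg_eq p hs.1, onChord, neg_smul, ← sub_eq_add_neg]
    ring
  · intro t ht
    have : p.1 - t • (p.2 : Space n) ∉ Ω := by
      rw [sub_eq_add_neg, ← neg_smul, chord_mem_iff A.isOpen A.bounded A.convex hp]
      exact fun h => absurd h.1 (by linarith)
    simp [ind_notMem this]

end Medium

lemma measurePreserving_swap_right {X Y : Type*} [MeasurableSpace X] [MeasurableSpace Y]
    (μ : Measure X) (ν : Measure Y) [SFinite μ] [SFinite ν] :
    MeasurePreserving (fun q : (X × Y) × Y => ((q.1.1, q.2), q.1.2)) ((μ.prod ν).prod ν)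
      ((μ.prod ν).prod ν) := by
  have h1 := (measurePreserving_prodAssoc μ ν ν)
  have h2 : MeasurePreserving (Prod.map id Prod.swap : X × Y × Y → X × Y × Y)
      (μ.prod (ν.prod ν)) (μ.prod (ν.prod ν)) :=
    (MeasurePreserving.id μ).prod Measure.measurePreserving_swap
  have h3 := (measurePreserving_prodAssoc μ ν ν).symm
  exact h3.comp (h2.comp h1)

/-- The incoming direction is the second argument of `k` but the integration variable of `K u (x,
θ)`. This regrouping carries almost everywhere statements about `k` over to almost every `(x, θ)`.
-/
lemma phase_prod_triple (Ω : Set (Space n)) :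
    MeasurePreserving (fun q : (Space n × Dir n) × Dir n => (q.1.1, q.2, q.1.2))
      ((phaseMeasure Ω).prod (sphereMeasure n))
      ((volume.restrict Ω).prod ((sphereMeasure n).prod (sphereMeasure n))) :=
  (measurePreserving_prodAssoc _ _ _).comp (measurePreserving_swap_right _ _)

namespace Medium
variable (A : Medium Ω)

/-- The scattering operator with the kernel `A.kk`. -/
noncomputable def scat (v : Space n × Dir n → ℝ) (p : Space n × Dir n) : ℝ :=
  ∫ θ', A.kk (p.1, θ', p.2) * v (p.1, θ') ∂(sphereMeasure n)

lemma integrable_kk_mul [NeZero n] {v : Space n × Dir n → ℝ} (hv : Integrable v (phaseMeasure Ω)) :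
    Integrable (fun q : (Space n × Dir n) × Dir n => A.kk (q.1.1, q.2, q.1.2) * v (q.1.1, q.2))
      ((phaseMeasure Ω).prod (sphereMeasure n)) := by
  have h1 : Integrable (fun q : (Space n × Dir n) × Dir n => v (q.1.1, q.2))
      ((phaseMeasure Ω).prod (sphereMeasure n)) := by
    have h2 : Integrable (fun q : (Space n × Dir n) × Dir n => v q.1)
      ((phaseMeasure Ω).prod (sphereMeasure n)) := hv.comp_fst _
    exact (measurePreserving_swap_right (volume.restrict Ω)
      (sphereMeasure n)).integrable_comp_of_integrable h2
  refine h1.bdd_mul (c := A.Ck) (A.kk_meas.comp (by fun_prop)).aestronglyMeasurable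
    (ae_of_all _ fun q => ?_)
  rw [Real.norm_of_nonneg (A.kk_nonneg _)]; exact A.kk_le _

lemma integrable_scat [NeZero n] {v : Space n × Dir n → ℝ} (hv : Integrable v (phaseMeasure Ω)) :
    Integrable (A.scat v) (phaseMeasure Ω) :=
  (A.integrable_kk_mul hv).integral_prod_left

/-- A scattered function transported from behind, expressed by the collision kernel. -/
lemma ae_scat_backInt [NeZero n] {q : Space n × Dir n → ℝ} (hq : Measurable q)
    (hqi : Integrable q (phaseMeasure Ω)) :
    ∀ᵐ p ∂(phaseMeasure Ω), Integrable q (A.collKernel p) ∧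
      Integrable (fun θ' => A.kk (p.1, θ', p.2) * A.backInt q (p.1, θ')) (sphereMeasure n) ∧
      A.scat (A.backInt q) p = ∫ z, q z ∂(A.collKernel p) := by
  have hfin : ∫⁻ p, (∫⁻ z, ‖q z‖ₑ ∂(A.collKernel p)) ∂(phaseMeasure Ω) ≠ ∞ :=
    ne_top_of_le_ne_top (ENNReal.mul_ne_top ENNReal.ofReal_ne_top hqi.2.ne)
      (A.lintegral_collKernel_le hq.enorm)
  filter_upwards [ae_lt_top (hq.enorm.lintegral_kernel (κ := A.collKernel)) hfin] with p hp
  have hi : Integrable q (A.collKernel p) := ⟨hq.aestronglyMeasurable, hp⟩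
  have hm : Measurable fun w : Dir n × ℝ => A.collDensity (p, w) *
      q (p.1 - w.2 • (w.1 : Space n), w.1) :=
    (A.measurable_collDensity.comp measurable_prodMk_left).mul (hq.comp (by fun_prop))
  have hi2 : Integrable (fun w : Dir n × ℝ => A.collDensity (p, w) *
      q (p.1 - w.2 • (w.1 : Space n), w.1))
      ((sphereMeasure n).prod (volume.restrict (Ioi (0 : ℝ)))) := by
    refine ⟨hm.aestronglyMeasurable, ?_⟩
    rw [HasFiniteIntegral]
    rw [collKernel, lintegral_weightedKernel _ hq.enorm] at hp
    convert hp using 3 with w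
    rw [enorm_mul, Real.enorm_of_nonneg (A.collDensity_nonneg _)]
  have heq : ∀ θ', ∫ s in Ioi (0:ℝ), A.collDensity (p, (θ', s)) *
      q (p.1 - s • (θ' : Space n), θ') = A.kk (p.1, θ', p.2) * A.backInt q (p.1, θ') := by
    intro θ'
    rw [backInt, ← integral_const_mul]
    refine integral_congr_ae (ae_of_all _ fun s => ?_)
    simp only [collDensity]
    ring
  refine ⟨hi, ?_, ?_⟩
  · exact hi2.integral_prod_left.congr (ae_of_all _ fun θ' => heq θ')
  · rw [collKernel, integral_weightedKernel A.collDensity_nonneg _ hq, integral_prod _ hi2, scat]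
    exact integral_congr_ae (ae_of_all _ fun θ' => (heq θ').symm)

end Medium
end RTE

/-! ### Outgoing values of the linear problem and resummation. -/

namespace RTE
open ProbabilityTheory
variable {n : ℕ} {Ω : Set (Space n)}

/-- The point of `∂Ω` behind `x` in the direction `θ`, as a measurable function. -/
noncomputable def ent (Ω : Set (Space n)) (p : Space n × Dir n) : Space n :=
  p.1 - lenMinus Ω p • (p.2 : Space n)

lemma measurable_ent (ho : IsOpen Ω) : Measurable (ent Ω) :=
  measurable_fst.sub ((measurable_lenMinus ho).smul (measurable_subtype_coe.comp measurable_snd))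

namespace Medium
variable (A : Medium Ω)

lemma ent_eq (A : Medium Ω) {p : Space n × Dir n} (hp : p.1 ∈ Ω) :
    ent Ω p = p.1 - tauMinus Ω p.1 p.2 • (p.2 : Space n) := by
  rw [ent, ← lenMinus_eq A.isOpen A.bounded A.convex hp]

lemma ent_mem_frontier (A : Medium Ω) {p : Space n × Dir n} (hp : p.1 ∈ Ω) :
    ent Ω p ∈ frontier Ω := by
  rw [A.ent_eq hp]; exact entry_mem_frontier A.isOpen A.bounded hp _

/-- The ballistic part of the solution with boundary values `f`. -/
noncomputable def ball (f : Space n → Dir n → ℝ) (p : Space n × Dir n) : ℝ :=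
  f (ent Ω p) p.2 * A.bwd p

lemma measurable_ball {f : Space n → Dir n → ℝ} (hf : Measurable (Function.uncurry f)) :
    Measurable (A.ball f) :=
  (hf.comp ((measurable_ent A.isOpen).prodMk measurable_snd)).mul A.measurable_bwd

lemma abs_ball_le {f : Space n → Dir n → ℝ} {c : ℝ} (hf : ∀ x θ, |f x θ| ≤ c)
    (p : Space n × Dir n) : |A.ball f p| ≤ c := by
  rw [ball, abs_mul, abs_of_nonneg (A.bwd_nonneg p)]
  have := (abs_nonneg _).trans (hf 0 p.2)
  calc _ ≤ c * 1 := mul_le_mul (hf _ _) (A.bwd_le_one p) (A.bwd_nonneg p) this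
    _ = c := mul_one c

lemma measurable_scat {v : Space n × Dir n → ℝ} (hv : Measurable v) : Measurable (A.scat v) := by
  have : Measurable fun q : (Space n × Dir n) × Dir n =>
      A.kk (q.1.1, q.2, q.1.2) * v (q.1.1, q.2) :=
    (A.kk_meas.comp (by fun_prop)).mul (hv.comp (by fun_prop))
  exact this.stronglyMeasurable.integral_prod_right'.measurable

lemma abs_scat_le [NeZero n] {v : Space n × Dir n → ℝ} {c : ℝ} (hv : ∀ p, |v p| ≤ c)
    (p : Space n × Dir n) : |A.scat v p| ≤ A.Ck * c := by
  rw [scat, ← Real.norm_eq_abs]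
  refine (norm_integral_le_of_norm_le_const (C := A.Ck * c) (ae_of_all _ fun θ' => ?_)).trans
    (by simp)
  rw [norm_mul, Real.norm_of_nonneg (A.kk_nonneg _)]
  exact mul_le_mul (A.kk_le _) (hv _) (norm_nonneg _) A.Ck_nonneg

/-- The outgoing values of the solution of the linear problem with boundary values `f`. -/
noncomputable def linExit [NeZero n] (f : Space n → Dir n → ℝ) (p : Space n × Dir n) : ℝ :=
  A.ball f p * A.fwd p + ∫ z, A.scat (A.ball f) z ∂(A.totalKernel p)

/-- The exit part of the kernel lives on a single chord, so null sets of phase space need not be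
null for every starting point. By the `L¹` bound they are for almost every one. -/
lemma ae_totalKernel (A : Medium Ω) [NeZero n] {P : Space n × Dir n → Prop}
    (h : ∀ᵐ p ∂phaseMeasure Ω, P p) :
    ∀ᵐ p ∂phaseMeasure Ω, ∀ᵐ z ∂(A.totalKernel p), P z := by
  obtain ⟨N, hN, hNm, hN0⟩ := exists_measurable_superset_of_null (ae_iff.1 h)
  have hg : Measurable (N.indicator (1 : Space n × Dir n → ℝ≥0∞)) := measurable_one.indicator hNm
  have h1 := A.lintegral_totalKernel_le hg
  rw [lintegral_indicator_one hNm, hN0, mul_zero, nonpos_iff_eq_zero,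
    lintegral_eq_zero_iff hg.lintegral_kernel] at h1
  filter_upwards [h1] with p hp
  rw [lintegral_indicator_one hNm] at hp
  exact measure_mono_null hN hp

lemma integrable_totalKernel (A : Medium Ω) [NeZero n] {q : Space n × Dir n → ℝ} (hq : Measurable q)
    (hqi : Integrable q (phaseMeasure Ω)) :
    ∀ᵐ p ∂phaseMeasure Ω, Integrable q (A.totalKernel p) := by
  have hfin : ∫⁻ p, (∫⁻ z, ‖q z‖ₑ ∂(A.totalKernel p)) ∂(phaseMeasure Ω) ≠ ∞ :=
    ne_top_of_le_ne_top (ENNReal.mul_ne_top A.bound_ne_top hqi.2.ne)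
      (A.lintegral_totalKernel_le hq.enorm)
  filter_upwards [ae_lt_top (hq.enorm.lintegral_kernel (κ := A.totalKernel)) hfin] with p hp
  exact ⟨hq.aestronglyMeasurable, hp⟩

/-- Resummation of the collision series. -/
lemma ae_exit_resum [NeZero n] {s w : Space n × Dir n → ℝ} (hs : Measurable s) (hw : Measurable w)
    (hsi : Integrable s (phaseMeasure Ω)) (hwi : Integrable w (phaseMeasure Ω))
    (h : ∀ᵐ p ∂phaseMeasure Ω, s p = w p + ∫ z, s z ∂(A.collKernel p)) :
    ∀ᵐ p ∂phaseMeasure Ω, ∫ z, s z ∂(A.exitKernel p) = ∫ z, w z ∂(A.totalKernel p) := by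
  filter_upwards [A.ae_totalKernel h, A.integrable_totalKernel hs hsi,
    A.integrable_totalKernel hw hwi] with p h1 h2 h3
  have e1 : A.totalKernel p = A.exitKernel p + (A.collKernel ∘ₖ A.totalKernel) p := by
    conv_lhs => rw [A.totalKernel_eq]
    rfl
  have h2' := h2
  rw [e1] at h2'
  have i1 : Integrable s (A.exitKernel p) := h2'.left_of_add_measure
  have i2 : Integrable s ((A.collKernel ∘ₖ A.totalKernel) p) := h2'.right_of_add_measure
  -- The integral of `s` against the total kernel is evaluated twice, by the renewal identity and by
  -- the fixed point equation of `s`. The common double integral is finite and cancels.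
  have e2 : ∫ z, s z ∂(A.totalKernel p) =
      ∫ z, s z ∂(A.exitKernel p) + ∫ y, ∫ z, s z ∂(A.collKernel y) ∂(A.totalKernel p) := by
    conv_lhs => rw [e1, integral_add_measure i1 i2, Kernel.integral_comp i2]
  have e3 : ∫ z, s z ∂(A.totalKernel p) =
      ∫ z, w z ∂(A.totalKernel p) + ∫ y, ∫ z, s z ∂(A.collKernel y) ∂(A.totalKernel p) := by
    rw [integral_congr_ae h1, integral_add h3 i2.integral_comp]
  linarith

end Medium
end RTE

/-! ### Comparison of the nonlinear problem with the linear one. -/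

namespace RTE
open ProbabilityTheory
variable {n : ℕ} {Ω : Set (Space n)}
namespace Medium
variable (A : Medium Ω)

/-- An `L¹` function that is dominated by a constant and its scattered transport has bounded
angular averages. -/
lemma lintegral_angle_le [NeZero n] {v : Space n × Dir n → ℝ≥0∞} (hv : Measurable v)
    (hfin : ∫⁻ p, v p ∂(phaseMeasure Ω) ≠ ∞) {c : ℝ} (hc : 0 ≤ c)
    (h : ∀ᵐ p ∂(phaseMeasure Ω), v p ≤ ENNReal.ofReal c + ENNReal.ofReal A.Ck *
      ∫⁻ t : ℝ, ENNReal.ofReal (ind Ω (p.1 + t • (p.2 : Space n))) *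
        ∫⁻ θ, v (p.1 + t • (p.2 : Space n), θ) ∂(sphereMeasure n)) :
    ∀ᵐ x ∂(volume.restrict Ω), ∫⁻ θ, v (x, θ) ∂(sphereMeasure n) ≤
      ENNReal.ofReal (c / (1 - A.Ck * A.M)) := by
  -- `C` solves `c + Ck * M * C = C`, the bound that iterating the hypothesis suggests. Since the
  -- averages are only known to be integrable, the iteration is replaced by an `L¹` estimate of
  -- their excess `e` over `C`.
  set C := c / (1 - A.Ck * A.M) with hC
  have h1 : 0 < 1 - A.Ck * A.M := by linarith [A.lt_one]
  have hC0 : 0 ≤ C := div_nonneg hc h1.le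
  have hCc : c + A.Ck * (A.M * C) = C := by
    rw [hC]; field_simp; ring
  set m : Space n → ℝ≥0∞ := fun x => ∫⁻ θ, v (x, θ) ∂(sphereMeasure n) with hm
  have hmm : Measurable m := hv.lintegral_prod_right'
  set e : Space n → ℝ≥0∞ := fun x => m x - ENNReal.ofReal C with he
  have hem : Measurable e := hmm.sub measurable_const
  have hprod : ∀ g : Space n → ℝ≥0∞, Measurable g →
      ∫⁻ p, g p.1 ∂(phaseMeasure Ω) = ∫⁻ x in Ω, g x := by
    intro g hg
    have h2 : Measurable fun p : Space n × Dir n => g p.1 := hg.comp measurable_fst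
    rw [phaseMeasure, lintegral_prod _ h2.aemeasurable]
    simp
  have hmint : ∫⁻ x in Ω, m x = ∫⁻ p, v p ∂(phaseMeasure Ω) := by
    rw [phaseMeasure, lintegral_prod _ hv.aemeasurable]
  have hmeasI : Measurable fun q : (Space n × Dir n) × ℝ =>
      ENNReal.ofReal (ind Ω (q.1.1 + q.2 • (q.1.2 : Space n))) *
        e (q.1.1 + q.2 • (q.1.2 : Space n)) :=
    ((measurable_ind A.isOpen).comp (by fun_prop)).ennreal_ofReal.mul (hem.comp (by fun_prop))
  set I : Space n × Dir n → ℝ≥0∞ := fun p =>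
    ∫⁻ t : ℝ, ENNReal.ofReal (ind Ω (p.1 + t • (p.2 : Space n))) *
      e (p.1 + t • (p.2 : Space n)) with hI
  have hIm : Measurable I := hmeasI.lintegral_prod_right'
  have hv2 : ∀ᵐ p ∂(phaseMeasure Ω), v p ≤ ENNReal.ofReal C + ENNReal.ofReal A.Ck * I p := by
    filter_upwards [h, ae_phase_mem A.isOpen] with p hp hpΩ
    refine hp.trans ?_
    have h2 : ∫⁻ t : ℝ, ENNReal.ofReal (ind Ω (p.1 + t • (p.2 : Space n))) *
        m (p.1 + t • (p.2 : Space n)) ≤ I p + ENNReal.ofReal A.M * ENNReal.ofReal C := by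
      calc _ ≤ ∫⁻ t : ℝ, (ENNReal.ofReal (ind Ω (p.1 + t • (p.2 : Space n))) *
            e (p.1 + t • (p.2 : Space n)) +
            ENNReal.ofReal (ind Ω (p.1 + t • (p.2 : Space n))) * ENNReal.ofReal C) := by
            refine lintegral_mono fun t => ?_
            rw [← mul_add]
            gcongr
            exact le_tsub_add
        _ = I p + (∫⁻ t : ℝ, ENNReal.ofReal (ind Ω (p.1 + t • (p.2 : Space n)))) *
            ENNReal.ofReal C := by
            have hmI : Measurable fun t : ℝ => ENNReal.ofReal (ind Ω (p.1 + t • (p.2 : Space n))) *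
                e (p.1 + t • (p.2 : Space n)) :=
              ((measurable_ind A.isOpen).comp (by fun_prop)).ennreal_ofReal.mul
                (hem.comp (by fun_prop))
            rw [lintegral_add_left hmI,
              lintegral_mul_const' _ _ ENNReal.ofReal_ne_top]
        _ ≤ _ := by gcongr; exact A.lintegral_ind_chord_le hpΩ p.2
    calc _ ≤ ENNReal.ofReal c + ENNReal.ofReal A.Ck *
          (I p + ENNReal.ofReal A.M * ENNReal.ofReal C) := by gcongr
      _ = ENNReal.ofReal (c + A.Ck * (A.M * C)) + ENNReal.ofReal A.Ck * I p := by
          rw [ENNReal.ofReal_add hc (mul_nonneg A.Ck_nonneg (mul_nonneg A.M_nonneg hC0)),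
            ENNReal.ofReal_mul A.Ck_nonneg, ENNReal.ofReal_mul A.M_nonneg]
          ring
      _ = _ := by rw [hCc]
  have hm2 : ∀ᵐ x ∂(volume.restrict Ω),
      e x ≤ ENNReal.ofReal A.Ck * ∫⁻ θ, I (x, θ) ∂(sphereMeasure n) := by
    filter_upwards [Measure.ae_ae_of_ae_prod hv2] with x hx
    rw [he, tsub_le_iff_left]
    calc m x ≤ ∫⁻ θ, (ENNReal.ofReal C + ENNReal.ofReal A.Ck * I (x, θ)) ∂(sphereMeasure n) :=
          lintegral_mono_ae hx
      _ = _ := by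
        rw [lintegral_add_left measurable_const, lintegral_const, measure_univ, mul_one,
          lintegral_const_mul' _ _ ENNReal.ofReal_ne_top]
  have hE : ∫⁻ x in Ω, e x ≤ ENNReal.ofReal (A.Ck * A.M) * ∫⁻ x in Ω, e x := by
    calc _ ≤ ∫⁻ x in Ω, ENNReal.ofReal A.Ck * ∫⁻ θ, I (x, θ) ∂(sphereMeasure n) :=
          lintegral_mono_ae hm2
      _ = ENNReal.ofReal A.Ck * ∫⁻ p, I p ∂(phaseMeasure Ω) := by
        rw [lintegral_const_mul' _ _ ENNReal.ofReal_ne_top, phaseMeasure,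
          lintegral_prod _ hIm.aemeasurable]
      _ ≤ ENNReal.ofReal A.Ck * (ENNReal.ofReal A.M * ∫⁻ p, e p.1 ∂(phaseMeasure Ω)) := by
        gcongr
        exact A.lintegral_chord_le (g := fun p => e p.1) (hem.comp measurable_fst)
      _ = _ := by rw [hprod e hem, ← mul_assoc, ← ENNReal.ofReal_mul A.Ck_nonneg]
  have hEfin : ∫⁻ x in Ω, e x ≠ ∞ :=
    ne_top_of_le_ne_top (hmint ▸ hfin) (lintegral_mono fun x => tsub_le_self)
  -- A finite quantity that is at most `Ck * M < 1` times itself vanishes.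
  have hE0 : ∫⁻ x in Ω, e x = 0 := by
    by_contra hne
    have : ENNReal.ofReal (A.Ck * A.M) * ∫⁻ x in Ω, e x < 1 * ∫⁻ x in Ω, e x :=
      (ENNReal.mul_lt_mul_iff_left hne hEfin).2 (by simpa using A.lt_one)
    rw [one_mul] at this
    exact absurd hE (not_le.2 this)
  rw [lintegral_eq_zero_iff hem] at hE0
  filter_upwards [hE0] with x hx
  exact tsub_eq_zero_iff_le.1 hx

/-- The nonlinear problem and the linear one have nearly the same outgoing values. -/
theorem lintegral_exit_sub_linExit_le [NeZero n] {σa σb : Space n → Dir n → ℝ}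
    {k : Space n → Dir n → Dir n → ℝ}
    (hσ : ∀ᵐ p ∂(phaseMeasure Ω), σa p.1 p.2 = A.sg p)
    (hk : ∀ᵐ q ∂((volume.restrict Ω).prod ((sphereMeasure n).prod (sphereMeasure n))),
      k q.1 q.2.1 q.2.2 = A.kk q)
    (hσbm : AEStronglyMeasurable (fun p : Space n × Dir n => σb p.1 p.2) (phaseMeasure Ω))
    (hσb0 : ∀ᵐ p ∂(phaseMeasure Ω), 0 ≤ σb p.1 p.2) {Cb : ℝ}
    (hσb : ∀ᵐ p ∂(phaseMeasure Ω), σb p.1 p.2 ≤ Cb) (hCb : 0 ≤ Cb)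
    {f u : Space n → Dir n → ℝ} (hf : Measurable (Function.uncurry f)) {c : ℝ}
    (hfc : ∀ x θ, |f x θ| ≤ c) (hsol : IsSolution Ω σa σb k f u) :
    ∫⁻ p, ‖u (p.1 + tauPlus Ω p.1 p.2 • (p.2 : Space n)) p.2 - A.linExit f p‖ₑ ∂(phaseMeasure Ω) ≤
      A.bound * ENNReal.ofReal (Cb * (c / (1 - A.Ck * A.M)) ^ 2 * volume.real Ω) := by
  have hfin := isFiniteMeasure_phase A.bounded
  have hfinΩ := isFiniteMeasure_restrict A.bounded
  obtain ⟨g, hgi, hw, hgeq⟩ := hsol.equation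
  have hui := hsol.integrable
  set U : Space n × Dir n → ℝ := fun p => u p.1 p.2 with hU
  have hc0 : 0 ≤ c ∨ Ω = ∅ := by
    rcases eq_empty_or_nonempty Ω with h | ⟨x, hx⟩
    · exact Or.inr h
    · left
      have : Nonempty (Dir n) := by
        obtain ⟨v, hv⟩ := (NormedSpace.sphere_nonempty (E := Space n) (x := 0) (r := 1)).2
          zero_le_one
        exact ⟨⟨v, hv⟩⟩
      obtain ⟨θ⟩ := this
      exact (abs_nonneg _).trans (hfc x θ)
  rcases hc0 with hc0 | hempty
  swap
  · subst hempty
    simp [phaseMeasure]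
  set C := c / (1 - A.Ck * A.M) with hC
  have hC0 : 0 ≤ C := div_nonneg hc0 (by linarith [A.lt_one])
  -- the scattering term
  set Q := A.scat U with hQ
  have hQi : Integrable Q (phaseMeasure Ω) := A.integrable_scat hui
  have hscat : ∀ᵐ p ∂(phaseMeasure Ω), scatter k u p.1 p.2 = Q p := by
    have h1 := (phase_prod_triple Ω).quasiMeasurePreserving.ae hk
    filter_upwards [Measure.ae_ae_of_ae_prod h1] with p hp
    refine integral_congr_ae ?_
    filter_upwards [hp] with θ' hθ'
    exact congrArg (· * u p.1 θ') hθ'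
  -- the absorption term
  have hav : Integrable (fun p : Space n × Dir n => angularAvg u p.1) (phaseMeasure Ω) :=
    (Integrable.integral_prod_left hui).comp_fst _
  have hsgi : Integrable A.sg (phaseMeasure Ω) :=
    Integrable.of_bound A.sg_meas.aestronglyMeasurable A.Cs
      (ae_of_all _ fun t => by rw [Real.norm_of_nonneg (A.sg_nonneg _)]; exact A.sg_le _)
  have hσbn : ∀ᵐ p ∂(phaseMeasure Ω), ‖σb p.1 p.2‖ ≤ Cb := by
    filter_upwards [hσb0, hσb] with p h1 h2
    rwa [Real.norm_of_nonneg h1]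
  have hbi : Integrable (fun p : Space n × Dir n => σb p.1 p.2 * |angularAvg u p.1|)
      (phaseMeasure Ω) := hav.abs.bdd_mul hσbm hσbn
  -- For the bound on the averages the nonlinear absorption stays in the exponent. Being
  -- non-negative it only damps, so `|u|` is at most `c` plus the transported scattering term, which
  -- is the hypothesis of `lintegral_angle_le`.
  set a : Space n × Dir n → ℝ := fun p => A.sg p + σb p.1 p.2 * |angularAvg u p.1| with ha
  have hai : Integrable a (phaseMeasure Ω) := hsgi.add hbi
  have hgeq1 : ∀ᵐ p ∂(phaseMeasure Ω), g p.1 p.2 = Q p - a p * u p.1 p.2 := by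
    filter_upwards [hgeq, hscat, hσ] with p h1 h2 h3
    rw [h2, h3] at h1
    simp only [ha]
    linarith
  -- a measurable version of the solution
  set U' := hui.1.mk U with hU'
  have hU'm : Measurable U' := hui.1.stronglyMeasurable_mk.measurable
  have hUU' : ∀ᵐ p ∂(phaseMeasure Ω), U p = U' p := hui.1.ae_eq_mk
  have hUU'x : ∀ᵐ x ∂(volume.restrict Ω), ∀ᵐ θ ∂(sphereMeasure n), U (x, θ) = U' (x, θ) :=
    Measure.ae_ae_of_ae_prod hUU'
  have hQle : ∀ᵐ p ∂(phaseMeasure Ω), ‖Q p‖ₑ ≤ ENNReal.ofReal A.Ck *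
      ∫⁻ θ', ‖U' (p.1, θ')‖ₑ ∂(sphereMeasure n) := by
    have h1 : ∀ᵐ p ∂(phaseMeasure Ω), ∀ᵐ θ' ∂(sphereMeasure n), U (p.1, θ') = U' (p.1, θ') :=
      Measure.quasiMeasurePreserving_fst.ae hUU'x
    filter_upwards [h1] with p hp
    rw [hQ, scat]
    refine (enorm_integral_le_lintegral_enorm _).trans ?_
    rw [← lintegral_const_mul' _ _ ENNReal.ofReal_ne_top]
    refine lintegral_mono_ae ?_
    filter_upwards [hp] with θ' hθ'
    rw [enorm_mul, hθ', Real.enorm_of_nonneg (A.kk_nonneg _)]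
    gcongr
    exact A.kk_le _
  have hangle : ∀ᵐ x ∂(volume.restrict Ω), ∫⁻ θ, ‖U' (x, θ)‖ₑ ∂(sphereMeasure n) ≤
      ENNReal.ofReal C := by
    refine A.lintegral_angle_le hU'm.enorm (hui.congr hUU').2.ne hc0 ?_
    filter_upwards [A.ae_duhamel hui hgi hw hsol.continuous_chord hsol.boundary hai hgeq1,
      hUU', A.ae_chord hQle, A.integrable_chord hQi, A.ae_chord hσb0,
      ae_phase_mem A.isOpen] with p h1 h2 h3 h4 h5 hp
    have hτm := tauMinus_pos A.isOpen A.bounded A.convex hp p.2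
    have h6 := h1 0 ⟨by linarith, tauPlus_nonneg _ _⟩
    rw [zero_smul, add_zero] at h6
    have ha0 : ∀ᵐ r : ℝ, 0 ≤ onChord Ω a p r := by
      filter_upwards [h5] with r hr
      by_cases hmem : p.1 + r • (p.2 : Space n) ∈ Ω
      · simp only [onChord, ind_mem hmem, one_mul, ha]
        exact add_nonneg (A.sg_nonneg _) (mul_nonneg (hr hmem) (abs_nonneg _))
      · simp [onChord, ind_notMem hmem]
    have hexp : ∀ s ≤ (0:ℝ), Real.exp (-∫ r in s..0, onChord Ω a p r) ≤ 1 := fun s hs =>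
      Real.exp_le_one_iff.2 (neg_nonpos.2 (intervalIntegral.integral_nonneg_of_ae hs ha0))
    rw [← h2]
    have h7 : ‖U p‖ₑ ≤ ENNReal.ofReal c + ∫⁻ s : ℝ, ‖onChord Ω Q p s‖ₑ := by
      simp only [hU, h6]
      refine (enorm_add_le _ _).trans (add_le_add ?_ ?_)
      · rw [enorm_mul, Real.enorm_of_nonneg (Real.exp_pos _).le, ← ofReal_norm,
          Real.norm_eq_abs]
        calc _ ≤ ENNReal.ofReal c * ENNReal.ofReal 1 := by
              gcongr
              · exact hfc _ _
              · exact hexp _ (by linarith)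
          _ = _ := by simp
      · rw [intervalIntegral.integral_of_le (by linarith)]
        refine (enorm_integral_le_lintegral_enorm _).trans ((setLIntegral_mono' measurableSet_Ioc
          (g := fun s => ‖onChord Ω Q p s‖ₑ) fun s hs => ?_).trans (setLIntegral_le_lintegral _ _))
        rw [enorm_mul, Real.enorm_of_nonneg (Real.exp_pos _).le]
        calc _ ≤ ENNReal.ofReal 1 * ‖onChord Ω Q p s‖ₑ := by
              gcongr
              exact hexp _ hs.2
          _ = _ := by simp
    refine h7.trans ?_
    gcongr
    rw [← lintegral_const_mul' _ _ ENNReal.ofReal_ne_top]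
    refine lintegral_mono_ae ?_
    filter_upwards [h3] with s hs
    rw [onChord, enorm_mul, Real.enorm_of_nonneg (ind_nonneg _), mul_left_comm]
    by_cases hmem : p.1 + s • (p.2 : Space n) ∈ Ω
    · gcongr
      exact hs hmem
    · simp [ind_notMem hmem]
  -- the nonlinear term
  set R : Space n × Dir n → ℝ := fun p => σb p.1 p.2 * |angularAvg u p.1| * u p.1 p.2 with hR
  have hRm : AEStronglyMeasurable R (phaseMeasure Ω) := hbi.1.mul hui.1
  have hRle : ∫⁻ p, ‖R p‖ₑ ∂(phaseMeasure Ω) ≤ ENNReal.ofReal (Cb * C ^ 2 * volume.real Ω) := by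
    have h1 : ∀ᵐ p ∂(phaseMeasure Ω), ‖R p‖ₑ ≤ ENNReal.ofReal (Cb * C) * ‖U' p‖ₑ := by
      have h2 : ∀ᵐ p ∂(phaseMeasure Ω), ‖angularAvg u p.1‖ₑ ≤ ENNReal.ofReal C := by
        have h3 : ∀ᵐ x ∂(volume.restrict Ω), ‖angularAvg u x‖ₑ ≤ ENNReal.ofReal C := by
          filter_upwards [hangle, hUU'x] with x h4 h5
          refine (enorm_integral_le_lintegral_enorm _).trans (le_trans (le_of_eq ?_) h4)
          exact lintegral_congr_ae (h5.mono fun θ h => by simp only [← h, hU])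
        exact Measure.quasiMeasurePreserving_fst.ae h3
      filter_upwards [h2, hσbn, hUU'] with p h3 h4 h5
      rw [hR, ← h5]
      simp only [enorm_mul, Real.enorm_abs, hU]
      rw [ENNReal.ofReal_mul hCb]
      gcongr
      rw [← ofReal_norm]
      exact ENNReal.ofReal_le_ofReal h4
    calc _ ≤ ∫⁻ p, ENNReal.ofReal (Cb * C) * ‖U' p‖ₑ ∂(phaseMeasure Ω) := lintegral_mono_ae h1
      _ = ENNReal.ofReal (Cb * C) * ∫⁻ x in Ω, ∫⁻ θ, ‖U' (x, θ)‖ₑ ∂(sphereMeasure n) := by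
        rw [lintegral_const_mul' _ _ ENNReal.ofReal_ne_top, phaseMeasure,
          lintegral_prod _ hU'm.enorm.aemeasurable]
      _ ≤ ENNReal.ofReal (Cb * C) * ∫⁻ _ in Ω, ENNReal.ofReal C := by
        exact mul_le_mul' le_rfl (lintegral_mono_ae hangle)
      _ = _ := by
        rw [lintegral_const, Measure.restrict_apply_univ, ← ofReal_measureReal
          (A.bounded.measure_lt_top.ne), ← ENNReal.ofReal_mul hC0,
          ← ENNReal.ofReal_mul (mul_nonneg hCb hC0)]
        congr 1
        ring
  have hRi : Integrable R (phaseMeasure Ω) :=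
    ⟨hRm, hRle.trans_lt ENNReal.ofReal_lt_top⟩
  set R' := hRm.mk R with hR'
  have hR'm : Measurable R' := hRm.stronglyMeasurable_mk.measurable
  have hRR' : ∀ᵐ p ∂(phaseMeasure Ω), R p = R' p := hRm.ae_eq_mk
  have hR'i : Integrable R' (phaseMeasure Ω) := hRi.congr hRR'
  have hsi0 : Integrable (fun p => Q p - R p) (phaseMeasure Ω) := hQi.sub hRi
  set s := hsi0.1.mk _ with hs
  have hsm : Measurable s := hsi0.1.stronglyMeasurable_mk.measurable
  have hseq : ∀ᵐ p ∂(phaseMeasure Ω), Q p - R p = s p := hsi0.1.ae_eq_mk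
  have hsi : Integrable s (phaseMeasure Ω) := hsi0.congr hseq
  have hgeq2 : ∀ᵐ p ∂(phaseMeasure Ω), g p.1 p.2 = s p - A.sg p * u p.1 p.2 := by
    filter_upwards [hgeq1, hseq] with p h1 h2
    rw [h1, ← h2]
    simp only [ha, hR]
    ring
  have hduh := A.ae_duhamel hui hgi hw hsol.continuous_chord hsol.boundary hsgi hgeq2
  have hint : ∀ᵐ p ∂(phaseMeasure Ω), U p = A.ball f p + A.backInt s p := by
    filter_upwards [hduh, ae_phase_mem A.isOpen] with p h1 hp
    have hτm := tauMinus_pos A.isOpen A.bounded A.convex hp p.2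
    have h6 := h1 0 ⟨by linarith, tauPlus_nonneg _ _⟩
    rw [zero_smul, add_zero] at h6
    simp only [hU, h6]
    rw [A.backInt_eq hp, ball, A.ent_eq hp, A.bwd_eq hp]
  set q0 := A.scat (A.ball f) with hq0
  have hbm := A.measurable_ball hf
  have hq0m : Measurable q0 := A.measurable_scat hbm
  have hbi' : Integrable (A.ball f) (phaseMeasure Ω) :=
    Integrable.of_bound hbm.aestronglyMeasurable c (ae_of_all _ (A.abs_ball_le hfc))
  have hq0i : Integrable q0 (phaseMeasure Ω) := A.integrable_scat hbi'
  -- Scattering Duhamel's formula closes the equation for the source `s`: one collision of the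
  -- ballistic part, minus the nonlinear term, plus one application of the collision kernel.
  have hfix : ∀ᵐ p ∂(phaseMeasure Ω), s p = (q0 p - R' p) + ∫ z, s z ∂(A.collKernel p) := by
    have hintx : ∀ᵐ p ∂(phaseMeasure Ω), ∀ᵐ θ' ∂(sphereMeasure n),
        U (p.1, θ') = A.ball f (p.1, θ') + A.backInt s (p.1, θ') :=
      Measure.quasiMeasurePreserving_fst.ae (Measure.ae_ae_of_ae_prod hint)
    filter_upwards [hintx, hseq, hRR', A.ae_scat_backInt hsm hsi,
      (A.integrable_kk_mul hbi').prod_right_ae] with p h1 h2 h3 h4 h5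
    have h6 : Q p = q0 p + A.scat (A.backInt s) p := by
      rw [hQ, hq0, scat, scat, scat, ← integral_add h5 h4.2.1]
      refine integral_congr_ae ?_
      filter_upwards [h1] with θ' hθ'
      rw [hθ', mul_add]
    rw [← h2, h6, h4.2.2, h3]
    ring
  have hres := A.ae_exit_resum hsm (hq0m.sub hR'm) hsi (hq0i.sub hR'i) hfix
  -- Resummation sends both inhomogeneities through the total kernel. The ballistic one reproduces
  -- `linExit`, so the difference of the outgoing values is exactly the contribution of `R'`.
  have hexit : ∀ᵐ p ∂(phaseMeasure Ω),
      u (p.1 + tauPlus Ω p.1 p.2 • (p.2 : Space n)) p.2 - A.linExit f p =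
        -∫ z, R' z ∂(A.totalKernel p) := by
    filter_upwards [hduh, ae_phase_mem A.isOpen, hres, A.integrable_totalKernel hq0m hq0i,
      A.integrable_totalKernel hR'm hR'i] with p h1 hp h2 h3 h4
    have hτm := tauMinus_pos A.isOpen A.bounded A.convex hp p.2
    have h6 := h1 (tauPlus Ω p.1 p.2) ⟨by linarith [tauPlus_nonneg (Ω := Ω) p.1 p.2], le_rfl⟩
    rw [← A.integral_exitKernel_eq hp hsm, h2, ← A.fwd_mul_bwd hp] at h6
    have h7 : ∫ z, (q0 - R') z ∂(A.totalKernel p) =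
        ∫ z, q0 z ∂(A.totalKernel p) - ∫ z, R' z ∂(A.totalKernel p) := integral_sub h3 h4
    rw [h6, h7, linExit, ball, A.ent_eq hp]
    ring
  calc _ = ∫⁻ p, ‖∫ z, R' z ∂(A.totalKernel p)‖ₑ ∂(phaseMeasure Ω) := by
        refine lintegral_congr_ae ?_
        filter_upwards [hexit] with p hp
        rw [hp, enorm_neg]
    _ ≤ ∫⁻ p, (∫⁻ z, ‖R' z‖ₑ ∂(A.totalKernel p)) ∂(phaseMeasure Ω) :=
        lintegral_mono fun p => enorm_integral_le_lintegral_enorm _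
    _ ≤ A.bound * ∫⁻ p, ‖R' p‖ₑ ∂(phaseMeasure Ω) := A.lintegral_totalKernel_le hR'm.enorm
    _ ≤ _ := by
        gcongr
        refine le_trans (le_of_eq (lintegral_congr_ae ?_)) hRle
        filter_upwards [hRR'] with p hp
        rw [hp]

end Medium
end RTE

namespace RTE
variable {n : ℕ} {Ω : Set (Space n)}

/-! ### Surface measure of the boundary -/

lemma exists_frontier_point (ho : IsOpen Ω) (p v : Space n) {a b : ℝ} (hab : a ≤ b)
    (ha : p + a • v ∈ Ω) (hb : p + b • v ∉ Ω) :
    ∃ s ∈ Icc a b, p + s • v ∈ frontier Ω := by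
  by_contra! hcon
  have hc : Continuous fun s : ℝ => p + s • v := by fun_prop
  have hfr : ∀ s ∈ Icc a b, p + s • v ∉ Ω → p + s • v ∉ closure Ω := fun s hs h1 h2 =>
    hcon s hs (by rw [ho.frontier_eq]; exact ⟨h2, h1⟩)
  obtain ⟨s, hs, h1, h2⟩ := isPreconnected_Icc (a := a) (b := b)
    ((fun s : ℝ => p + s • v) ⁻¹' Ω) ((fun s : ℝ => p + s • v) ⁻¹' (closure Ω)ᶜ)
    (ho.preimage hc) (isClosed_closure.isOpen_compl.preimage hc)
    (fun s hs => (em (p + s • v ∈ Ω)).imp id (hfr s hs))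
    ⟨a, left_mem_Icc.2 hab, ha⟩ ⟨b, right_mem_Icc.2 hab, hfr b (right_mem_Icc.2 hab) hb⟩
  exact h2 (subset_closure h1)

/-- Near a boundary point, a `C¹` boundary is a graph over its tangent plane whose slope is as small
as we please. -/
lemma HasC1Boundary.exists_flat (ho : IsOpen Ω) (h : HasC1Boundary Ω) {p : Space n}
    (hp : p ∈ frontier Ω) :
    ∃ ν : Space n, ‖ν‖ = 1 ∧ ∀ η > 0, η < 1 / 2 → ∃ ρ > 0,
      (∀ a ∈ frontier Ω ∩ Metric.ball p ρ, ∀ b ∈ frontier Ω ∩ Metric.ball p ρ,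
        |⟪ν, a - b⟫| ≤ η * ‖a - b‖) ∧
      ∀ w : Space n, ⟪ν, w⟫ = 0 → ‖w‖ < ρ / 2 →
        ∃ s : ℝ, p + w + s • ν ∈ frontier Ω ∩ Metric.ball p ρ := by
  obtain ⟨U, hU, hpU, g, hg, hgp, hΩU⟩ := h p hp
  have hmemU : ∀ x ∈ U, (x ∈ Ω ↔ g x < 0) := fun x hx =>
    ⟨fun hxΩ => (hΩU ▸ (⟨hxΩ, hx⟩ : x ∈ Ω ∩ U) : x ∈ {x ∈ U | g x < 0}).2,
      fun hgx => (hΩU.symm ▸ (⟨hx, hgx⟩ : x ∈ {x ∈ U | g x < 0}) : x ∈ Ω ∩ U).1⟩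
  have hzero : ∀ x ∈ frontier Ω ∩ U, g x = 0 := by
    rintro x ⟨hx, hxU⟩
    rw [ho.frontier_eq] at hx
    refine le_antisymm ?_ (not_lt.1 fun h => hx.2 ((hmemU x hxU).2 h))
    have hc : ContinuousAt g x := (hg.continuousOn.continuousAt (hU.mem_nhds hxU))
    by_contra! hpos
    have h1 : ∀ᶠ y in 𝓝 x, 0 < g y ∧ y ∈ U :=
      (hc.eventually (lt_mem_nhds hpos)).and (hU.mem_nhds hxU)
    obtain ⟨y, hy, hyΩ⟩ := mem_closure_iff_nhds.1 hx.1 _ h1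
    exact absurd ((hmemU y hy.2).1 hyΩ) (not_lt.2 hy.1.le)
  have hst : HasStrictFDerivAt g (fderiv ℝ g p) p :=
    ((hg.contDiffAt (hU.mem_nhds hpU)).hasStrictFDerivAt (by norm_num))
  set d := (InnerProductSpace.toDual ℝ (Space n)).symm (fderiv ℝ g p) with hd
  have hdd : ∀ v, fderiv ℝ g p v = ⟪d, v⟫ := fun v => by
    rw [hd, InnerProductSpace.toDual_symm_apply]
  have hd0 : d ≠ 0 := by
    intro h0
    exact hgp (ContinuousLinearMap.ext fun v => by rw [hdd, h0]; simp)
  have hc : 0 < ‖d‖ := norm_pos_iff.2 hd0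
  have hdν : ∀ v, fderiv ℝ g p v = ‖d‖ * ⟪‖d‖⁻¹ • d, v⟫ := fun v => by
    rw [hdd, real_inner_smul_left, ← mul_assoc, mul_inv_cancel₀ hc.ne', one_mul]
  refine ⟨‖d‖⁻¹ • d, by rw [norm_smul, norm_inv, norm_norm, inv_mul_cancel₀ hc.ne'], ?_⟩
  set ν := ‖d‖⁻¹ • d with hν
  have hν1 : ‖ν‖ = 1 := by rw [hν, norm_smul, norm_inv, norm_norm, inv_mul_cancel₀ hc.ne']
  intro η hη hη2
  -- Strict differentiability compares any two points near `p`, not only `p` with its neighbours. On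
  -- the zero set of `g` this bounds the normal component of every difference of two nearby boundary
  -- points.
  have hlo := (hasStrictFDerivAt_iff_isLittleO.1 hst).def (mul_pos hc hη)
  rw [nhds_prod_eq] at hlo
  obtain ⟨V, hV, hVlo⟩ := eventually_prod_self_iff'.1 hlo
  obtain ⟨ρ, hρ, hρV⟩ := Metric.mem_nhds_iff.1 (inter_mem hV (hU.mem_nhds hpU))
  have key : ∀ a ∈ Metric.ball p ρ, ∀ b ∈ Metric.ball p ρ,
      |g a - g b - ‖d‖ * ⟪ν, a - b⟫| ≤ ‖d‖ * η * ‖a - b‖ := fun a ha b hb => by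
    rw [← hdν]
    exact hVlo a (hρV ha).1 b (hρV hb).1
  refine ⟨ρ, hρ, ?_, ?_⟩
  · rintro a ⟨ha, haρ⟩ b ⟨hb, hbρ⟩
    have h1 := key a haρ b hbρ
    rw [hzero a ⟨ha, (hρV haρ).2⟩, hzero b ⟨hb, (hρV hbρ).2⟩, sub_zero, zero_sub, abs_neg, abs_mul,
      abs_of_pos hc, mul_assoc] at h1
    exact le_of_mul_le_mul_left h1 hc
  · intro w hw hwρ
    rcases eq_or_ne w 0 with rfl | hw0
    · exact ⟨0, by simpa using hp, by simpa using hρ⟩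
    have hwpos : 0 < ‖w‖ := norm_pos_iff.2 hw0
    have hball : ∀ s : ℝ, |s| ≤ ‖w‖ → p + w + s • ν ∈ Metric.ball p ρ := fun s hs => by
      rw [Metric.mem_ball, dist_eq_norm, show p + w + s • ν - p = w + s • ν by abel]
      calc _ ≤ ‖w‖ + ‖s • ν‖ := norm_add_le _ _
        _ ≤ ‖w‖ + ‖w‖ := by rw [norm_smul, hν1, mul_one, Real.norm_eq_abs]; gcongr
        _ < ρ := by linarith
    have hest : ∀ s : ℝ, |s| ≤ ‖w‖ → |g (p + w + s • ν) - ‖d‖ * s| ≤ ‖d‖ * η * (2 * ‖w‖) := by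
      intro s hs
      have h1 := key _ (hball s hs) p (Metric.mem_ball_self hρ)
      rw [hzero p ⟨hp, hpU⟩, sub_zero, show p + w + s • ν - p = w + s • ν by abel, inner_add_right,
        hw, zero_add, real_inner_smul_right, real_inner_self_eq_norm_sq, hν1, one_pow,
        mul_one] at h1
      refine h1.trans ?_
      gcongr
      calc _ ≤ ‖w‖ + ‖s • ν‖ := norm_add_le _ _
        _ ≤ ‖w‖ + ‖w‖ := by rw [norm_smul, hν1, mul_one, Real.norm_eq_abs]; gcongr
        _ = _ := by ring
    -- For `|s| ≤ ‖w‖` the displacement `w + sν` has norm at most `2‖w‖`, so `η < 1/2` lets the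
    -- linear term determine the sign of `g` at `s = ±‖w‖`. Between these two values the boundary is
    -- crossed.
    have hlt : ‖d‖ * η * (2 * ‖w‖) < ‖d‖ * ‖w‖ := by
      have : 0 < ‖d‖ * ‖w‖ := mul_pos hc hwpos
      nlinarith
    have hneg : p + w + (-‖w‖) • ν ∈ Ω := by
      have h1 : |(-‖w‖)| ≤ ‖w‖ := by rw [abs_neg, abs_norm]
      refine (hmemU _ (hρV (hball _ h1)).2).2 ?_
      have := (abs_le.1 (hest _ h1)).2
      nlinarith
    have hposi : p + w + ‖w‖ • ν ∉ Ω := by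
      have h1 : |‖w‖| ≤ ‖w‖ := by rw [abs_norm]
      rw [hmemU _ (hρV (hball _ h1)).2]
      have := (abs_le.1 (hest _ h1)).1
      nlinarith
    obtain ⟨s, hs, hfr⟩ := exists_frontier_point ho (p + w) ν (by linarith) hneg hposi
    exact ⟨s, hfr, hball s (abs_le.2 hs)⟩

lemma LipschitzOnWith.euclideanHausdorffMeasure_image_le {X Y : Type*} [EMetricSpace X]
    [MeasurableSpace X] [BorelSpace X] [EMetricSpace Y] [MeasurableSpace Y] [BorelSpace Y]
    {K : NNReal} {f : X → Y} {s : Set X} (h : LipschitzOnWith K f s) (d : ℕ) :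
    μHE[d] (f '' s) ≤ (K : ℝ≥0∞) ^ d * μHE[d] s := by
  simp only [Measure.euclideanHausdorffMeasure_def, Measure.smul_apply, ENNReal.smul_def,
    smul_eq_mul]
  have h1 := h.hausdorffMeasure_image_le (d := d) (by positivity)
  rw [ENNReal.rpow_natCast] at h1
  calc _ ≤ _ * ((K : ℝ≥0∞) ^ d * μH[d] s) := mul_le_mul' le_rfl h1
    _ = _ := by ring

/-- The tangent plane `ν^⊥`. -/
noncomputable abbrev tangent (ν : Space n) : Submodule ℝ (Space n) := (ℝ ∙ ν)ᗮ

lemma finrank_tangent {ν : Space n} (hν : ‖ν‖ = 1) : Module.finrank ℝ (tangent ν) = n - 1 := by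
  have h1 := (ℝ ∙ ν).finrank_add_finrank_orthogonal
  rw [finrank_span_singleton (by rintro rfl; simp at hν), finrank_euclideanSpace_fin] at h1
  have : Module.finrank ℝ (tangent ν) = Module.finrank ℝ (ℝ ∙ ν)ᗮ := rfl
  omega

/-- This normalization of Hausdorff measure is the reason why the constant in the boundary limit is
exactly the Lebesgue integral of the bump over the tangent plane. -/
lemma hausdorff_tangent {ν : Space n} (hν : ‖ν‖ = 1) :
    (μHE[n - 1] : Measure (tangent ν)) = volume := by
  rw [← finrank_tangent hν]
  exact InnerProductSpace.euclideanHausdorffMeasure_eq_volume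

/-- Orthogonal projection onto the tangent plane. -/
noncomputable abbrev toTangent (ν : Space n) : Space n →L[ℝ] tangent ν :=
  (tangent ν).orthogonalProjectionOnto

lemma mem_tangent {ν w : Space n} : w ∈ tangent ν ↔ ⟪ν, w⟫ = 0 :=
  Submodule.mem_orthogonal_singleton_iff_inner_right

lemma coe_toTangent {ν : Space n} (hν : ‖ν‖ = 1) (v : Space n) :
    (toTangent ν v : Space n) = v - ⟪ν, v⟫ • ν := by
  have h := (ℝ ∙ ν).starProjection_add_starProjection_orthogonal v
  rw [Submodule.starProjection_unit_singleton ℝ hν] at h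
  exact eq_sub_iff_add_eq'.2 h

lemma norm_toTangent_le (ν v : Space n) : ‖toTangent ν v‖ ≤ ‖v‖ :=
  Submodule.norm_orthogonalProjectionOnto_apply_le _ v

lemma norm_le_of_flat {ν v : Space n} (hν : ‖ν‖ = 1) {η : ℝ} (hη : η < 1 / 2)
    (h : |⟪ν, v⟫| ≤ η * ‖v‖) : ‖v‖ ≤ (1 - η)⁻¹ * ‖toTangent ν v‖ := by
  have h1 : ‖v‖ ≤ ‖toTangent ν v‖ + |⟪ν, v⟫| := by
    calc ‖v‖ = ‖(toTangent ν v : Space n) + ⟪ν, v⟫ • ν‖ := by rw [coe_toTangent hν]; simp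
      _ ≤ _ := (norm_add_le _ _).trans (by rw [norm_smul, hν, mul_one]; rfl)
  rw [le_inv_mul_iff₀ (by linarith)]
  linarith

section Flat
variable {ν p : Space n} {η ρ : ℝ}

/-- On a piece of small slope the projection to the tangent plane is injective, and its inverse is
Lipschitz with constant `(1 - η)⁻¹`. -/
lemma hausdorff_flat_le (hν : ‖ν‖ = 1) (hη : η < 1 / 2) {A : Set (Space n)}
    (hA : ∀ a ∈ A, ∀ b ∈ A, |⟪ν, a - b⟫| ≤ η * ‖a - b‖) (S : Set (tangent ν)) :
    μHE[n - 1] (A ∩ toTangent ν ⁻¹' S) ≤ ENNReal.ofReal ((1 - η)⁻¹ ^ (n - 1)) * volume S := by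
  have hη' : 0 < 1 - η := by linarith
  have hanti : ∀ a ∈ A, ∀ b ∈ A, dist a b ≤ (1 - η)⁻¹ * dist (toTangent ν a) (toTangent ν b) := by
    intro a ha b hb
    rw [dist_eq_norm, dist_eq_norm, ← map_sub]
    exact norm_le_of_flat hν hη (hA a ha b hb)
  have hinj : InjOn (toTangent ν) A := fun a ha b hb hab => by
    have := hanti a ha b hb
    rw [hab, dist_self, mul_zero] at this
    exact dist_le_zero.1 this
  have hl := hinj.leftInvOn_invFunOn
  have hlip : LipschitzOnWith (Real.toNNReal (1 - η)⁻¹) (Function.invFunOn (toTangent ν) A)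
      (toTangent ν '' A ∩ S) := by
    refine LipschitzOnWith.of_dist_le_mul ?_
    rintro _ ⟨⟨a, ha, rfl⟩, -⟩ _ ⟨⟨b, hb, rfl⟩, -⟩
    rw [hl ha, hl hb, Real.coe_toNNReal _ (inv_nonneg.2 hη'.le)]
    exact hanti a ha b hb
  have h1 := hlip.euclideanHausdorffMeasure_image_le (n - 1)
  rw [hausdorff_tangent hν] at h1
  refine (measure_mono ?_).trans (h1.trans ?_)
  · rintro a ⟨ha, haS⟩
    exact ⟨toTangent ν a, ⟨⟨a, ha, rfl⟩, haS⟩, hl ha⟩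
  · rw [ENNReal.ofReal_pow (inv_nonneg.2 hη'.le)]
    exact mul_le_mul' le_rfl (measure_mono inter_subset_right)

/-- An orthogonal projection is 1-Lipschitz and so does not increase Hausdorff measure. -/
lemma le_hausdorff_flat (hν : ‖ν‖ = 1) {A : Set (Space n)} {S : Set (tangent ν)}
    (hS : S ⊆ toTangent ν '' A) : volume S ≤ μHE[n - 1] (A ∩ toTangent ν ⁻¹' S) := by
  have hlip : LipschitzWith 1 (toTangent ν) :=
    LipschitzWith.of_dist_le_mul fun a b => by
      rw [dist_eq_norm, dist_eq_norm, ← map_sub, NNReal.coe_one, one_mul]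
      exact norm_toTangent_le _ _
  have h1 := (hlip.lipschitzOnWith (s := A ∩ toTangent ν ⁻¹' S)).euclideanHausdorffMeasure_image_le
    (n - 1)
  rw [hausdorff_tangent hν, ENNReal.coe_one, one_pow, one_mul] at h1
  refine (measure_mono ?_).trans h1
  intro t ht
  obtain ⟨a, ha, rfl⟩ := hS ht
  exact ⟨a, ⟨ha, ht⟩, rfl⟩

end Flat

lemma volume_tangent_ball {ν : Space n} (hν : ‖ν‖ = 1) (x : tangent ν) {r : ℝ} (hr : 0 < r) :
    volume (Metric.ball x r) =
      ENNReal.ofReal (r ^ (n - 1)) * volume (Metric.ball (0 : tangent ν) 1) := by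
  rw [Measure.addHaar_ball_of_pos _ _ hr, finrank_tangent hν]

/-- A bounded `C¹` boundary is upper Ahlfors regular. -/
lemma HasC1Boundary.exists_ahlfors (ho : IsOpen Ω) (hb : Bornology.IsBounded Ω)
    (h : HasC1Boundary Ω) :
    ∃ C : ℝ, 0 ≤ C ∧ ∃ r₀ > 0, ∀ x ∈ frontier Ω, ∀ r > 0, r < r₀ →
      boundaryMeasure Ω (Metric.ball x r) ≤ ENNReal.ofReal (C * r ^ (n - 1)) := by
  have hcomp : IsCompact (frontier Ω) :=
    Metric.isCompact_of_isClosed_isBounded isClosed_frontier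
      (hb.closure.subset frontier_subset_closure)
  suffices H : ∃ C : ℝ, 0 ≤ C ∧ ∃ r₀ > 0, ∀ x ∈ frontier Ω ∩ frontier Ω, ∀ r > 0, r < r₀ →
      boundaryMeasure Ω (Metric.ball x r) ≤ ENNReal.ofReal (C * r ^ (n - 1)) by
    rwa [inter_self] at H
  refine hcomp.induction_on (p := fun s => ∃ C : ℝ, 0 ≤ C ∧ ∃ r₀ > 0, ∀ x ∈ frontier Ω ∩ s,
    ∀ r > 0, r < r₀ → boundaryMeasure Ω (Metric.ball x r) ≤ ENNReal.ofReal (C * r ^ (n - 1)))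
    ?_ ?_ ?_ ?_
  · exact ⟨0, le_rfl, 1, one_pos, fun x hx => absurd hx.2 (notMem_empty x)⟩
  · rintro s t hst ⟨C, hC, r₀, hr₀, H⟩
    exact ⟨C, hC, r₀, hr₀, fun x hx => H x ⟨hx.1, hst hx.2⟩⟩
  · rintro s t ⟨C, hC, r₀, hr₀, H⟩ ⟨C', hC', r₀', hr₀', H'⟩
    refine ⟨max C C', hC.trans (le_max_left _ _), min r₀ r₀', lt_min hr₀ hr₀', ?_⟩
    rintro x ⟨hx, hxs | hxt⟩ r hr hrr
    · refine (H x ⟨hx, hxs⟩ r hr (hrr.trans_le (min_le_left _ _))).trans ?_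
      gcongr
      exact le_max_left _ _
    · refine (H' x ⟨hx, hxt⟩ r hr (hrr.trans_le (min_le_right _ _))).trans ?_
      gcongr
      exact le_max_right _ _
  · intro p hp
    obtain ⟨ν, hν, H⟩ := h.exists_flat ho hp
    obtain ⟨ρ, hρ, hflat, -⟩ := H (1 / 4) (by norm_num) (by norm_num)
    set c := volume (Metric.ball (0 : tangent ν) 1) with hc
    have hctop : c ≠ ∞ := measure_ball_lt_top.ne
    refine ⟨Metric.ball p (ρ / 2), mem_nhdsWithin_of_mem_nhds
      (Metric.ball_mem_nhds _ (by linarith)),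
      (1 - 1 / 4)⁻¹ ^ (n - 1) * c.toReal, by positivity, ρ / 2, by linarith, ?_⟩
    rintro x ⟨hx, hxp⟩ r hr hrρ
    rw [boundaryMeasure, Measure.restrict_apply measurableSet_ball]
    refine (measure_mono ?_).trans
      ((hausdorff_flat_le hν (by norm_num) hflat (Metric.ball (toTangent ν x) r)).trans ?_)
    · rintro y ⟨hy, hyf⟩
      refine ⟨⟨hyf, ?_⟩, ?_⟩
      · rw [Metric.mem_ball] at hy hxp ⊢
        linarith [dist_triangle y x p]
      · change dist (toTangent ν y) (toTangent ν x) < r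
        rw [dist_eq_norm, ← map_sub]
        exact (norm_toTangent_le _ _).trans_lt (by rwa [← dist_eq_norm])
    · rw [volume_tangent_ball hν _ hr, ← hc, ← ENNReal.ofReal_toReal hctop,
        ← ENNReal.ofReal_mul (by positivity), ← ENNReal.ofReal_mul (by positivity)]
      refine ENNReal.ofReal_le_ofReal (le_of_eq ?_)
      rw [ENNReal.toReal_ofReal ENNReal.toReal_nonneg]
      ring

lemma HasC1Boundary.isFiniteMeasure (ho : IsOpen Ω) (hb : Bornology.IsBounded Ω)
    (h : HasC1Boundary Ω) : IsFiniteMeasure (boundaryMeasure Ω) := by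
  have hcomp : IsCompact (frontier Ω) :=
    Metric.isCompact_of_isClosed_isBounded isClosed_frontier
      (hb.closure.subset frontier_subset_closure)
  obtain ⟨C, -, r₀, hr₀, H⟩ := h.exists_ahlfors ho hb
  have h1 := hcomp.measure_lt_top_of_nhdsWithin (μ := boundaryMeasure Ω) fun x hx =>
    ⟨Metric.ball x (r₀ / 2), mem_nhdsWithin_of_mem_nhds (Metric.ball_mem_nhds _ (by linarith)),
      (H x hx (r₀ / 2) (by linarith) (by linarith)).trans_lt ENNReal.ofReal_lt_top⟩
  refine ⟨?_⟩
  rw [boundaryMeasure, Measure.restrict_apply_self] at h1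
  rwa [boundaryMeasure, Measure.restrict_apply_univ]

end RTE

namespace RTE
variable {n : ℕ} {Ω : Set (Space n)}

/-! ### Concentration at a boundary point -/

/-- Nonnegative Lipschitz bumps with support in the unit ball. -/
structure IsBump (g : Space n → ℝ) (L : NNReal) : Prop where
  lip : LipschitzWith L g
  nonneg : ∀ x, 0 ≤ g x
  le_one : ∀ x, g x ≤ 1
  zero : ∀ x, 1 ≤ ‖x‖ → g x = 0

lemma IsCutoff.exists_isBump {h : Space n → ℝ} (hh : IsCutoff h) : ∃ L, IsBump h L := by
  obtain ⟨L, hL⟩ := hh.smooth.lipschitzWith_of_hasCompactSupport hh.compact (by simp)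
  refine ⟨L, hL, hh.nonneg, hh.le_one, fun x hx => ?_⟩
  by_contra hne
  have := hh.support (subset_tsupport _ hne)
  rw [mem_ball_zero_iff] at this
  linarith

namespace IsBump
variable {g : Space n → ℝ} {L : NNReal}

lemma norm_lt (hg : IsBump g L) {x : Space n} (hx : g x ≠ 0) : ‖x‖ < 1 := by
  by_contra! h
  exact hx (hg.zero x h)

end IsBump

section Blowup
variable {g : Space n → ℝ} {L : NNReal} {ν p : Space n} {η ρ : ℝ}

lemma integral_tangent_scale (hν : ‖ν‖ = 1) (f : tangent ν → ℝ) (t₀ : tangent ν) {ε : ℝ}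
    (hε : 0 < ε) :
    ∫ t, 1 / ε ^ (n - 1) * f (ε⁻¹ • (t₀ - t)) = ∫ t, f t := by
  rw [integral_const_mul, integral_sub_left_eq_self (fun t => f (ε⁻¹ • t)) volume t₀,
    Measure.integral_comp_inv_smul, finrank_tangent hν, smul_eq_mul, abs_of_pos (pow_pos hε _),
    ← mul_assoc, one_div, inv_mul_cancel₀ (pow_pos hε _).ne', one_mul]

/-- The pushforward of the surface measure to the tangent plane is close to Lebesgue measure. -/
lemma integral_flat_bounds (hg : IsBump g L) (hν : ‖ν‖ = 1) (hη0 : 0 < η) (hη : η < 1 / 2)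
    {A : Set (Space n)}
    (hA : ∀ a ∈ A, ∀ b ∈ A, |⟪ν, a - b⟫| ≤ η * ‖a - b‖)
    (hsurj : ∀ w : Space n, ⟪ν, w⟫ = 0 → ‖w‖ < ρ / 2 → ∃ s : ℝ, p + w + s • ν ∈ A)
    {ε : ℝ} (hε : 0 < ε) (hερ : ε < ρ / 2) :
    ∫ t : tangent ν, g t ≤
        ∫ x in A, 1 / ε ^ (n - 1) * g (ε⁻¹ • (toTangent ν (p - x) : Space n)) ∂μHE[n - 1] ∧
    ∫ x in A, 1 / ε ^ (n - 1) * g (ε⁻¹ • (toTangent ν (p - x) : Space n)) ∂μHE[n - 1] ≤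
      (1 - η)⁻¹ ^ (n - 1) * ∫ t : tangent ν, g t := by
  have hη' : 0 < 1 - η := by linarith
  set P := toTangent ν with hP
  have hPm : Measurable P := P.continuous.measurable
  set m := (μHE[n - 1].restrict A).map P with hm
  have hmS : ∀ S, MeasurableSet S → m S = μHE[n - 1] (A ∩ P ⁻¹' S) := fun S hS => by
    rw [hm, Measure.map_apply hPm hS, Measure.restrict_apply (hPm hS), inter_comm]
  have h1 : m ≤ ENNReal.ofReal ((1 - η)⁻¹ ^ (n - 1)) • volume := by
    refine Measure.le_iff.2 fun S hS => ?_
    rw [hmS S hS]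
    exact hausdorff_flat_le hν hη hA S
  -- The lower bound is available only over the ball where the piece is known to cover the tangent
  -- plane; `ε < ρ / 2` keeps the support of the bump inside it.
  have h2 : volume.restrict (Metric.ball (P p) (ρ / 2)) ≤ m := by
    refine Measure.le_iff.2 fun S hS => ?_
    rw [Measure.restrict_apply hS, hmS S hS]
    refine (le_hausdorff_flat hν (A := A) ?_).trans
      (measure_mono (inter_subset_inter_right _ (preimage_mono inter_subset_left)))
    rintro t ⟨-, ht⟩
    rw [Metric.mem_ball, dist_eq_norm] at ht
    obtain ⟨s, hs⟩ := hsurj (t - P p : tangent ν) (mem_tangent.1 (t - P p).2) ht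
    refine ⟨_, hs, ?_⟩
    have h3 : P ν = 0 := by
      refine Subtype.ext ?_
      rw [hP, coe_toTangent hν, real_inner_self_eq_norm_sq, hν]
      simp
    rw [map_add, map_add, map_smul, h3, smul_zero, add_zero, hP, toTangent,
      Submodule.orthogonalProjectionOnto_mem_subspace_eq_self]
    abel
  set F : tangent ν → ℝ := fun t => 1 / ε ^ (n - 1) * g (ε⁻¹ • (P p - t : tangent ν) : tangent ν)
    with hF
  have hFc : Continuous F := by
    have := hg.lip.continuous
    fun_prop
  have hF0 : ∀ t, 0 ≤ F t := fun t => mul_nonneg (by positivity) (hg.nonneg _)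
  have hFint : ∫ t, F t = ∫ t : tangent ν, g t :=
    integral_tangent_scale hν (fun t => g t) (P p) hε
  have hFzero : ∀ t, t ∉ Metric.ball (P p) (ρ / 2) → F t = 0 := fun t ht => by
    rw [hF]
    simp only
    rw [hg.zero, mul_zero]
    change 1 ≤ ‖ε⁻¹ • (P p - t)‖
    rw [norm_smul, norm_inv, Real.norm_of_nonneg hε.le]
    rw [Metric.mem_ball, dist_eq_norm, norm_sub_rev, not_lt] at ht
    rw [le_inv_mul_iff₀ hε, mul_one]
    linarith
  have hFi : Integrable F volume := by
    refine hFc.integrable_of_hasCompactSupport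
      (HasCompactSupport.intro (isCompact_closedBall (P p) (ρ / 2)) fun t ht => hFzero t fun h =>
        ht (Metric.ball_subset_closedBall h))
  have hFi2 : Integrable F (ENNReal.ofReal ((1 - η)⁻¹ ^ (n - 1)) • volume) :=
    hFi.smul_measure ENNReal.ofReal_ne_top
  have hJ : ∫ x in A, 1 / ε ^ (n - 1) * g (ε⁻¹ • (P (p - x) : Space n)) ∂μHE[n - 1] =
      ∫ t, F t ∂m := by
    rw [hm, integral_map hPm.aemeasurable hFc.aestronglyMeasurable]
    simp [hF, map_sub]
  rw [hJ, ← hFint]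
  constructor
  · rw [← setIntegral_eq_integral_of_forall_compl_eq_zero hFzero]
    exact integral_mono_measure h2 (ae_of_all _ hF0) (hFi2.mono_measure h1)
  · refine (integral_mono_measure h1 (ae_of_all _ hF0) hFi2).trans ?_
    rw [integral_smul_measure, ENNReal.toReal_ofReal (by positivity), smul_eq_mul]

/-- The vector and its tangential part differ by the normal component, of size at most `η ‖v‖`, and
the bump is Lipschitz. Since `‖v‖ ≤ 2 ‖toTangent ν v‖`, both values are zero once `‖v‖ ≥ 2ε`. -/
lemma abs_bump_flat_sub_le (hg : IsBump g L) (hν : ‖ν‖ = 1) (hη0 : 0 < η) (hη : η < 1 / 2)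
    {v : Space n} (hv : |⟪ν, v⟫| ≤ η * ‖v‖) {ε : ℝ} (hε : 0 < ε) :
    |g (ε⁻¹ • v) - g (ε⁻¹ • (toTangent ν v : Space n))| ≤
      (Metric.ball (0 : Space n) (2 * ε)).indicator (fun _ => 2 * L * η) v := by
  have h1 : (1 - η)⁻¹ ≤ 2 := by
    rw [inv_le_comm₀ (by linarith) (by norm_num)]; linarith
  have h2 : ‖v‖ ≤ 2 * ‖toTangent ν v‖ :=
    (norm_le_of_flat hν hη hv).trans (by gcongr)
  by_cases hmem : v ∈ Metric.ball (0 : Space n) (2 * ε)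
  · rw [indicator_of_mem hmem]
    rw [mem_ball_zero_iff] at hmem
    have h3 := hg.lip.dist_le_mul (ε⁻¹ • v) (ε⁻¹ • (toTangent ν v : Space n))
    rw [Real.dist_eq, dist_eq_norm, ← smul_sub, coe_toTangent hν, sub_sub_cancel, norm_smul,
      norm_smul, hν, mul_one, norm_inv, Real.norm_of_nonneg hε.le, Real.norm_eq_abs] at h3
    rw [coe_toTangent hν]
    refine h3.trans ?_
    have : ε⁻¹ * |⟪ν, v⟫| ≤ 2 * η := by
      rw [inv_mul_le_iff₀ hε]
      nlinarith
    calc _ ≤ (L : ℝ) * (2 * η) := by gcongr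
      _ = _ := by ring
  · rw [indicator_of_notMem hmem]
    rw [mem_ball_zero_iff, not_lt] at hmem
    rw [hg.zero, hg.zero, sub_zero, abs_zero]
    · rw [norm_smul, norm_inv, Real.norm_of_nonneg hε.le, le_inv_mul_iff₀ hε]
      change ε * 1 ≤ ‖toTangent ν v‖
      linarith
    · rw [norm_smul, norm_inv, Real.norm_of_nonneg hε.le, le_inv_mul_iff₀ hε]
      linarith

end Blowup

/-- At scale `ε` the boundary is a graph of slope `η` over the tangent plane. Replacing `p - x` by
its projection costs `O(η)`, after which the integral is sandwiched between multiples of the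
tangential integral. First `ε` tends to zero for fixed `η`, then `η` does. -/
lemma HasC1Boundary.tendsto_bump (ho : IsOpen Ω) (hb : Bornology.IsBounded Ω)
    (h : HasC1Boundary Ω) {p : Space n} (hp : p ∈ frontier Ω) {g : Space n → ℝ} {L : NNReal}
    (hg : IsBump g L) {c : ℝ} (hc : ∀ ν : Space n, ‖ν‖ = 1 → ∫ t : tangent ν, g t = c) :
    Tendsto (fun ε : ℝ => ∫ x, 1 / ε ^ (n - 1) * g (ε⁻¹ • (p - x)) ∂(boundaryMeasure Ω))
      (𝓝[>] 0) (𝓝 c) := by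
  have hfin := h.isFiniteMeasure ho hb
  obtain ⟨C, hC, r₀, hr₀, hAhl⟩ := h.exists_ahlfors ho hb
  obtain ⟨ν, hν, H⟩ := h.exists_flat ho hp
  have hc0 : 0 ≤ c := (hc ν hν) ▸ integral_nonneg fun t => hg.nonneg _
  -- The first error term comes from flattening the argument on a ball of radius `2ε`, whose measure
  -- is controlled by Ahlfors regularity; the second comes from the distortion of surface measure
  -- under projection. Neither depends on `ε`.
  have key : ∀ η > 0, η < 1 / 2 → ∀ᶠ ε in 𝓝[>] (0 : ℝ),
      |∫ x, 1 / ε ^ (n - 1) * g (ε⁻¹ • (p - x)) ∂(boundaryMeasure Ω) - c| ≤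
        2 * L * η * (C * 2 ^ (n - 1)) + ((1 - η)⁻¹ ^ (n - 1) - 1) * c := by
    intro η hη0 hη
    obtain ⟨ρ, hρ, hflat, hsurj⟩ := H η hη0 hη
    have hsmall : Ioo (0 : ℝ) (min (ρ / 2) (r₀ / 2)) ∈ 𝓝[>] (0 : ℝ) :=
      Ioo_mem_nhdsGT (lt_min (by linarith) (by linarith))
    filter_upwards [hsmall] with ε hε
    obtain ⟨hε0, hε1⟩ := hε
    obtain ⟨hερ, hεr⟩ := lt_min_iff.1 hε1
    set A := frontier Ω ∩ Metric.ball p ρ with hA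
    have hpA : p ∈ A := ⟨hp, Metric.mem_ball_self hρ⟩
    have hAm : MeasurableSet A := isClosed_frontier.measurableSet.inter measurableSet_ball
    obtain ⟨hJ1, hJ2⟩ := integral_flat_bounds hg hν hη0 hη hflat hsurj hε0 hερ
    rw [hc ν hν] at hJ1 hJ2
    have hAeq : μHE[n - 1].restrict A = (boundaryMeasure Ω).restrict (Metric.ball p ρ) := by
      rw [boundaryMeasure, Measure.restrict_restrict measurableSet_ball, inter_comm]
    have hεp : 0 < ε ^ (n - 1) := pow_pos hε0 _
    set f : Space n → ℝ := fun x => 1 / ε ^ (n - 1) * g (ε⁻¹ • (p - x)) with hf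
    set f' : Space n → ℝ := fun x => 1 / ε ^ (n - 1) * g (ε⁻¹ • (toTangent ν (p - x) : Space n))
      with hf'
    have hgc := hg.lip.continuous
    have hbd : ∀ y : Space n, ‖1 / ε ^ (n - 1) * g y‖ ≤ 1 / ε ^ (n - 1) := fun y => by
      rw [norm_mul, Real.norm_of_nonneg (hg.nonneg _), Real.norm_of_nonneg (by positivity)]
      exact mul_le_of_le_one_right (by positivity) (hg.le_one _)
    have hfi : Integrable f (boundaryMeasure Ω) :=
      Integrable.of_bound (by apply Continuous.aestronglyMeasurable; fun_prop) _
        (ae_of_all _ fun x => hbd _)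
    have hfi' : Integrable f' (boundaryMeasure Ω) :=
      Integrable.of_bound (by apply Continuous.aestronglyMeasurable; fun_prop) _
        (ae_of_all _ fun x => hbd _)
    have hI : ∫ x, f x ∂(boundaryMeasure Ω) = ∫ x in A, f x ∂μHE[n - 1] := by
      rw [hAeq, setIntegral_eq_integral_of_forall_compl_eq_zero]
      intro x hx
      rw [Metric.mem_ball, dist_comm, dist_eq_norm, not_lt] at hx
      simp only [hf]
      rw [hg.zero, mul_zero]
      rw [norm_smul, norm_inv, Real.norm_of_nonneg hε0.le, le_inv_mul_iff₀ hε0]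
      linarith
    have hdiff : |∫ x in A, f x ∂μHE[n - 1] - ∫ x in A, f' x ∂μHE[n - 1]| ≤
        2 * L * η * (C * 2 ^ (n - 1)) := by
      rw [hAeq, ← integral_sub hfi.integrableOn hfi'.integrableOn, ← hAeq]
      have hball : ∀ x ∈ A, ‖f x - f' x‖ ≤ (Metric.ball p (2 * ε)).indicator
          (fun _ => 1 / ε ^ (n - 1) * (2 * L * η)) x := by
        intro x hx
        have h1 := abs_bump_flat_sub_le hg hν hη0 hη (hflat p hpA x hx) hε0
        rw [← mul_sub, norm_mul, Real.norm_of_nonneg (by positivity : 0 ≤ 1 / ε ^ (n - 1))]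
        refine (mul_le_mul_of_nonneg_left h1 (by positivity)).trans (le_of_eq ?_)
        have h2 : p - x ∈ Metric.ball (0 : Space n) (2 * ε) ↔ x ∈ Metric.ball p (2 * ε) := by
          rw [mem_ball_zero_iff, Metric.mem_ball, dist_comm, dist_eq_norm]
        by_cases h3 : x ∈ Metric.ball p (2 * ε)
        · rw [indicator_of_mem h3, indicator_of_mem (h2.2 h3)]
        · rw [indicator_of_notMem h3, indicator_of_notMem (fun h => h3 (h2.1 h)), mul_zero]
      have hindi : Integrable ((Metric.ball p (2 * ε)).indicator
          (fun _ => 1 / ε ^ (n - 1) * (2 * (L : ℝ) * η))) (boundaryMeasure Ω) :=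
        (integrable_const _).indicator measurableSet_ball
      have hμ : (boundaryMeasure Ω).real (Metric.ball p (2 * ε)) ≤ C * (2 * ε) ^ (n - 1) :=
        ENNReal.toReal_le_of_le_ofReal (by positivity)
          (hAhl p hp (2 * ε) (by linarith) (by linarith))
      calc |∫ x in A, f x - f' x ∂μHE[n - 1]| ≤ ∫ x in A, ‖f x - f' x‖ ∂μHE[n - 1] :=
            by rw [← Real.norm_eq_abs]; exact norm_integral_le_integral_norm _
        _ ≤ ∫ x in A, (Metric.ball p (2 * ε)).indicator
            (fun _ => 1 / ε ^ (n - 1) * (2 * (L : ℝ) * η)) x ∂μHE[n - 1] := by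
            refine setIntegral_mono_on ?_ ?_ hAm hball
            · rw [IntegrableOn, hAeq]; exact ((hfi.sub hfi').norm).integrableOn
            · rw [IntegrableOn, hAeq]; exact hindi.integrableOn
        _ ≤ ∫ x, (Metric.ball p (2 * ε)).indicator
            (fun _ => 1 / ε ^ (n - 1) * (2 * (L : ℝ) * η)) x ∂(boundaryMeasure Ω) := by
            rw [hAeq]
            exact setIntegral_le_integral hindi
              (ae_of_all _ fun x => indicator_nonneg (fun _ _ => by positivity) x)
        _ = (boundaryMeasure Ω).real (Metric.ball p (2 * ε)) *
            (1 / ε ^ (n - 1) * (2 * (L : ℝ) * η)) := by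
            rw [integral_indicator_const _ measurableSet_ball, smul_eq_mul]
        _ ≤ C * (2 * ε) ^ (n - 1) * (1 / ε ^ (n - 1) * (2 * (L : ℝ) * η)) := by gcongr
        _ = _ := by
            rw [mul_pow]
            field_simp
    rw [hI]
    rw [abs_le] at hdiff ⊢
    constructor <;> nlinarith
  have hlim : Tendsto (fun η : ℝ => 2 * L * η * (C * 2 ^ (n - 1)) +
      ((1 - η)⁻¹ ^ (n - 1) - 1) * c) (𝓝[>] 0) (𝓝 0) := by
    have : ContinuousAt (fun η : ℝ => 2 * L * η * (C * 2 ^ (n - 1)) +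
      ((1 - η)⁻¹ ^ (n - 1) - 1) * c) 0 := by
      have : ContinuousAt (fun η : ℝ => (1 - η)⁻¹) 0 :=
        ContinuousAt.inv₀ (by fun_prop) (by norm_num)
      fun_prop
    have h2 := this.tendsto
    simp only [mul_zero, zero_mul, sub_zero, inv_one, one_pow, sub_self, add_zero] at h2
    exact h2.mono_left nhdsWithin_le_nhds
  refine Metric.tendsto_nhds.2 fun e he => ?_
  obtain ⟨η, h1, h2⟩ := ((hlim.eventually (gt_mem_nhds he)).and
    (Ioo_mem_nhdsGT (show (0 : ℝ) < 1 / 2 by norm_num))).exists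
  filter_upwards [key η h2.1 h2.2] with ε hε
  rw [Real.dist_eq]
  exact hε.trans_lt h1

/-- The rescaled bumps have bounded mass and shrinking support, so a continuous weight may be
replaced by its value at `p`. -/
lemma HasC1Boundary.tendsto_blowup (ho : IsOpen Ω) (hb : Bornology.IsBounded Ω)
    (h : HasC1Boundary Ω) {p : Space n} (hp : p ∈ frontier Ω) {g : Space n → ℝ} {L : NNReal}
    (hg : IsBump g L) {c : ℝ} (hc : ∀ ν : Space n, ‖ν‖ = 1 → ∫ t : tangent ν, g t = c)
    {Φ : Space n → ℝ} (hΦ : Continuous Φ) :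
    Tendsto (fun ε : ℝ => ∫ x, 1 / ε ^ (n - 1) * g (ε⁻¹ • (p - x)) * Φ x ∂(boundaryMeasure Ω))
      (𝓝[>] 0) (𝓝 (c * Φ p)) := by
  have hfin := h.isFiniteMeasure ho hb
  have h0 := h.tendsto_bump ho hb hp hg hc
  have hc0 : 0 ≤ c := by
    refine ge_of_tendsto h0 ?_
    filter_upwards [self_mem_nhdsWithin] with ε hε
    exact integral_nonneg fun x => mul_nonneg
      (one_div_nonneg.2 (pow_nonneg (le_of_lt hε) _)) (hg.nonneg _)
  have hgc := hg.lip.continuous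
  have hdiff : Tendsto (fun ε : ℝ => ∫ x, 1 / ε ^ (n - 1) * g (ε⁻¹ • (p - x)) * (Φ x - Φ p)
      ∂(boundaryMeasure Ω)) (𝓝[>] 0) (𝓝 0) := by
    refine Metric.tendsto_nhds.2 fun e he => ?_
    have he' : 0 < e / (c + 2) := by positivity
    obtain ⟨r, hr, hrΦ⟩ := Metric.continuousAt_iff.1 hΦ.continuousAt (e / (c + 2)) he'
    filter_upwards [h0.eventually (gt_mem_nhds (show c < c + 1 by linarith)),
      Ioo_mem_nhdsGT hr] with ε hε1 hε2
    have hεp : 0 < ε ^ (n - 1) := pow_pos hε2.1 _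
    rw [dist_zero_right]
    have hint : Integrable (fun x => 1 / ε ^ (n - 1) * g (ε⁻¹ • (p - x))) (boundaryMeasure Ω) := by
      refine Integrable.of_bound (by apply Continuous.aestronglyMeasurable; fun_prop)
        (1 / ε ^ (n - 1)) (ae_of_all _ fun x => ?_)
      rw [norm_mul, Real.norm_of_nonneg (hg.nonneg _), Real.norm_of_nonneg (by positivity)]
      exact mul_le_of_le_one_right (by positivity) (hg.le_one _)
    calc _ ≤ ∫ x, 1 / ε ^ (n - 1) * g (ε⁻¹ • (p - x)) * (e / (c + 2)) ∂(boundaryMeasure Ω) := by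
          refine norm_integral_le_of_norm_le (hint.mul_const _) (ae_of_all _ fun x => ?_)
          by_cases hz : g (ε⁻¹ • (p - x)) = 0
          · simp [hz]
          · have h1 := hg.norm_lt hz
            rw [norm_smul, norm_inv, Real.norm_of_nonneg hε2.1.le, inv_mul_lt_iff₀ hε2.1, mul_one,
              norm_sub_rev, ← dist_eq_norm] at h1
            have h2 := hrΦ (h1.trans hε2.2)
            rw [norm_mul, Real.norm_of_nonneg (mul_nonneg (by positivity) (hg.nonneg _))]
            rw [Real.dist_eq] at h2
            exact mul_le_mul_of_nonneg_left h2.le (mul_nonneg (by positivity) (hg.nonneg _))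
      _ = (∫ x, 1 / ε ^ (n - 1) * g (ε⁻¹ • (p - x)) ∂(boundaryMeasure Ω)) * (e / (c + 2)) :=
          integral_mul_const _ _
      _ ≤ (c + 1) * (e / (c + 2)) := by gcongr
      _ < e := by
          rw [mul_div_assoc', div_lt_iff₀ (by positivity)]
          nlinarith
  have hsum := hdiff.add (h0.mul_const (Φ p))
  rw [zero_add] at hsum
  refine hsum.congr' ?_
  filter_upwards [self_mem_nhdsWithin] with ε hε
  have hεp : 0 < ε ^ (n - 1) := pow_pos hε _
  have hcomp : IsCompact (frontier Ω) :=
    Metric.isCompact_of_isClosed_isBounded isClosed_frontier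
      (hb.closure.subset frontier_subset_closure)
  have hcont : ∀ f : Space n → ℝ, Continuous f → Integrable f (boundaryMeasure Ω) := fun f hf => by
    obtain ⟨B, hB⟩ := hcomp.exists_bound_of_continuousOn hf.continuousOn
    refine Integrable.of_bound hf.aestronglyMeasurable B ?_
    exact (ae_restrict_mem isClosed_frontier.measurableSet).mono hB
  rw [← integral_mul_const, ← integral_add (hcont _ (by fun_prop)) (hcont _ (by fun_prop))]
  congr 1
  ext x
  ring

end RTE

namespace RTE
variable {n : ℕ}

/-! ### Surface measure of the sphere -/

/-- With the indicator of a thin shell as radial factor, this recovers integrals over the sphere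
from Lebesgue integrals. -/
lemma integral_polar [NeZero n] (a : ℝ → ℝ) (B : Space n → ℝ) :
    ∫ x : Space n, a ‖x‖ * B (‖x‖⁻¹ • x) =
      (∫ θ : Dir n, B θ ∂(volume : Measure (Space n)).toSphere) *
        ∫ r in Ioi (0 : ℝ), r ^ (n - 1) * a r := by
  calc
    _ = ∫ x : ({(0 : Space n)}ᶜ : Set (Space n)), a ‖x.1‖ * B (‖x.1‖⁻¹ • x.1)
        ∂((volume : Measure (Space n)).comap (↑)) := by
      rw [integral_subtype_comap (measurableSet_singleton _).compl
        fun x : Space n => a ‖x‖ * B (‖x‖⁻¹ • x), restrict_compl_singleton]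
    _ = ∫ x : Dir n × Ioi (0 : ℝ), B x.1 * a x.2 ∂(volume : Measure (Space n)).toSphere.prod
        (.volumeIoiPow (n - 1)) := by
      have h :=
        (volume : Measure (Space n)).measurePreserving_homeomorphUnitSphereProd.integral_comp
        (Homeomorph.measurableEmbedding _) (fun x : Dir n × Ioi (0 : ℝ) => B x.1 * a x.2)
      rw [finrank_euclideanSpace_fin] at h
      rw [← h]
      refine integral_congr_ae (ae_of_all _ fun x => ?_)
      simp [mul_comm]
    _ = _ := by
      rw [integral_prod_mul (fun θ : Dir n => B θ) (fun r : Ioi (0 : ℝ) => a r)]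
      congr 1
      simp only [Measure.volumeIoiPow, ENNReal.ofReal]
      rw [integral_withDensity_eq_integral_smul,
        integral_subtype_comap measurableSet_Ioi fun r : ℝ => Real.toNNReal (r ^ (n - 1)) • a r]
      · refine setIntegral_congr_fun measurableSet_Ioi fun x hx => ?_
        rw [NNReal.smul_def, Real.coe_toNNReal _ (pow_nonneg (le_of_lt hx) _), smul_eq_mul]
      · exact (measurable_subtype_coe.pow_const _).real_toNNReal

/-- The radial mass of a thin shell. -/
noncomputable def shellMass (n : ℕ) (ε : ℝ) : ℝ :=
  ∫ r in Ioi (0 : ℝ), r ^ (n - 1) * (Ioc 1 (1 + ε)).indicator 1 r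

lemma shellMass_eq {ε : ℝ} (hε : 0 < ε) :
    shellMass n ε = ∫ r in (1 : ℝ)..(1 + ε), r ^ (n - 1) := by
  have h1 : Ioi (0 : ℝ) ∩ Ioc 1 (1 + ε) = Ioc 1 (1 + ε) :=
    inter_eq_right.2 fun x hx => lt_trans one_pos hx.1
  have h2 : ∀ r : ℝ, r ^ (n - 1) * (Ioc 1 (1 + ε)).indicator (1 : ℝ → ℝ) r =
      (Ioc 1 (1 + ε)).indicator (fun r => r ^ (n - 1)) r := fun r => by
    by_cases hr : r ∈ Ioc 1 (1 + ε) <;> simp [hr]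
  rw [shellMass, intervalIntegral.integral_of_le (by linarith)]
  simp_rw [h2]
  rw [setIntegral_indicator measurableSet_Ioc, h1]

/-- The limit is the derivative at `r = 1` of the primitive of `r ^ (n - 1)`. -/
lemma tendsto_shellMass : Tendsto (fun ε => ε⁻¹ * shellMass n ε) (𝓝[>] 0) (𝓝 1) := by
  have h1 : HasDerivAt (fun y : ℝ => ∫ r in (1 : ℝ)..y, r ^ (n - 1)) (1 ^ (n - 1)) 1 :=
    ((continuous_pow (M := ℝ) (n - 1)).integral_hasStrictDerivAt 1 1).hasDerivAt
  have h2 := h1.tendsto_slope_zero_right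
  rw [one_pow] at h2
  refine h2.congr' ?_
  filter_upwards [self_mem_nhdsWithin] with ε hε
  rw [shellMass_eq hε, intervalIntegral.integral_same, sub_zero, smul_eq_mul]

lemma le_shellMass {ε : ℝ} (hε : 0 < ε) : ε ≤ shellMass n ε := by
  rw [shellMass_eq hε]
  calc ε = ∫ _ in (1 : ℝ)..(1 + ε), (1 : ℝ) := by simp
    _ ≤ _ := by
      refine intervalIntegral.integral_mono_on (by linarith) (by simp)
        ((continuous_pow _).intervalIntegrable _ _) fun r hr => one_le_pow₀ hr.1

/-- The sphere is upper Ahlfors regular. -/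
lemma sphereMeasure_ball_le (n : ℕ) [NeZero n] : ∃ C : ℝ, 0 ≤ C ∧ ∀ (θ : Dir n) (ε : ℝ), 0 < ε →
    (sphereMeasure n).real (Metric.ball θ ε) ≤ C * ε ^ (n - 1) := by
  set c := (volume : Measure (Space n)).real (Metric.ball 0 1) with hc
  set S := (volume : Measure (Space n)).toSphere with hS
  refine ⟨(S univ)⁻¹.toReal * (2 ^ n * c), by positivity, fun θ ε hε => ?_⟩
  -- The spherical cap is thickened radially to `1 < r ≤ 1 + ε`. The result lies in a ball of radius
  -- `2ε`, while the radial direction contributes mass at least `ε`.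
  have h1 := integral_polar (n := n) ((Ioc 1 (1 + ε)).indicator 1)
    ((Metric.ball (θ : Space n) ε).indicator 1)
  have h2 : ∫ η : Dir n, (Metric.ball (θ : Space n) ε).indicator (1 : Space n → ℝ) η ∂S =
      S.real (Metric.ball θ ε) := by
    have : (fun η : Dir n => (Metric.ball (θ : Space n) ε).indicator (1 : Space n → ℝ) η) =
        (Metric.ball θ ε).indicator 1 := by
      ext η
      by_cases h : dist η θ < ε
      · rw [indicator_of_mem (show η ∈ Metric.ball θ ε from h),
          indicator_of_mem (show (η : Space n) ∈ Metric.ball (θ : Space n) ε from h)]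
        rfl
      · rw [indicator_of_notMem (show η ∉ Metric.ball θ ε from h),
          indicator_of_notMem (show (η : Space n) ∉ Metric.ball (θ : Space n) ε from h)]
    rw [this, integral_indicator_one measurableSet_ball]
  have h3 : ∫ x : Space n, (Ioc 1 (1 + ε)).indicator (1 : ℝ → ℝ) ‖x‖ *
      (Metric.ball (θ : Space n) ε).indicator (1 : Space n → ℝ) (‖x‖⁻¹ • x) ≤
      (2 * ε) ^ n * c := by
    have h4 : (volume : Measure (Space n)).real (Metric.ball (θ : Space n) (2 * ε)) =
        (2 * ε) ^ n * c := by
      rw [Measure.real, Measure.addHaar_ball_of_pos _ _ (by positivity), ENNReal.toReal_mul,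
        ENNReal.toReal_ofReal (by positivity), finrank_euclideanSpace_fin]
      rfl
    rw [← h4, ← integral_indicator_one measurableSet_ball]
    refine integral_mono_of_nonneg (ae_of_all _ fun x => mul_nonneg
      (indicator_nonneg (fun _ _ => zero_le_one) _) (indicator_nonneg (fun _ _ => zero_le_one) _))
      ((integrable_indicator_iff measurableSet_ball).2
        (integrableOn_const (C := (1 : ℝ)) measure_ball_lt_top.ne)) (ae_of_all _ fun x => ?_)
    simp only
    by_cases hx1 : ‖x‖ ∈ Ioc 1 (1 + ε)
    · by_cases hx2 : ‖x‖⁻¹ • x ∈ Metric.ball (θ : Space n) ε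
      · have hx3 : x ∈ Metric.ball (θ : Space n) (2 * ε) := by
          rw [Metric.mem_ball, dist_eq_norm] at hx2 ⊢
          have hx0 : 0 < ‖x‖ := by linarith [hx1.1]
          have h5 : ‖x - ‖x‖⁻¹ • x‖ ≤ ε := by
            rw [show x - ‖x‖⁻¹ • x = (1 - ‖x‖⁻¹) • x by rw [sub_smul, one_smul], norm_smul,
              Real.norm_of_nonneg (sub_nonneg.2 (inv_le_one_of_one_le₀ hx1.1.le)), sub_mul,
              inv_mul_cancel₀ hx0.ne']
            linarith [hx1.2]
          calc ‖x - θ‖ = ‖(x - ‖x‖⁻¹ • x) + (‖x‖⁻¹ • x - θ)‖ := by congr 1; abel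
            _ ≤ _ := norm_add_le _ _
            _ < _ := by linarith
        rw [indicator_of_mem hx1, indicator_of_mem hx2, indicator_of_mem hx3]
        simp
      · rw [indicator_of_notMem hx2, mul_zero]
        exact indicator_nonneg (fun _ _ => zero_le_one) _
    · rw [indicator_of_notMem hx1, zero_mul]
      exact indicator_nonneg (fun _ _ => zero_le_one) _
  rw [h1, h2] at h3
  have h5 : S.real (Metric.ball θ ε) * ε ≤ (2 * ε) ^ n * c :=
    (mul_le_mul_of_nonneg_left (le_shellMass (n := n) hε) measureReal_nonneg).trans h3
  have h6 : S.real (Metric.ball θ ε) ≤ 2 ^ n * c * ε ^ (n - 1) := by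
    refine le_of_mul_le_mul_right (h5.trans (le_of_eq ?_)) hε
    obtain ⟨m, rfl⟩ := Nat.exists_eq_succ_of_ne_zero (NeZero.ne n)
    rw [Nat.succ_sub_one, mul_pow, pow_succ ε]
    ring
  rw [sphereMeasure, measureReal_ennreal_smul_apply, mul_assoc]
  gcongr

/-- Fubini for the splitting into `ℝν` and its orthogonal complement: the slab has thickness one, so
the normal variable integrates to one. -/
lemma integral_slab (ν : Space n) (hν : ‖ν‖ = 1) (g : Space n → ℝ) :
    ∫ z : Space n, (Ioo (0 : ℝ) 1).indicator 1 ⟪ν, z⟫ * g (toTangent ν z) =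
      ∫ t : tangent ν, g t := by
  have h1 := Submodule.measurePreserving_measurableEquivProd (ℝ ∙ ν) (0 : Space n)
  rw [InnerProductSpace.euclideanHausdorffMeasure_eq_volume] at h1
  set l := LinearIsometryEquiv.toSpanUnitSingleton (𝕜 := ℝ) ν hν with hl
  have h2 := h1.integral_comp (MeasurableEquiv.measurableEmbedding _)
    (fun q : (ℝ ∙ ν) × tangent ν => (Ioo (0 : ℝ) 1).indicator 1 ⟪ν, (q.1 : Space n)⟫ * g q.2)
  rw [Measure.volume_eq_prod, integral_prod_mul
    (fun c : (ℝ ∙ ν) => (Ioo (0 : ℝ) 1).indicator 1 ⟪ν, (c : Space n)⟫)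
    (fun t : tangent ν => g t)] at h2
  have h3 : ∫ c : (ℝ ∙ ν), (Ioo (0 : ℝ) 1).indicator (1 : ℝ → ℝ) ⟪ν, (c : Space n)⟫ = 1 := by
    rw [← l.measurePreserving.integral_comp l.toHomeomorph.measurableEmbedding]
    simp only [hl, LinearIsometryEquiv.toSpanUnitSingleton_apply, real_inner_smul_right,
      real_inner_self_eq_norm_sq, hν, one_pow, mul_one]
    rw [integral_indicator_one measurableSet_Ioo]
    simp
  rw [h3, one_mul] at h2
  rw [← h2]
  refine integral_congr_ae (ae_of_all _ fun z => ?_)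
  simp only [Submodule.measurableEquivProd_apply, vsub_eq_sub, sub_zero]
  congr 2
  have h4 : ((ℝ ∙ ν).orthogonalProjectionOnto z : Space n) = ⟪ν, z⟫ • ν := by
    exact Submodule.starProjection_unit_singleton ℝ hν z
  rw [h4, real_inner_smul_right, real_inner_self_eq_norm_sq, hν, one_pow, mul_one]

/-- The radial excess `(‖ν + ε z‖ - 1) / ε`. -/
noncomputable def excess (ν z : Space n) (ε : ℝ) : ℝ := ε⁻¹ * (‖ν + ε • z‖ - 1)

lemma tendsto_excess {ν : Space n} (hν : ‖ν‖ = 1) (z : Space n) :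
    Tendsto (excess ν z) (𝓝[>] 0) (𝓝 ⟪ν, z⟫) := by
  have h1 : ContinuousAt (fun ε : ℝ => (2 * ⟪ν, z⟫ + ε * ‖z‖ ^ 2) / (‖ν + ε • z‖ + 1)) 0 := by
    refine ContinuousAt.div (by fun_prop) (by fun_prop) ?_
    positivity
  have h2 := h1.tendsto.mono_left (nhdsWithin_le_nhds (s := Ioi 0))
  have h3 : (2 * ⟪ν, z⟫ + 0 * ‖z‖ ^ 2) / (‖ν + (0 : ℝ) • z‖ + 1) = ⟪ν, z⟫ := by
    rw [zero_smul, add_zero, hν]; ring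
  rw [h3] at h2
  refine h2.congr' ?_
  filter_upwards [self_mem_nhdsWithin] with ε hε
  have hε0 : (ε : ℝ) ≠ 0 := ne_of_gt hε
  have h4 : ‖ν + ε • z‖ ^ 2 = 1 + 2 * ε * ⟪ν, z⟫ + ε ^ 2 * ‖z‖ ^ 2 := by
    rw [norm_add_sq_real, hν, real_inner_smul_right, norm_smul, mul_pow, Real.norm_eq_abs, sq_abs]
    ring
  rw [excess, div_eq_iff (by positivity)]
  field_simp
  linear_combination -h4

/-- The unnormalized spherical integral of a concentrating bump tends to the integral of the bump
over the tangent plane. -/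
lemma tendsto_sphere_bump [NeZero n] {g : Space n → ℝ} {L : NNReal} (hg : IsBump g L) (θ : Dir n) :
    Tendsto (fun ε : ℝ => ∫ η : Dir n, 1 / ε ^ (n - 1) * g (ε⁻¹ • ((η : Space n) - θ))
      ∂(volume : Measure (Space n)).toSphere) (𝓝[>] 0) (𝓝 (∫ t : tangent (θ : Space n), g t)) := by
  have hθ := norm_dir θ
  set ν := (θ : Space n) with hν
  -- The bump on the sphere, thickened to a shell and rescaled by `x = ν + εz`. As `ε → 0` the shell
  -- becomes the slab `0 < ⟪ν, z⟫ < 1`, and the argument of `g` becomes the tangential part of `z`.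
  set F : ℝ → Space n → ℝ := fun ε z => (Ioc (1 : ℝ) (1 + ε)).indicator 1 ‖ν + ε • z‖ *
    g (ε⁻¹ • (‖ν + ε • z‖⁻¹ • (ν + ε • z) - ν)) with hF
  have hgc := hg.lip.continuous
  have hFeq : ∀ ε > 0, ∫ z, F ε z = (∫ η : Dir n, 1 / ε ^ (n - 1) * g (ε⁻¹ • ((η : Space n) - ν))
      ∂(volume : Measure (Space n)).toSphere) * (ε⁻¹ * shellMass n ε) := by
    intro ε hε
    have h1 := integral_polar (n := n) ((Ioc (1 : ℝ) (1 + ε)).indicator 1)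
      (fun x => g (ε⁻¹ • (x - ν)))
    have h2 := integral_add_left_eq_self (μ := (volume : Measure (Space n)))
      (fun x : Space n => (Ioc (1 : ℝ) (1 + ε)).indicator (1 : ℝ → ℝ) ‖x‖ *
        g (ε⁻¹ • (‖x‖⁻¹ • x - ν))) ν
    have h3 := Measure.integral_comp_smul (volume : Measure (Space n))
      (fun x : Space n => (Ioc (1 : ℝ) (1 + ε)).indicator (1 : ℝ → ℝ) ‖ν + x‖ *
        g (ε⁻¹ • (‖ν + x‖⁻¹ • (ν + x) - ν))) ε
    rw [finrank_euclideanSpace_fin, smul_eq_mul, abs_of_pos (inv_pos.2 (pow_pos hε n))] at h3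
    simp only [hF]
    rw [h3, h2, h1, integral_const_mul]
    change (ε ^ n)⁻¹ * (_ * shellMass n ε) = _
    obtain ⟨m, rfl⟩ := Nat.exists_eq_succ_of_ne_zero (NeZero.ne n)
    rw [Nat.succ_sub_one, pow_succ]
    field_simp
  have hlim : Tendsto (fun ε => ∫ z, F ε z) (𝓝[>] 0) (𝓝 (∫ t : tangent ν, g t)) := by
    rw [← integral_slab ν hθ g]
    refine tendsto_integral_filter_of_dominated_convergence
      ((Metric.ball (0 : Space n) 2).indicator 1) ?_ ?_ ?_ ?_
    · refine Eventually.of_forall fun ε => Measurable.aestronglyMeasurable ?_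
      have h1 : Measurable ((Ioc (1 : ℝ) (1 + ε)).indicator (1 : ℝ → ℝ)) :=
        measurable_one.indicator measurableSet_Ioc
      have h2 : Measurable fun z : Space n => ‖ν + ε • z‖ := by fun_prop
      refine (h1.comp h2).mul (hgc.measurable.comp ?_)
      fun_prop
    · filter_upwards [self_mem_nhdsWithin] with ε hε
      have hε0 : (0 : ℝ) < ε := hε
      refine ae_of_all _ fun z => ?_
      by_cases h1 : ‖ν + ε • z‖ ∈ Ioc (1 : ℝ) (1 + ε)
      swap
      · simp only [hF]
        rw [indicator_of_notMem h1, zero_mul, norm_zero]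
        exact indicator_nonneg (fun _ _ => zero_le_one) _
      by_cases h2 : g (ε⁻¹ • (‖ν + ε • z‖⁻¹ • (ν + ε • z) - ν)) = 0
      · simp only [hF]
        rw [h2, mul_zero, norm_zero]
        exact indicator_nonneg (fun _ _ => zero_le_one) _
      have hz : z ∈ Metric.ball (0 : Space n) 2 := by
        have h3 := hg.norm_lt h2
        rw [norm_smul, norm_inv, Real.norm_of_nonneg hε0.le, inv_mul_lt_iff₀ hε0, mul_one] at h3
        set x := ν + ε • z with hx
        have hx0 : 0 < ‖x‖ := by linarith [h1.1]
        have h5 : ‖x - ‖x‖⁻¹ • x‖ ≤ ε := by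
          rw [show x - ‖x‖⁻¹ • x = (1 - ‖x‖⁻¹) • x by rw [sub_smul, one_smul], norm_smul,
            Real.norm_of_nonneg (sub_nonneg.2 (inv_le_one_of_one_le₀ h1.1.le)), sub_mul,
            inv_mul_cancel₀ hx0.ne']
          linarith [h1.2]
        have h6 : ‖ε • z‖ < 2 * ε := by
          calc ‖ε • z‖ = ‖(x - ‖x‖⁻¹ • x) + (‖x‖⁻¹ • x - ν)‖ := by
                congr 1; rw [hx]; abel
            _ ≤ _ := norm_add_le _ _
            _ < _ := by linarith
        rw [norm_smul, Real.norm_of_nonneg hε0.le] at h6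
        rw [mem_ball_zero_iff]
        nlinarith
      simp only [hF]
      rw [indicator_of_mem h1, indicator_of_mem hz, Pi.one_apply, one_mul,
        Real.norm_of_nonneg (hg.nonneg _)]
      exact hg.le_one _
    · exact (integrable_indicator_iff measurableSet_ball).2
        (integrableOn_const (C := (1 : ℝ)) measure_ball_lt_top.ne)
    · have hnull : ∀ c : ℝ, ∀ᵐ z : Space n, ⟪ν, z⟫ ≠ c := by
        intro c
        have h1 := Measure.addHaar_affineSubspace (volume : Measure (Space n))
          (AffineSubspace.mk' (c • ν) (tangent ν)) (by
            intro h
            have h2 : (c + 1) • ν ∈ AffineSubspace.mk' (c • ν) (tangent ν) := by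
              rw [h]; exact AffineSubspace.mem_top _ _ _
            rw [AffineSubspace.mem_mk', vsub_eq_sub, ← sub_smul, mem_tangent, real_inner_smul_right,
              real_inner_self_eq_norm_sq, hθ] at h2
            norm_num at h2)
        refine measure_mono_null (fun z hz => ?_) h1
        have hz' : ⟪ν, z⟫ = c := not_not.1 hz
        change z ∈ AffineSubspace.mk' (c • ν) (tangent ν)
        rw [AffineSubspace.mem_mk', vsub_eq_sub, mem_tangent, inner_sub_right,
          real_inner_smul_right, real_inner_self_eq_norm_sq, hθ, hz']
        ring
      filter_upwards [hnull 0, hnull 1] with z hz0 hz1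
      have hq := tendsto_excess hθ z
      have hN : Tendsto (fun ε : ℝ => ‖ν + ε • z‖) (𝓝[>] 0) (𝓝 1) := by
        have h1 : Continuous fun ε : ℝ => ‖ν + ε • z‖ := by fun_prop
        have h2 := (h1.tendsto 0).mono_left (nhdsWithin_le_nhds (s := Ioi 0))
        rwa [zero_smul, add_zero, hθ] at h2
      have hind : ∀ᶠ ε in 𝓝[>] (0 : ℝ), (Ioc (1 : ℝ) (1 + ε)).indicator (1 : ℝ → ℝ) ‖ν + ε • z‖ =
          (Ioo (0 : ℝ) 1).indicator 1 ⟪ν, z⟫ := by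
        have hmem : ∀ ε : ℝ, 0 < ε →
            (‖ν + ε • z‖ ∈ Ioc 1 (1 + ε) ↔ excess ν z ε ∈ Ioc (0 : ℝ) 1) := by
          intro ε hε
          have he : ‖ν + ε • z‖ = 1 + ε * excess ν z ε := by
            rw [excess, ← mul_assoc, mul_inv_cancel₀ hε.ne']; ring
          rw [he]
          constructor
          · rintro ⟨h1, h2⟩
            exact ⟨by nlinarith, by nlinarith⟩
          · rintro ⟨h1, h2⟩
            exact ⟨by nlinarith, by nlinarith⟩
        by_cases hI : ⟪ν, z⟫ ∈ Ioo (0 : ℝ) 1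
        · filter_upwards [hq.eventually (Ioo_mem_nhds hI.1 hI.2), self_mem_nhdsWithin] with ε h1 h2
          rw [indicator_of_mem hI, indicator_of_mem ((hmem ε h2).2 ⟨h1.1, h1.2.le⟩)]
          rfl
        · have hI2 : ⟪ν, z⟫ ∈ (Icc (0 : ℝ) 1)ᶜ := fun h =>
            hI ⟨lt_of_le_of_ne h.1 (Ne.symm hz0), lt_of_le_of_ne h.2 hz1⟩
          filter_upwards [hq.eventually (isClosed_Icc.isOpen_compl.mem_nhds hI2),
            self_mem_nhdsWithin] with ε h1 h2
          rw [indicator_of_notMem hI, indicator_of_notMem fun h =>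
            h1 (Ioc_subset_Icc_self ((hmem ε h2).1 h))]
      have harg : Tendsto (fun ε : ℝ => ε⁻¹ • (‖ν + ε • z‖⁻¹ • (ν + ε • z) - ν)) (𝓝[>] 0)
          (𝓝 (toTangent ν z)) := by
        have h1 := (hN.inv₀ one_ne_zero).smul ((tendsto_const_nhds (x := z)).sub (hq.smul_const ν))
        rw [inv_one, one_smul, ← coe_toTangent hθ] at h1
        refine h1.congr' ?_
        filter_upwards [self_mem_nhdsWithin, hN.eventually (lt_mem_nhds one_pos)] with ε hε hpos
        have hε0 : (ε : ℝ) ≠ 0 := ne_of_gt hε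
        have hN0 : ‖ν + ε • z‖ ≠ 0 := ne_of_gt hpos
        rw [excess]
        set N := ‖ν + ε • z‖
        have h2 : ε⁻¹ • (N⁻¹ • (ν + ε • z) - ν) = (ε⁻¹ * N⁻¹ - ε⁻¹) • ν + (ε⁻¹ * N⁻¹ * ε) • z := by
          module
        have h3 : N⁻¹ • (z - (ε⁻¹ * (N - 1)) • ν) = N⁻¹ • z - (N⁻¹ * (ε⁻¹ * (N - 1))) • ν := by
          module
        rw [h2, h3, show ε⁻¹ * N⁻¹ * ε = N⁻¹ by field_simp,
          show N⁻¹ * (ε⁻¹ * (N - 1)) = -(ε⁻¹ * N⁻¹ - ε⁻¹) by field_simp; ring]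
        module
      have h2 := ((hgc.tendsto _).comp harg).const_mul ((Ioo (0 : ℝ) 1).indicator 1 ⟪ν, z⟫)
      refine h2.congr' ?_
      filter_upwards [hind] with ε hε
      simp only [hF, hε, Function.comp]
  have h1 := hlim.div (tendsto_shellMass (n := n)) one_ne_zero
  rw [div_one] at h1
  refine h1.congr' ?_
  filter_upwards [self_mem_nhdsWithin] with ε hε
  have hε0 : (0 : ℝ) < ε := hε
  have : 0 < ε⁻¹ * shellMass n ε := mul_pos (inv_pos.2 hε0) (hε0.trans_le (le_shellMass hε0))
  rw [Pi.div_apply, hFeq ε hε0, mul_div_assoc, div_self this.ne', mul_one]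

lemma sphereArea_pos [NeZero n] : 0 < sphereArea n := by
  rw [sphereArea, Measure.real]
  exact ENNReal.toReal_pos (Measure.measure_univ_ne_zero.2 (Measure.toSphere_ne_zero _))
    (measure_ne_top _ _)

lemma integral_sphereMeasure [NeZero n] (f : Dir n → ℝ) :
    ∫ θ, f θ ∂(volume : Measure (Space n)).toSphere =
      sphereArea n * ∫ θ, f θ ∂(sphereMeasure n) := by
  rw [sphereMeasure, integral_smul_measure, smul_eq_mul, ENNReal.toReal_inv, ← mul_assoc]
  have : sphereArea n * ((volume : Measure (Space n)).toSphere univ).toReal⁻¹ = 1 :=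
    mul_inv_cancel₀ sphereArea_pos.ne'
  rw [this, one_mul]

/-- The mollifier constant is the integral of the bump over any tangent plane. -/
lemma IsMollifierConstant.integral_tangent [NeZero n] {h : Space n → ℝ} {L : NNReal}
    (hh : IsBump h L) {ω : ℝ} (hω : IsMollifierConstant h ω) (ν : Space n) (hν : ‖ν‖ = 1) :
    ∫ t : tangent ν, h t = sphereArea n * ω := by
  have hν' : ν ∈ Metric.sphere (0 : Space n) 1 := by simpa using hν
  have h1 := tendsto_sphere_bump hh ⟨ν, hν'⟩
  simp_rw [integral_sphereMeasure] at h1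
  exact tendsto_nhds_unique h1 ((hω ⟨ν, hν'⟩).const_mul _)

/-- By the previous lemma the sign of `ω` is that of the integral of `h` over a tangent plane; `h`
is continuous, non-negative and equal to one at the origin. -/
lemma IsMollifierConstant.pos [NeZero n] {h : Space n → ℝ} {L : NNReal} (hh : IsBump h L)
    (h0 : h 0 = 1) {ω : ℝ} (hω : IsMollifierConstant h ω) : 0 < ω := by
  obtain ⟨v, hv⟩ := (NormedSpace.sphere_nonempty (E := Space n) (x := 0) (r := 1)).2 zero_le_one
  have hv1 : ‖v‖ = 1 := by simpa using hv
  have h1 := hω.integral_tangent hh v hv1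
  have h2 : 0 < ∫ t : tangent v, h t := by
    refine Continuous.integral_pos_of_hasCompactSupport_nonneg_nonzero
      (hh.lip.continuous.comp continuous_subtype_val) ?_ (fun t => hh.nonneg _) (x := 0)
      (by simp [h0])
    refine HasCompactSupport.intro (isCompact_closedBall (0 : tangent v) 1) fun t ht => ?_
    refine hh.zero _ ?_
    rw [Metric.mem_closedBall, dist_zero_right, not_le] at ht
    exact ht.le
  rw [h1] at h2
  exact (pos_iff_pos_of_mul_pos h2).1 sphereArea_pos

end RTE

namespace RTE
variable {n : ℕ}

/-! ### Mollification on the sphere -/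

/-- The angular mollifier. -/
noncomputable def moll (g : Space n → ℝ) (ω ε : ℝ) (a b : Dir n) : ℝ :=
  1 / (ω * ε ^ (n - 1)) * g (ε⁻¹ • ((a : Space n) - b))

variable {g : Space n → ℝ} {L : NNReal} {ω : ℝ}

lemma measurable_moll (hg : IsBump g L) (ω ε : ℝ) :
    Measurable fun q : Dir n × Dir n => moll g ω ε q.1 q.2 := by
  have h : Measurable fun q : Dir n × Dir n => ε⁻¹ • ((q.1 : Space n) - q.2) := by fun_prop
  exact (hg.lip.continuous.measurable.comp h).const_mul _

lemma moll_nonneg (hg : IsBump g L) (hω : 0 < ω) {ε : ℝ} (hε : 0 < ε) (a b : Dir n) :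
    0 ≤ moll g ω ε a b := mul_nonneg (by positivity) (hg.nonneg _)

lemma moll_le (hg : IsBump g L) (hω : 0 < ω) {ε : ℝ} (hε : 0 < ε) (a b : Dir n) :
    moll g ω ε a b ≤ 1 / (ω * ε ^ (n - 1)) :=
  mul_le_of_le_one_right (by positivity) (hg.le_one _)

lemma moll_eq_zero (hg : IsBump g L) {ε : ℝ} (hε : 0 < ε) {a b : Dir n} (h : ε ≤ dist a b) :
    moll g ω ε a b = 0 := by
  rw [moll, hg.zero, mul_zero]
  rw [norm_smul, norm_inv, Real.norm_of_nonneg hε.le, le_inv_mul_iff₀ hε, mul_one,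
    ← dist_eq_norm]
  exact h

/-- A cap of radius `ε` has measure `O(ε ^ (n - 1))`, which compensates the normalization. Bounding
both marginals controls mollification on bounded functions and on `L¹`. -/
lemma exists_lintegral_moll_le [NeZero n] (hg : IsBump g L) (hω : 0 < ω) :
    ∃ C : ℝ, 0 ≤ C ∧ ∀ ε > 0, ∀ b : Dir n,
      (∫⁻ a, ENNReal.ofReal (moll g ω ε a b) ∂(sphereMeasure n) ≤ ENNReal.ofReal C) ∧
      ∫⁻ a, ENNReal.ofReal (moll g ω ε b a) ∂(sphereMeasure n) ≤ ENNReal.ofReal C := by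
  obtain ⟨C, hC, H⟩ := sphereMeasure_ball_le n
  refine ⟨ω⁻¹ * C, by positivity, fun ε hε b => ?_⟩
  have key : ∀ f : Dir n → ℝ, (∀ a, f a ≤ 1 / (ω * ε ^ (n - 1))) →
      (∀ a, ε ≤ dist a b → f a = 0) →
      ∫⁻ a, ENNReal.ofReal (f a) ∂(sphereMeasure n) ≤ ENNReal.ofReal (ω⁻¹ * C) := by
    intro f h1 h2
    calc _ ≤ ∫⁻ a, (Metric.ball b ε).indicator
          (fun _ => ENNReal.ofReal (1 / (ω * ε ^ (n - 1)))) a ∂(sphereMeasure n) := by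
          refine lintegral_mono fun a => ?_
          by_cases ha : a ∈ Metric.ball b ε
          · rw [indicator_of_mem ha]
            exact ENNReal.ofReal_le_ofReal (h1 a)
          · rw [h2 a (not_lt.1 ha)]
            simp
      _ = ENNReal.ofReal (1 / (ω * ε ^ (n - 1))) * (sphereMeasure n) (Metric.ball b ε) :=
          lintegral_indicator_const measurableSet_ball _
      _ ≤ ENNReal.ofReal (1 / (ω * ε ^ (n - 1))) * ENNReal.ofReal (C * ε ^ (n - 1)) := by
          gcongr
          rw [← ofReal_measureReal]
          exact ENNReal.ofReal_le_ofReal (H b ε hε)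
      _ = _ := by
          rw [← ENNReal.ofReal_mul (by positivity)]
          congr 1
          field_simp
  exact ⟨key _ (fun a => moll_le hg hω hε a b) fun a ha => moll_eq_zero hg hε ha,
    key _ (fun a => moll_le hg hω hε b a) fun a ha => moll_eq_zero hg hε (by rwa [dist_comm])⟩

lemma integrable_moll_mul [NeZero n] (hg : IsBump g L) (hω : 0 < ω) {ε : ℝ} (hε : 0 < ε) (b : Dir n)
    {F : Dir n → ℝ} (hF : Integrable F (sphereMeasure n)) :
    Integrable (fun a => moll g ω ε a b * F a) (sphereMeasure n) := by
  have hm : Measurable fun a => moll g ω ε a b := (measurable_moll hg ω ε).of_uncurry_right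
  refine hF.bdd_mul hm.aestronglyMeasurable (c := 1 / (ω * ε ^ (n - 1))) (ae_of_all _ fun a => ?_)
  rw [Real.norm_of_nonneg (moll_nonneg hg hω hε a b)]
  exact moll_le hg hω hε a b

lemma tendsto_integral_moll [NeZero n] (hω0 : 0 < ω) (hω : IsMollifierConstant g ω) (b : Dir n) :
    Tendsto (fun ε : ℝ => ∫ a, moll g ω ε a b ∂(sphereMeasure n)) (𝓝[>] 0) (𝓝 1) := by
  have h := (hω b).const_mul ω⁻¹
  rw [inv_mul_cancel₀ hω0.ne'] at h
  refine h.congr fun ε => ?_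
  rw [← integral_const_mul]
  congr 1
  ext a
  rw [moll, one_div, one_div, mul_inv, mul_assoc]

/-- Mollification converges at the points of continuity. -/
lemma tendsto_moll_continuous [NeZero n] (hg : IsBump g L) (hω0 : 0 < ω)
    (hω : IsMollifierConstant g ω) {F : Dir n → ℝ} (hF : Continuous F) (b : Dir n) :
    Tendsto (fun ε : ℝ => ∫ a, moll g ω ε a b * F a ∂(sphereMeasure n)) (𝓝[>] 0) (𝓝 (F b)) := by
  have h0 := tendsto_integral_moll hω0 hω b
  have hFi : Integrable F (sphereMeasure n) :=
    hF.integrable_of_hasCompactSupport (HasCompactSupport.of_compactSpace F)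
  have hdiff : Tendsto (fun ε : ℝ => ∫ a, moll g ω ε a b * (F a - F b) ∂(sphereMeasure n))
      (𝓝[>] 0) (𝓝 0) := by
    refine Metric.tendsto_nhds.2 fun e he => ?_
    obtain ⟨r, hr, hrF⟩ := Metric.continuousAt_iff.1 hF.continuousAt (e / 3) (by positivity)
    filter_upwards [h0.eventually (gt_mem_nhds (show (1 : ℝ) < 2 by norm_num)),
      Ioo_mem_nhdsGT hr] with ε hε1 hε2
    rw [dist_zero_right]
    have hint := integrable_moll_mul hg hω0 hε2.1 b (integrable_const (1 : ℝ))
    simp only [mul_one] at hint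
    calc _ ≤ ∫ a, moll g ω ε a b * (e / 3) ∂(sphereMeasure n) := by
          refine norm_integral_le_of_norm_le (hint.mul_const _) (ae_of_all _ fun a => ?_)
          have hm0 := moll_nonneg hg hω0 hε2.1 a b
          rw [norm_mul, Real.norm_of_nonneg hm0]
          by_cases hd : ε ≤ dist a b
          · rw [moll_eq_zero hg hε2.1 hd]
            simp
          · exact mul_le_mul_of_nonneg_left (hrF ((not_le.1 hd).trans hε2.2)).le hm0
      _ = (∫ a, moll g ω ε a b ∂(sphereMeasure n)) * (e / 3) := integral_mul_const _ _
      _ ≤ 2 * (e / 3) := by gcongr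
      _ < e := by linarith
  have hsum := hdiff.add (h0.mul_const (F b))
  rw [zero_add, one_mul] at hsum
  refine hsum.congr' ?_
  filter_upwards [self_mem_nhdsWithin] with ε hε
  have h1 := integrable_moll_mul hg hω0 hε b (hFi.sub (integrable_const (F b)))
  have h2 := (integrable_moll_mul hg hω0 hε b (integrable_const (1 : ℝ))).mul_const (F b)
  simp only [mul_one, Pi.sub_apply] at h1 h2
  rw [← integral_mul_const, ← integral_add h1 h2]
  congr 1
  ext a
  ring

lemma enorm_integral_moll_le [NeZero n] (hg : IsBump g L) (hω : 0 < ω) {C : ℝ}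
    (hC : ∀ ε > 0, ∀ b : Dir n,
      (∫⁻ a, ENNReal.ofReal (moll g ω ε a b) ∂(sphereMeasure n) ≤ ENNReal.ofReal C) ∧
      ∫⁻ a, ENNReal.ofReal (moll g ω ε b a) ∂(sphereMeasure n) ≤ ENNReal.ofReal C)
    {ε : ℝ} (hε : 0 < ε) (b : Dir n) {F : Dir n → ℝ} {B : ℝ} (hB : ∀ a, |F a| ≤ B) :
    ‖∫ a, moll g ω ε a b * F a ∂(sphereMeasure n)‖ₑ ≤ ENNReal.ofReal C * ENNReal.ofReal B := by
  refine (enorm_integral_le_lintegral_enorm _).trans ?_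
  calc _ ≤ ∫⁻ a, ENNReal.ofReal (moll g ω ε a b) * ENNReal.ofReal B ∂(sphereMeasure n) := by
        refine lintegral_mono fun a => ?_
        rw [enorm_mul, Real.enorm_of_nonneg (moll_nonneg hg hω hε a b), ← ofReal_norm (F a)]
        gcongr
        exact hB a
    _ = (∫⁻ a, ENNReal.ofReal (moll g ω ε a b) ∂(sphereMeasure n)) * ENNReal.ofReal B :=
        lintegral_mul_const' _ _ ENNReal.ofReal_ne_top
    _ ≤ _ := by gcongr; exact (hC ε hε b).1

/-- Mollification converges in `L¹` of the sphere. -/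
lemma tendsto_moll [NeZero n] (hg : IsBump g L) (hω0 : 0 < ω)
    (hω : IsMollifierConstant g ω) {F : Dir n → ℝ} (hF : Integrable F (sphereMeasure n)) :
    Tendsto (fun ε : ℝ => ∫⁻ b, ‖∫ a, moll g ω ε a b * F a ∂(sphereMeasure n) - F b‖ₑ
      ∂(sphereMeasure n)) (𝓝[>] 0) (𝓝 0) := by
  obtain ⟨C, hC0, hC⟩ := exists_lintegral_moll_le hg hω0
  refine ENNReal.tendsto_nhds_zero.2 fun e he => ?_
  obtain ⟨d, hd0, hd⟩ : ∃ d : ℝ≥0∞, d ≠ 0 ∧ (ENNReal.ofReal C + 2) * d ≤ e := by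
    rcases eq_or_ne e ∞ with rfl | he'
    · exact ⟨1, one_ne_zero, le_top⟩
    · refine ⟨e / (ENNReal.ofReal C + 2), ?_, ENNReal.mul_div_le⟩
      simp [ENNReal.div_eq_zero_iff, he.ne', ENNReal.add_eq_top]
  obtain ⟨G, hG, hGi⟩ := hF.exists_boundedContinuous_lintegral_sub_le hd0
  have hlim : Tendsto (fun ε : ℝ => ∫⁻ b, ‖∫ a, moll g ω ε a b * G a ∂(sphereMeasure n) - G b‖ₑ
      ∂(sphereMeasure n)) (𝓝[>] 0) (𝓝 0) := by
    have hB : ∀ a, |G a| ≤ ‖G‖ := fun a => G.norm_coe_le_norm a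
    have : (0 : ℝ≥0∞) = ∫⁻ _ : Dir n, 0 ∂(sphereMeasure n) := by simp
    rw [this]
    refine tendsto_lintegral_filter_of_dominated_convergence
      (fun _ => ENNReal.ofReal C * ENNReal.ofReal ‖G‖ + ENNReal.ofReal ‖G‖) ?_ ?_ ?_ ?_
    · refine Eventually.of_forall fun ε => ?_
      have h1 : Measurable fun q : Dir n × Dir n => moll g ω ε q.2 q.1 * G q.2 :=
        ((measurable_moll hg ω ε).comp measurable_swap).mul
          (G.continuous.measurable.comp measurable_snd)
      exact (h1.stronglyMeasurable.integral_prod_right'.measurable.sub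
        G.continuous.measurable).enorm
    · filter_upwards [self_mem_nhdsWithin] with ε hε
      refine ae_of_all _ fun b => (enorm_sub_le).trans ?_
      refine add_le_add (enorm_integral_moll_le hg hω0 hC hε b hB) ?_
      rw [← ofReal_norm (G b)]
      exact ENNReal.ofReal_le_ofReal (hB b)
    · rw [lintegral_const, measure_univ, mul_one]
      exact ENNReal.add_ne_top.2 ⟨ENNReal.mul_ne_top ENNReal.ofReal_ne_top ENNReal.ofReal_ne_top,
        ENNReal.ofReal_ne_top⟩
    · refine ae_of_all _ fun b => ?_
      have h1 := (tendsto_moll_continuous hg hω0 hω G.continuous b).sub_const (G b)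
      rw [sub_self] at h1
      have h2 := h1.enorm
      rwa [enorm_zero] at h2
  filter_upwards [(ENNReal.tendsto_nhds_zero.1 hlim) d hd0.bot_lt, self_mem_nhdsWithin] with ε h1 hε
  have hmeasK : Measurable fun q : Dir n × Dir n => ENNReal.ofReal (moll g ω ε q.2 q.1) :=
    ((measurable_moll hg ω ε).comp measurable_swap).ennreal_ofReal
  -- For continuous `G` the convergence is pointwise and dominated. The remainder `F - G` is small
  -- in `L¹`, and so is its mollification, by the marginal in the second variable.
  set R : Dir n → ℝ≥0∞ := fun a => ‖F a - G a‖ₑ with hR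
  have hRm : AEMeasurable R (sphereMeasure n) := (hF.sub hGi).1.enorm
  have hT : ∫⁻ b, (∫⁻ a, ENNReal.ofReal (moll g ω ε a b) * R a ∂(sphereMeasure n))
      ∂(sphereMeasure n) ≤ ENNReal.ofReal C * d := by
    rw [lintegral_lintegral_swap]
    · calc _ = ∫⁻ a, (∫⁻ b, ENNReal.ofReal (moll g ω ε a b) ∂(sphereMeasure n)) * R a
            ∂(sphereMeasure n) := by
            refine lintegral_congr fun a => ?_
            rw [lintegral_mul_const]
            exact (((measurable_moll hg ω ε).of_uncurry_left)).ennreal_ofReal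
        _ ≤ ∫⁻ a, ENNReal.ofReal C * R a ∂(sphereMeasure n) := by
            refine lintegral_mono fun a => ?_
            gcongr
            exact (hC ε hε a).2
        _ = ENNReal.ofReal C * ∫⁻ a, R a ∂(sphereMeasure n) :=
            lintegral_const_mul' _ _ ENNReal.ofReal_ne_top
        _ ≤ _ := by gcongr
    · exact hmeasK.aemeasurable.mul (hRm.comp_quasiMeasurePreserving
        Measure.quasiMeasurePreserving_snd)
  have hpt : ∀ b, ‖∫ a, moll g ω ε a b * F a ∂(sphereMeasure n) - F b‖ₑ ≤
      (∫⁻ a, ENNReal.ofReal (moll g ω ε a b) * R a ∂(sphereMeasure n)) +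
        (‖∫ a, moll g ω ε a b * G a ∂(sphereMeasure n) - G b‖ₑ + R b) := by
    intro b
    have h2 : ∫ a, moll g ω ε a b * F a ∂(sphereMeasure n) - F b =
        ∫ a, moll g ω ε a b * (F a - G a) ∂(sphereMeasure n) +
          ((∫ a, moll g ω ε a b * G a ∂(sphereMeasure n) - G b) - (F b - G b)) := by
      simp_rw [mul_sub]
      rw [integral_sub (integrable_moll_mul hg hω0 hε b hF) (integrable_moll_mul hg hω0 hε b hGi)]
      ring
    rw [h2]
    refine (enorm_add_le _ _).trans (add_le_add ?_ enorm_sub_le)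
    refine (enorm_integral_le_lintegral_enorm _).trans (le_of_eq ?_)
    refine lintegral_congr fun a => ?_
    rw [enorm_mul, Real.enorm_of_nonneg (moll_nonneg hg hω0 hε a b)]
  calc _ ≤ ∫⁻ b, ((∫⁻ a, ENNReal.ofReal (moll g ω ε a b) * R a ∂(sphereMeasure n)) +
        (‖∫ a, moll g ω ε a b * G a ∂(sphereMeasure n) - G b‖ₑ + R b)) ∂(sphereMeasure n) :=
        lintegral_mono hpt
    _ = ∫⁻ b, (∫⁻ a, ENNReal.ofReal (moll g ω ε a b) * R a ∂(sphereMeasure n)) ∂(sphereMeasure n) +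
        (∫⁻ b, ‖∫ a, moll g ω ε a b * G a ∂(sphereMeasure n) - G b‖ₑ ∂(sphereMeasure n) +
          ∫⁻ b, R b ∂(sphereMeasure n)) := by
        have h3 : AEMeasurable (fun b => ∫⁻ a, ENNReal.ofReal (moll g ω ε a b) * R a
            ∂(sphereMeasure n)) (sphereMeasure n) := by
          have h4 : AEMeasurable (fun q : Dir n × Dir n => ENNReal.ofReal (moll g ω ε q.2 q.1) *
              R q.2) ((sphereMeasure n).prod (sphereMeasure n)) :=
            hmeasK.aemeasurable.mul (hRm.comp_quasiMeasurePreserving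
              Measure.quasiMeasurePreserving_snd)
          exact h4.lintegral_prod_right'
        rw [lintegral_add_left' h3, lintegral_add_right' _ hRm]
    _ ≤ ENNReal.ofReal C * d + (d + d) := by gcongr
    _ = (ENNReal.ofReal C + 2) * d := by ring
    _ ≤ e := hd

end RTE

namespace RTE
open ProbabilityTheory
variable {n : ℕ} {Ω : Set (Space n)}

/-! ### Test functions -/

lemma inner_perpDir (θ θ' : Dir n) : ⟪perpDir θ θ', (θ' : Space n)⟫ = 0 := by
  rw [perpDir, real_inner_smul_left, inner_sub_left, real_inner_smul_left,
    real_inner_self_eq_norm_sq, norm_dir]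
  ring

lemma smul_perpDir (θ θ' : Dir n) :
    (θ : Space n) = ⟪(θ : Space n), (θ' : Space n)⟫ • (θ' : Space n) +
      ‖(θ : Space n) - ⟪(θ : Space n), (θ' : Space n)⟫ • (θ' : Space n)‖ • perpDir θ θ' := by
  rw [perpDir]
  set w := (θ : Space n) - ⟪(θ : Space n), (θ' : Space n)⟫ • (θ' : Space n) with hw
  by_cases h : ‖w‖ = 0
  · rw [h, zero_smul, add_zero, ← sub_eq_zero, ← hw]
    exact norm_eq_zero.1 h
  · rw [smul_smul, mul_inv_cancel₀ h, one_smul, hw]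
    abel

/-- For parallel directions `perpDir` is zero, as the inverse of zero is zero, and the identity
still holds. Hence `planeProj_eq` requires no independence. -/
lemma inner_perpDir_self (x : Space n) (θ θ' : Dir n) :
    ⟪x, perpDir θ θ'⟫ * ⟪perpDir θ θ', perpDir θ θ'⟫ = ⟪x, perpDir θ θ'⟫ := by
  rw [perpDir]
  set w := (θ : Space n) - ⟪(θ : Space n), (θ' : Space n)⟫ • (θ' : Space n) with hw
  by_cases h : ‖w‖ = 0
  · simp [h]
  · rw [real_inner_self_eq_norm_sq, norm_smul, norm_inv, norm_norm, inv_mul_cancel₀ h]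
    ring

lemma perpDir_mem_span (θ θ' : Dir n) :
    perpDir θ θ' ∈ Submodule.span ℝ {(θ : Space n), (θ' : Space n)} := by
  have h1 : (θ : Space n) ∈ Submodule.span ℝ {(θ : Space n), (θ' : Space n)} :=
    Submodule.subset_span (by simp)
  have h2 : (θ' : Space n) ∈ Submodule.span ℝ {(θ : Space n), (θ' : Space n)} :=
    Submodule.subset_span (by simp)
  exact Submodule.smul_mem _ _ (Submodule.sub_mem _ h1 (Submodule.smul_mem _ _ h2))

/-- The explicit formula makes the projection measurable in the two directions and continuous in the
point. -/
lemma planeProj_eq (θ θ' : Dir n) (x : Space n) :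
    planeProj θ θ' x = ⟪x, (θ' : Space n)⟫ • (θ' : Space n) +
      ⟪x, perpDir θ θ'⟫ • perpDir θ θ' := by
  rw [planeProj]
  have h2 : (θ' : Space n) ∈ Submodule.span ℝ {(θ : Space n), (θ' : Space n)} :=
    Submodule.subset_span (by simp)
  refine Submodule.eq_starProjection_of_mem_of_inner_eq_zero
    (Submodule.add_mem _ (Submodule.smul_mem _ _ h2)
      (Submodule.smul_mem _ _ (perpDir_mem_span θ θ'))) ?_
  have e0 : ⟪(θ' : Space n), perpDir θ θ'⟫ = 0 := by
    rw [real_inner_comm]; exact inner_perpDir θ θ'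
  have e1 : ⟪x - (⟪x, (θ' : Space n)⟫ • (θ' : Space n) + ⟪x, perpDir θ θ'⟫ • perpDir θ θ'),
      (θ' : Space n)⟫ = 0 := by
    rw [inner_sub_left, inner_add_left, real_inner_smul_left, real_inner_smul_left, inner_perpDir,
      real_inner_self_eq_norm_sq, norm_dir]
    ring
  have e2 : ⟪x - (⟪x, (θ' : Space n)⟫ • (θ' : Space n) + ⟪x, perpDir θ θ'⟫ • perpDir θ θ'),
      perpDir θ θ'⟫ = 0 := by
    rw [inner_sub_left, inner_add_left, real_inner_smul_left, real_inner_smul_left,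
      inner_perpDir_self, e0]
    ring
  intro w hw
  induction hw using Submodule.span_induction with
  | mem v hv =>
    rcases hv with rfl | rfl
    · rw [smul_perpDir θ θ', inner_add_right, real_inner_smul_right, real_inner_smul_right,
        e1, e2]
      ring
    · exact e1
  | zero => exact inner_zero_right _
  | add a b _ _ ha hb => rw [inner_add_right, ha, hb, add_zero]
  | smul c a _ ha => rw [real_inner_smul_right, ha, mul_zero]

lemma measurable_perpDir : Measurable fun q : Dir n × Dir n => perpDir q.1 q.2 := by
  have h : Measurable fun q : Dir n × Dir n =>
      (q.1 : Space n) - ⟪(q.1 : Space n), (q.2 : Space n)⟫ • (q.2 : Space n) := by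
    apply Continuous.measurable
    fun_prop
  exact h.norm.inv.smul h

/-- The test function centred at the entry point of the line through `x` in the direction `θ'`. -/
noncomputable def testAt (Ω : Set (Space n)) (φ : ℝ → ℝ) (h : Space n → ℝ) (γ₁ γ₂ : ℝ)
    (q : (Space n × Dir n × Dir n) × Space n) : ℝ :=
  testFun φ h γ₁ γ₂ (q.2 - ent Ω (q.1.1, q.1.2.2)) q.1.2.1 q.1.2.2

section TestAt
variable {φ : ℝ → ℝ} {h : Space n → ℝ} {γ₁ γ₂ : ℝ}

lemma continuous_testAt (hφ : IsProfile φ) (hh : IsCutoff h) (γ₁ γ₂ : ℝ)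
    (p : Space n × Dir n × Dir n) : Continuous fun y => testAt Ω φ h γ₁ γ₂ (p, y) := by
  have h1 := hφ.smooth.continuous
  have h2 := hh.smooth.continuous
  simp only [testAt, testFun, planeProj_eq]
  fun_prop

lemma measurable_testFun_comp {X : Type*} [MeasurableSpace X] (hφ : Measurable φ)
    (hh : Measurable h) (γ₁ γ₂ : ℝ) {w : X → Space n} {a b : X → Dir n} (hw : Measurable w)
    (ha : Measurable a) (hb : Measurable b) :
    Measurable fun q => testFun φ h γ₁ γ₂ (w q) (a q) (b q) := by
  simp only [testFun, planeProj_eq]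
  have h3' := measurable_perpDir.comp (ha.prodMk hb)
  have h3 : Measurable fun q => perpDir (a q) (b q) := h3'
  have ha' : Measurable fun q => (a q : Space n) := measurable_subtype_coe.comp ha
  have hb' : Measurable fun q => (b q : Space n) := measurable_subtype_coe.comp hb
  have h7 : Measurable fun q => ⟪w q, perpDir (a q) (b q)⟫ := hw.inner h3
  have h8 : Measurable fun q => ⟪(a q : Space n), perpDir (a q) (b q)⟫ := ha'.inner h3
  have h9 : Measurable fun q => ⟪w q, (b q : Space n)⟫ := hw.inner hb'
  have h10 : Measurable fun q => w q - (⟪w q, (b q : Space n)⟫ • (b q : Space n) +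
      ⟪w q, perpDir (a q) (b q)⟫ • perpDir (a q) (b q)) :=
    hw.sub ((h9.smul hb').add (h7.smul h3))
  have h11 := hφ.comp (h7.div (h8.const_mul γ₁))
  have h12 := hh.comp ((measurable_const_smul γ₂⁻¹).comp h10)
  exact (h11.const_mul _).mul h12

lemma measurable_testAt (ho : IsOpen Ω) (hφ : IsProfile φ) (hh : IsCutoff h) (γ₁ γ₂ : ℝ) :
    Measurable (testAt Ω φ h γ₁ γ₂) := by
  have h4 : Measurable fun q : (Space n × Dir n × Dir n) × Space n =>
      q.2 - ent Ω (q.1.1, q.1.2.2) :=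
    measurable_snd.sub ((measurable_ent ho).comp (by fun_prop))
  exact measurable_testFun_comp hφ.smooth.continuous.measurable hh.smooth.continuous.measurable
    γ₁ γ₂ h4 (by fun_prop) (by fun_prop)

lemma testAt_nonneg (hφ : IsProfile φ) (hh : IsCutoff h) (hγ : 0 < γ₁)
    (q : (Space n × Dir n × Dir n) × Space n) : 0 ≤ testAt Ω φ h γ₁ γ₂ q :=
  mul_nonneg (mul_nonneg (by positivity) (hφ.nonneg _)) (hh.nonneg _)

lemma testAt_le (hφ : IsProfile φ) (hh : IsCutoff h) (hγ : 0 < γ₁)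
    (q : (Space n × Dir n × Dir n) × Space n) : testAt Ω φ h γ₁ γ₂ q ≤ 1 / γ₁ := by
  calc _ ≤ 1 / γ₁ * 1 * 1 := mul_le_mul (mul_le_mul_of_nonneg_left (hφ.le_one _) (by positivity))
        (hh.le_one _) (hh.nonneg _) (by positivity)
    _ = _ := by ring

lemma abs_testAt_le (hφ : IsProfile φ) (hh : IsCutoff h) (hγ : 0 < γ₁)
    (q : (Space n × Dir n × Dir n) × Space n) : |testAt Ω φ h γ₁ γ₂ q| ≤ 1 / γ₁ := by
  rw [abs_of_nonneg (testAt_nonneg hφ hh hγ q)]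
  exact testAt_le hφ hh hγ q

end TestAt

/-! ### Convergence in `L¹` -/

/-- The measure `dx dθ dθ'` on `Ω × 𝕊ⁿ⁻¹ × 𝕊ⁿ⁻¹`. -/
noncomputable abbrev tripleOn (Ω : Set (Space n)) : Measure (Space n × Dir n × Dir n) :=
  (volume.restrict Ω).prod ((sphereMeasure n).prod (sphereMeasure n))

lemma tripleOn_eq [NeZero n] (Ω : Set (Space n)) :
    tripleOn Ω = (tripleMeasure n).restrict (Ω ×ˢ univ) := by
  rw [tripleMeasure, ← Measure.prod_restrict, Measure.restrict_univ]

lemma ae_tripleOn_mem [NeZero n] (ho : IsOpen Ω) : ∀ᵐ p ∂(tripleOn Ω), p.1 ∈ Ω :=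
  Measure.quasiMeasurePreserving_fst.ae (ae_restrict_mem ho.measurableSet)

lemma tendstoL1Loc_of [NeZero n] {F : ℝ → Space n × Dir n × Dir n → ℝ}
    {G : Space n × Dir n × Dir n → ℝ}
    (hF : ∀ᶠ t in 𝓝[>] (0 : ℝ), Integrable (F t) (tripleOn Ω)) (hG : Integrable G (tripleOn Ω))
    (hlim : ∀ K : Set (Space n × Dir n × Dir n), K ⊆ nonparallelSet Ω → IsCompact K →
      Tendsto (fun t => ∫⁻ p in K, ‖F t p - G p‖ₑ ∂(tripleOn Ω)) (𝓝[>] 0) (𝓝 0)) :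
    TendstoL1Loc Ω F G := by
  have hsub : nonparallelSet Ω ⊆ Ω ×ˢ univ := fun p hp => ⟨hp.1, mem_univ _⟩
  have hloc : ∀ f : Space n × Dir n × Dir n → ℝ, Integrable f (tripleOn Ω) →
      LocallyIntegrableOn f (nonparallelSet Ω) (tripleMeasure n) := fun f hf => by
    rw [tripleOn_eq] at hf
    exact (IntegrableOn.mono_set hf hsub).locallyIntegrableOn
  refine ⟨hF.mono fun t ht => hloc _ ht, hloc _ hG, fun K hK hKc => ?_⟩
  have hKr : (tripleMeasure n).restrict K = (tripleOn Ω).restrict K := by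
    rw [tripleOn_eq, Measure.restrict_restrict hKc.measurableSet,
      inter_eq_left.2 (hK.trans hsub)]
  have h1 := (ENNReal.tendsto_toReal ENNReal.zero_ne_top).comp (hlim K hK hKc)
  rw [ENNReal.toReal_zero] at h1
  refine h1.congr' ?_
  filter_upwards [hF] with t ht
  rw [hKr]
  exact (integral_norm_eq_lintegral_enorm (f := F t - G) (ht.sub hG).1.restrict).symm

lemma tendstoL1Loc_of_global [NeZero n] {F : ℝ → Space n × Dir n × Dir n → ℝ}
    {G : Space n × Dir n × Dir n → ℝ}
    (hF : ∀ᶠ t in 𝓝[>] (0 : ℝ), Integrable (F t) (tripleOn Ω)) (hG : Integrable G (tripleOn Ω))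
    (hlim : Tendsto (fun t => ∫⁻ p, ‖F t p - G p‖ₑ ∂(tripleOn Ω)) (𝓝[>] 0) (𝓝 0)) :
    TendstoL1Loc Ω F G :=
  tendstoL1Loc_of hF hG fun _ _ _ => tendsto_of_tendsto_of_tendsto_of_le_of_le tendsto_const_nhds
    hlim (fun _ => zero_le) fun _ => setLIntegral_le_lintegral _ _

/-- Bounded pointwise convergence implies convergence in `L¹_loc`. -/
lemma tendstoL1Loc_of_bounded [NeZero n] (hb : Bornology.IsBounded Ω)
    {F : ℝ → Space n × Dir n × Dir n → ℝ}
    {G : Space n × Dir n × Dir n → ℝ} {B : ℝ}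
    (hF : ∀ᶠ t in 𝓝[>] (0 : ℝ), Measurable (F t) ∧ ∀ p, |F t p| ≤ B) (hG : Measurable G)
    (hGB : ∀ p, |G p| ≤ B)
    (hlim : ∀ᵐ p ∂(tripleOn Ω), Tendsto (fun t => F t p) (𝓝[>] 0) (𝓝 (G p))) :
    TendstoL1Loc Ω F G := by
  have hfin := isFiniteMeasure_restrict hb
  have hi : ∀ f : Space n × Dir n × Dir n → ℝ, Measurable f → (∀ p, |f p| ≤ B) →
      Integrable f (tripleOn Ω) := fun f hf hfB =>
    Integrable.of_bound hf.aestronglyMeasurable B (ae_of_all _ hfB)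
  refine tendstoL1Loc_of_global (hF.mono fun t ht => hi _ ht.1 ht.2) (hi _ hG hGB) ?_
  have : (0 : ℝ≥0∞) = ∫⁻ _, 0 ∂(tripleOn Ω) := by simp
  rw [this]
  refine tendsto_lintegral_filter_of_dominated_convergence
    (fun _ => ENNReal.ofReal B + ENNReal.ofReal B) ?_ ?_ ?_ ?_
  · exact hF.mono fun t ht => (ht.1.sub hG).enorm
  · filter_upwards [hF] with t ht
    refine ae_of_all _ fun p => enorm_sub_le.trans (add_le_add ?_ ?_)
    · rw [← ofReal_norm]; exact ENNReal.ofReal_le_ofReal (ht.2 p)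
    · rw [← ofReal_norm]; exact ENNReal.ofReal_le_ofReal (hGB p)
  · rw [lintegral_const]
    exact ENNReal.mul_ne_top (ENNReal.add_ne_top.2 ⟨ENNReal.ofReal_ne_top, ENNReal.ofReal_ne_top⟩)
      (measure_ne_top _ _)
  · filter_upwards [hlim] with p hp
    have h1 := (hp.sub_const (G p)).enorm
    rwa [sub_self, enorm_zero] at h1

/-! ### The response to boundary values with a single incoming direction. -/

namespace Medium
variable (A : Medium Ω)

/-- The source of first collisions, for boundary values concentrated in the direction `θ'` with
profile `Ψ`. -/
noncomputable def firstColl (Ψ : (Space n × Dir n × Dir n) × Space n → ℝ)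
    (q : (Space n × Dir n × Dir n) × (Space n × Dir n)) : ℝ :=
  A.kk (q.2.1, q.1.2.2, q.2.2) * A.bwd (q.2.1, q.1.2.2) * Ψ (q.1, ent Ω (q.2.1, q.1.2.2))

/-- The outgoing values produced by `firstColl`. -/
noncomputable def through (Ψ : (Space n × Dir n × Dir n) × Space n → ℝ)
    (p : Space n × Dir n × Dir n) : ℝ :=
  ∫ z, A.firstColl Ψ (p, z) ∂(A.totalKernel (p.1, p.2.1))

/-- The part of `through` that is scattered only once. -/
noncomputable def throughOnce (Ψ : (Space n × Dir n × Dir n) × Space n → ℝ)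
    (p : Space n × Dir n × Dir n) : ℝ :=
  ∫ z, A.firstColl Ψ (p, z) ∂(A.exitKernel (p.1, p.2.1))

variable {Ψ : (Space n × Dir n × Dir n) × Space n → ℝ}

lemma measurable_firstColl (hΨ : Measurable Ψ) : Measurable (A.firstColl Ψ) := by
  have h1 : Measurable fun q : (Space n × Dir n × Dir n) × (Space n × Dir n) =>
      ent Ω (q.2.1, q.1.2.2) := (measurable_ent A.isOpen).comp (by fun_prop)
  exact ((A.kk_meas.comp (by fun_prop)).mul (A.measurable_bwd.comp (by fun_prop))).mul
    (hΨ.comp (measurable_fst.prodMk h1))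

/-- A bound for `Ψ` on the frontier suffices because entry points lie there. This matters for
`smear`, which is estimated only at frontier points. -/
lemma abs_firstColl_le (p : Space n × Dir n × Dir n) {B : ℝ} (hB0 : 0 ≤ B)
    (hB : ∀ y ∈ frontier Ω, |Ψ (p, y)| ≤ B) (z : Space n × Dir n) :
    |A.firstColl Ψ (p, z)| ≤ A.Ck * B := by
  by_cases hz : z.1 ∈ Ω
  · rw [firstColl, abs_mul, abs_mul, abs_of_nonneg (A.kk_nonneg _), abs_of_nonneg (A.bwd_nonneg _)]
    have h1 : A.kk (z.1, p.2.2, z.2) * A.bwd (z.1, p.2.2) ≤ A.Ck * 1 :=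
      mul_le_mul (A.kk_le _) (A.bwd_le_one _) (A.bwd_nonneg _) A.Ck_nonneg
    rw [mul_one] at h1
    exact mul_le_mul h1 (hB _ (A.ent_mem_frontier (p := (z.1, p.2.2)) hz)) (abs_nonneg _)
      A.Ck_nonneg
  · rw [firstColl, A.kk_zero _ hz]
    simpa using mul_nonneg A.Ck_nonneg hB0

lemma measurable_through [NeZero n] (hΨ : Measurable Ψ) : Measurable (A.through Ψ) := by
  have hm : Measurable fun p : Space n × Dir n × Dir n => (p.1, p.2.1) := by fun_prop
  have h : StronglyMeasurable (Function.uncurry fun (p : Space n × Dir n × Dir n)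
    (z : Space n × Dir n) => A.firstColl Ψ (p, z)) := (A.measurable_firstColl hΨ).stronglyMeasurable
  exact (StronglyMeasurable.integral_kernel_prod_right (κ := A.totalKernel.comap _ hm) h).measurable

lemma abs_through_le [NeZero n] (p : Space n × Dir n × Dir n) {B : ℝ} (hB0 : 0 ≤ B)
    (hB : ∀ y ∈ frontier Ω, |Ψ (p, y)| ≤ B) : |A.through Ψ p| ≤ A.Ck * B * A.bound.toReal := by
  refine (norm_integral_le_of_norm_le_const (f := fun z => A.firstColl Ψ (p, z)) (C := A.Ck * B)
    (ae_of_all _ fun z => A.abs_firstColl_le p hB0 hB z)).trans ?_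
  exact mul_le_mul_of_nonneg_left (ENNReal.toReal_mono A.bound_ne_top (A.totalKernel_univ_le _))
    (mul_nonneg A.Ck_nonneg hB0)

/-- Dominated convergence for `through`. -/
lemma tendsto_through [NeZero n] (p : Space n × Dir n × Dir n)
    {Ψt : ℝ → (Space n × Dir n × Dir n) × Space n → ℝ} {B : ℝ} (hB0 : 0 ≤ B)
    (hΨt : ∀ᶠ t in 𝓝[>] (0 : ℝ), Measurable (Ψt t) ∧ ∀ y ∈ frontier Ω, |Ψt t (p, y)| ≤ B)
    (hlim : ∀ y ∈ frontier Ω, Tendsto (fun t => Ψt t (p, y)) (𝓝[>] 0) (𝓝 (Ψ (p, y)))) :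
    Tendsto (fun t => A.through (Ψt t) p) (𝓝[>] 0) (𝓝 (A.through Ψ p)) := by
  refine tendsto_integral_filter_of_dominated_convergence (fun _ => A.Ck * B) ?_ ?_
    (integrable_const _) ?_
  · filter_upwards [hΨt] with t ht
    exact ((A.measurable_firstColl ht.1).comp measurable_prodMk_left).aestronglyMeasurable
  · filter_upwards [hΨt] with t ht
    exact ae_of_all _ fun z => A.abs_firstColl_le p hB0 ht.2 z
  · refine ae_of_all _ fun z => ?_
    by_cases hz : z.1 ∈ Ω
    · exact (hlim _ (A.ent_mem_frontier (p := (z.1, p.2.2)) hz)).const_mul _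
    · simp only [firstColl, A.kk_zero _ (show (z.1, p.2.2, z.2).1 ∉ Ω from hz), zero_mul]
      exact tendsto_const_nhds

end Medium
end RTE

/-! ### The limits in `ε'`, `γ₂` and `γ₁`. -/

namespace RTE
open ProbabilityTheory
variable {n : ℕ} {Ω : Set (Space n)}

/-- Translation is continuous in `L¹`. -/
lemma tendsto_translate {f : Space n → ℝ} (hf : Integrable f) :
    Tendsto (fun v : Space n => ∫⁻ x, ‖f (v + x) - f x‖ₑ) (𝓝 0) (𝓝 0) := by
  have hF := memLp_one_iff_integrable.2 hf
  have : Fact ((1 : ℝ≥0∞) ≠ ∞) := ⟨ENNReal.one_ne_top⟩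
  have hc : Continuous fun v : Space n => DomAddAct.mk v +ᵥ hF.toLp f := by
    have h1 : Continuous fun v : Space n => DomAddAct.mk v := DomAddAct.continuous_mk
    exact h1.vadd continuous_const
  have h2 := (hc.edist (continuous_const (y := hF.toLp f))).tendsto (0 : Space n)
  have h3 : ∀ v : Space n, edist (DomAddAct.mk v +ᵥ hF.toLp f) (hF.toLp f) =
      ∫⁻ x, ‖f (v + x) - f x‖ₑ := fun v => by
    rw [DomAddAct.mk_vadd_toLp, Lp.edist_toLp_toLp, eLpNorm_one_eq_lintegral_enorm]
    rfl
  simp only [h3] at h2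
  simpa using h2

section Smear
variable {h : Space n → ℝ} {L : NNReal} {c : ℝ}
  {Ψ : (Space n × Dir n × Dir n) × Space n → ℝ}

/-- Mollification of `Ψ` along the boundary. -/
noncomputable def smear (Ω : Set (Space n)) (h : Space n → ℝ) (c ε : ℝ)
    (Ψ : (Space n × Dir n × Dir n) × Space n → ℝ)
    (q : (Space n × Dir n × Dir n) × Space n) : ℝ :=
  ∫ x, 1 / (c * ε ^ (n - 1)) * h (ε⁻¹ • (q.2 - x)) * Ψ (q.1, x) ∂(boundaryMeasure Ω)

lemma measurable_smear [IsFiniteMeasure (boundaryMeasure Ω)] (hh : IsBump h L) (c ε : ℝ)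
    (hΨ : Measurable Ψ) : Measurable (smear Ω h c ε Ψ) := by
  have h0 : Measurable fun w : ((Space n × Dir n × Dir n) × Space n) × Space n =>
      ε⁻¹ • (w.1.2 - w.2) := by fun_prop
  have h1 : Measurable fun w : ((Space n × Dir n × Dir n) × Space n) × Space n =>
      Ψ (w.1.1, w.2) := hΨ.comp (by fun_prop)
  have h2 := ((hh.lip.continuous.measurable.comp h0).const_mul (1 / (c * ε ^ (n - 1)))).mul h1
  exact (StronglyMeasurable.integral_prod_right' (ν := boundaryMeasure Ω)
    h2.stronglyMeasurable).measurable

/-- The bump lives in a ball about a frontier point, of surface measure `O(ε ^ (n - 1))`. The bound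
is uniform in `ε`, as dominated convergence requires. -/
lemma HasC1Boundary.exists_smear_le (ho : IsOpen Ω) (hb : Bornology.IsBounded Ω)
    (hC : HasC1Boundary Ω) (hh : IsBump h L) (hc : 0 < c) :
    ∃ C : ℝ, 0 ≤ C ∧ ∀ᶠ ε in 𝓝[>] (0 : ℝ), ∀ (Ψ : (Space n × Dir n × Dir n) × Space n → ℝ)
      (p : Space n × Dir n × Dir n) (B : ℝ), 0 ≤ B → (∀ x, |Ψ (p, x)| ≤ B) →
        ∀ y ∈ frontier Ω, |smear Ω h c ε Ψ (p, y)| ≤ C * B := by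
  have hfin := hC.isFiniteMeasure ho hb
  obtain ⟨C, hC0, r₀, hr₀, H⟩ := hC.exists_ahlfors ho hb
  refine ⟨c⁻¹ * C, by positivity, ?_⟩
  filter_upwards [Ioo_mem_nhdsGT hr₀] with ε hε Ψ p B hB0 hB y hy
  have hε0 := hε.1
  have hμ : (boundaryMeasure Ω).real (Metric.ball y ε) ≤ C * ε ^ (n - 1) :=
    ENNReal.toReal_le_of_le_ofReal (by positivity) (H y hy ε hε.1 hε.2)
  have hi : Integrable ((Metric.ball y ε).indicator fun _ => 1 / (c * ε ^ (n - 1)) * B)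
      (boundaryMeasure Ω) := (integrable_const _).indicator measurableSet_ball
  calc |smear Ω h c ε Ψ (p, y)| ≤
        ∫ x, (Metric.ball y ε).indicator (fun _ => 1 / (c * ε ^ (n - 1)) * B) x
          ∂(boundaryMeasure Ω) := by
        rw [← Real.norm_eq_abs, smear]
        refine norm_integral_le_of_norm_le hi (ae_of_all _ fun x => ?_)
        rw [norm_mul, norm_mul, Real.norm_of_nonneg (by positivity : 0 ≤ 1 / (c * ε ^ (n - 1))),
          Real.norm_of_nonneg (hh.nonneg _)]
        by_cases hx : x ∈ Metric.ball y ε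
        · rw [indicator_of_mem hx]
          have h1 : 1 / (c * ε ^ (n - 1)) * h (ε⁻¹ • (y - x)) ≤ 1 / (c * ε ^ (n - 1)) :=
            mul_le_of_le_one_right (by positivity) (hh.le_one _)
          exact mul_le_mul h1 (hB x) (norm_nonneg _) (by positivity)
        · rw [indicator_of_notMem hx, hh.zero]
          · simp
          · rw [Metric.mem_ball, not_lt, dist_comm, dist_eq_norm] at hx
            rwa [norm_smul, norm_inv, Real.norm_of_nonneg hε0.le, le_inv_mul_iff₀ hε0, mul_one]
    _ = (boundaryMeasure Ω).real (Metric.ball y ε) * (1 / (c * ε ^ (n - 1)) * B) := by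
        rw [integral_indicator_const _ measurableSet_ball, smul_eq_mul]
    _ ≤ C * ε ^ (n - 1) * (1 / (c * ε ^ (n - 1)) * B) := by gcongr
    _ = _ := by field_simp

lemma HasC1Boundary.tendsto_smear (ho : IsOpen Ω) (hb : Bornology.IsBounded Ω)
    (hC : HasC1Boundary Ω) (hh : IsBump h L) (hc : 0 < c)
    (hcT : ∀ ν : Space n, ‖ν‖ = 1 → ∫ t : tangent ν, h t = c)
    {p : Space n × Dir n × Dir n} (hΨ : Continuous fun y => Ψ (p, y)) {y : Space n}
    (hy : y ∈ frontier Ω) :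
    Tendsto (fun ε => smear Ω h c ε Ψ (p, y)) (𝓝[>] 0) (𝓝 (Ψ (p, y))) := by
  have h1 := (hC.tendsto_blowup ho hb hy hh hcT hΨ).const_mul c⁻¹
  rw [← mul_assoc, inv_mul_cancel₀ hc.ne', one_mul] at h1
  refine h1.congr fun ε => ?_
  rw [smear, ← integral_const_mul]
  congr 1
  ext x
  rw [one_div, one_div, mul_inv]
  ring

end Smear

namespace Medium
variable (A : Medium Ω) {h : Space n → ℝ} {L : NNReal} {c : ℝ} {φ : ℝ → ℝ}

/-- The limit of concentrating the source on the boundary. -/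
theorem tendstoL1Loc_smear [NeZero n] (hC : HasC1Boundary Ω) (hh : IsBump h L) (hc : 0 < c)
    (hcT : ∀ ν : Space n, ‖ν‖ = 1 → ∫ t : tangent ν, h t = c)
    {Ψ : (Space n × Dir n × Dir n) × Space n → ℝ} (hΨ : Measurable Ψ)
    (hΨc : ∀ p, Continuous fun y => Ψ (p, y)) {B : ℝ} (hB0 : 0 ≤ B) (hB : ∀ q, |Ψ q| ≤ B) :
    TendstoL1Loc Ω (fun ε => A.through (smear Ω h c ε Ψ)) (A.through Ψ) := by
  have hfin := hC.isFiniteMeasure A.isOpen A.bounded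
  obtain ⟨C, hC0, H⟩ := hC.exists_smear_le A.isOpen A.bounded hh hc
  set D := max (C * B) B with hD
  have hD0 : 0 ≤ D := hB0.trans (le_max_right _ _)
  refine tendstoL1Loc_of_bounded A.bounded (B := A.Ck * D * A.bound.toReal) ?_
    (A.measurable_through hΨ)
    (fun p => A.abs_through_le p hD0 fun y _ => (hB _).trans (le_max_right _ _))
    (ae_of_all _ fun p => ?_)
  · filter_upwards [H] with ε hε
    exact ⟨A.measurable_through (measurable_smear hh c ε hΨ), fun p => A.abs_through_le p hD0
      fun y hy => (hε Ψ p B hB0 (fun x => hB _) y hy).trans (le_max_left _ _)⟩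
  · refine A.tendsto_through p hD0 ?_ fun y hy =>
      hC.tendsto_smear A.isOpen A.bounded hh hc hcT (hΨc p) hy
    filter_upwards [H] with ε hε
    exact ⟨measurable_smear hh c ε hΨ, fun y hy =>
      (hε Ψ p B hB0 (fun x => hB _) y hy).trans (le_max_left _ _)⟩

lemma measurable_throughOnce {Ψ : (Space n × Dir n × Dir n) × Space n → ℝ} (hΨ : Measurable Ψ) :
    Measurable (A.throughOnce Ψ) := by
  have hm : Measurable fun p : Space n × Dir n × Dir n => (p.1, p.2.1) := by fun_prop
  have h : StronglyMeasurable (Function.uncurry fun (p : Space n × Dir n × Dir n)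
    (z : Space n × Dir n) => A.firstColl Ψ (p, z)) := (A.measurable_firstColl hΨ).stronglyMeasurable
  exact (StronglyMeasurable.integral_kernel_prod_right (κ := A.exitKernel.comap _ hm) h).measurable

lemma abs_throughOnce_le {Ψ : (Space n × Dir n × Dir n) × Space n → ℝ}
    (p : Space n × Dir n × Dir n) {B : ℝ} (hB0 : 0 ≤ B)
    (hB : ∀ y ∈ frontier Ω, |Ψ (p, y)| ≤ B) : |A.throughOnce Ψ p| ≤ A.Ck * B * A.M := by
  refine (norm_integral_le_of_norm_le_const (f := fun z => A.firstColl Ψ (p, z)) (C := A.Ck * B)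
    (ae_of_all _ fun z => A.abs_firstColl_le p hB0 hB z)).trans ?_
  refine mul_le_mul_of_nonneg_left ?_ (mul_nonneg A.Ck_nonneg hB0)
  exact ENNReal.toReal_le_of_le_ofReal A.M_nonneg (A.exitKernel_univ_le _)

/-- Passing to entry points moves along `θ'`, which belongs to the plane. The transversal cut-off,
though evaluated on the boundary, therefore detects whether the collision point lies in the plane
through `x`. -/
lemma ent_sub_ent_mem_span_iff (x y : Space n) (θ θ' : Dir n) :
    ent Ω (y, θ') - ent Ω (x, θ') ∈ Submodule.span ℝ {(θ : Space n), (θ' : Space n)} ↔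
      y - x ∈ Submodule.span ℝ {(θ : Space n), (θ' : Space n)} := by
  have h2 : (θ' : Space n) ∈ Submodule.span ℝ {(θ : Space n), (θ' : Space n)} :=
    Submodule.subset_span (by simp)
  have h3 : ent Ω (y, θ') - ent Ω (x, θ') =
      (y - x) + (lenMinus Ω (x, θ') - lenMinus Ω (y, θ')) • (θ' : Space n) := by
    simp only [ent, sub_smul]
    abel
  rw [h3]
  exact Submodule.add_mem_iff_left _ (Submodule.smul_mem _ _ h2)

lemma sub_planeProj_eq_zero_iff (θ θ' : Dir n) (x : Space n) :
    x - planeProj θ θ' x = 0 ↔ x ∈ Submodule.span ℝ {(θ : Space n), (θ' : Space n)} := by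
  rw [sub_eq_zero, eq_comm, planeProj]
  exact Submodule.starProjection_eq_self_iff

/-- On the plane through the line, the transversal cut-off of the test function is inactive. -/
lemma throughOnce_testAt_eq (hφ : IsProfile φ) (hh : IsCutoff h) (γ₁ γ₂ : ℝ)
    (p : Space n × Dir n × Dir n) :
    A.throughOnce (testAt Ω φ h γ₁ γ₂) p = ∫ t : ℝ, A.exitDensity ((p.1, p.2.1), t) *
      (A.kk (p.1 + t • (p.2.1 : Space n), p.2.2, p.2.1) *
        A.bwd (p.1 + t • (p.2.1 : Space n), p.2.2) *
        (1 / γ₁ * φ (t * ⟪(p.2.1 : Space n), perpDir p.2.1 p.2.2⟫ /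
          (γ₁ * ⟪(p.2.1 : Space n), perpDir p.2.1 p.2.2⟫)))) := by
  rw [throughOnce, exitKernel, integral_weightedKernel A.exitDensity_nonneg]
  swap
  · exact (A.measurable_firstColl (measurable_testAt A.isOpen hφ hh γ₁ γ₂)).comp
      measurable_prodMk_left
  congr 1
  ext t
  have hspan : p.1 + t • (p.2.1 : Space n) - p.1 ∈
      Submodule.span ℝ {(p.2.1 : Space n), (p.2.2 : Space n)} := by
    rw [add_sub_cancel_left]
    exact Submodule.smul_mem _ _ (Submodule.subset_span (by simp))
  have h1 := (sub_planeProj_eq_zero_iff p.2.1 p.2.2 _).2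
    ((ent_sub_ent_mem_span_iff (Ω := Ω) p.1 (p.1 + t • (p.2.1 : Space n)) p.2.1 p.2.2).2 hspan)
  have h2 : ⟪ent Ω (p.1 + t • (p.2.1 : Space n), p.2.2) - ent Ω (p.1, p.2.2),
      perpDir p.2.1 p.2.2⟫ = t * ⟪(p.2.1 : Space n), perpDir p.2.1 p.2.2⟫ := by
    have h3 : ent Ω (p.1 + t • (p.2.1 : Space n), p.2.2) - ent Ω (p.1, p.2.2) =
        t • (p.2.1 : Space n) + (lenMinus Ω (p.1, p.2.2) -
          lenMinus Ω (p.1 + t • (p.2.1 : Space n), p.2.2)) • (p.2.2 : Space n) := by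
      simp only [ent, sub_smul]
      abel
    rw [h3, inner_add_left, real_inner_smul_left, real_inner_smul_left,
      real_inner_comm _ (p.2.2 : Space n), inner_perpDir, mul_zero, add_zero]
  simp only [firstColl, testAt, testFun]
  rw [h1, h2, smul_zero, hh.eq_one.self_of_nhds, mul_one]

/-- The limit of thin test functions: only single scattering survives. -/
theorem tendstoL1Loc_thin [NeZero n] (hn : 3 ≤ n) (hφ : IsProfile φ) (hh : IsCutoff h) {γ₁ : ℝ}
    (hγ : 0 < γ₁) :
    TendstoL1Loc Ω (fun γ₂ => A.through (testAt Ω φ h γ₁ γ₂))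
      (A.throughOnce (testAt Ω φ h γ₁ 1)) := by
  obtain ⟨L, hL⟩ := hh.exists_isBump
  have hB0 : 0 ≤ 1 / γ₁ := by positivity
  have hmeas : ∀ γ₂ : ℝ, Measurable (testAt Ω φ h γ₁ γ₂) := measurable_testAt A.isOpen hφ hh γ₁
  refine tendstoL1Loc_of_bounded A.bounded
    (B := max (A.Ck * (1 / γ₁) * A.bound.toReal) (A.Ck * (1 / γ₁) * A.M))
    (Eventually.of_forall fun γ₂ => ⟨A.measurable_through (hmeas γ₂), fun p =>
      (A.abs_through_le p hB0 fun y _ => abs_testAt_le hφ hh hγ _).trans (le_max_left _ _)⟩)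
    (A.measurable_throughOnce (hmeas 1))
    (fun p => (A.abs_throughOnce_le p hB0 fun y _ => abs_testAt_le hφ hh hγ _).trans
      (le_max_right _ _)) (ae_of_all _ fun p => ?_)
  set V := Submodule.span ℝ {(p.2.1 : Space n), (p.2.2 : Space n)} with hV
  have e1 : A.totalKernel (p.1, p.2.1) =
      A.exitKernel (p.1, p.2.1) + (A.collKernel ∘ₖ A.totalKernel) (p.1, p.2.1) := by
    conv_lhs => rw [A.totalKernel_eq]
    rfl
  -- This part of the kernel consists of the paths with at least two collisions; the first collision
  -- in time is then almost surely off the plane through `x`.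
  have hae : ∀ᵐ z ∂((A.collKernel ∘ₖ A.totalKernel) (p.1, p.2.1)), z.1 - p.1 ∉ V := by
    have hm0 : IsClosed {y : Space n | y - p.1 ∈ V} :=
      V.closed_of_finiteDimensional.preimage (by fun_prop : Continuous fun y : Space n => y - p.1)
    exact Kernel.ae_comp_of_ae_ae (p := fun z : Space n × Dir n => z.1 - p.1 ∉ V)
      (hm0.measurableSet.compl.preimage measurable_fst)
      (ae_of_all _ fun z => A.collKernel_plane (span_pair_ne_top hn _ _) p.1 z)
  have hi : ∀ (γ₂ : ℝ) (κ : Measure (Space n × Dir n)) [IsFiniteMeasure κ],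
      Integrable (fun z => A.firstColl (testAt Ω φ h γ₁ γ₂) (p, z)) κ := fun γ₂ κ _ =>
    Integrable.of_bound ((A.measurable_firstColl (hmeas γ₂)).comp
      measurable_prodMk_left).aestronglyMeasurable (A.Ck * (1 / γ₁))
      (ae_of_all _ fun z => A.abs_firstColl_le p hB0 (fun y _ => abs_testAt_le hφ hh hγ _) z)
  have hsplit : ∀ γ₂ : ℝ, A.through (testAt Ω φ h γ₁ γ₂) p =
      A.throughOnce (testAt Ω φ h γ₁ 1) p + ∫ z, A.firstColl (testAt Ω φ h γ₁ γ₂) (p, z)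
        ∂((A.collKernel ∘ₖ A.totalKernel) (p.1, p.2.1)) := fun γ₂ => by
    rw [through, e1, integral_add_measure (hi γ₂ _) (hi γ₂ _), A.throughOnce_testAt_eq hφ hh γ₁ 1,
      ← A.throughOnce_testAt_eq hφ hh γ₁ γ₂]
    rfl
  simp_rw [hsplit]
  have hlim : Tendsto (fun γ₂ => ∫ z, A.firstColl (testAt Ω φ h γ₁ γ₂) (p, z)
      ∂((A.collKernel ∘ₖ A.totalKernel) (p.1, p.2.1))) (𝓝[>] 0) (𝓝 0) := by
    suffices H : Tendsto (fun γ₂ => ∫ z, A.firstColl (testAt Ω φ h γ₁ γ₂) (p, z)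
        ∂((A.collKernel ∘ₖ A.totalKernel) (p.1, p.2.1))) (𝓝[>] 0)
        (𝓝 (∫ _, (0 : ℝ) ∂((A.collKernel ∘ₖ A.totalKernel) (p.1, p.2.1)))) by simpa using H
    refine tendsto_integral_filter_of_dominated_convergence (fun _ => A.Ck * (1 / γ₁))
      (Eventually.of_forall fun γ₂ => (hi γ₂ _).1)
      (Eventually.of_forall fun γ₂ => ae_of_all _ fun z =>
        A.abs_firstColl_le p hB0 (fun y _ => abs_testAt_le hφ hh hγ _) z) (integrable_const _) ?_
    filter_upwards [hae] with z hz
    refine tendsto_const_nhds.congr' ?_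
    have hw := mt (sub_planeProj_eq_zero_iff p.2.1 p.2.2 _).1
      (mt (ent_sub_ent_mem_span_iff (Ω := Ω) p.1 z.1 p.2.1 p.2.2).1 hz)
    set w := ent Ω (z.1, p.2.2) - ent Ω (p.1, p.2.2) with hwdef
    filter_upwards [Ioo_mem_nhdsGT (norm_pos_iff.2 hw)] with γ₂ hγ₂
    have h1 : h (γ₂⁻¹ • (w - planeProj p.2.1 p.2.2 w)) = 0 := by
      refine hL.zero _ ?_
      rw [norm_smul, norm_inv, Real.norm_of_nonneg hγ₂.1.le, le_inv_mul_iff₀ hγ₂.1, mul_one]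
      exact hγ₂.2.le
    simp only [firstColl, testAt, testFun, ← hwdef]
    rw [h1]
    ring
  simpa using hlim.const_add (A.throughOnce (testAt Ω φ h γ₁ 1) p)

/-- The limiting single scattering amplitude. -/
noncomputable def amplitude (p : Space n × Dir n × Dir n) : ℝ :=
  A.fwd (p.1, p.2.1) * A.bwd (p.1, p.2.2) * A.kk (p.1, p.2.2, p.2.1)

lemma measurable_amplitude : Measurable A.amplitude :=
  ((A.measurable_fwd.comp (by fun_prop)).mul (A.measurable_bwd.comp (by fun_prop))).mul
    (A.kk_meas.comp (by fun_prop))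

/-- The amplitude inherits from `kk` that it vanishes off `Ω`, so it is integrable in `x` over the
whole space; continuity of translations in `L¹` is applied to this extension. -/
lemma abs_amplitude_le (p : Space n × Dir n × Dir n) :
    |A.amplitude p| ≤ (Ω.indicator fun _ => A.Ck) p.1 := by
  by_cases hp : p.1 ∈ Ω
  · rw [indicator_of_mem hp, amplitude, abs_mul, abs_mul, abs_of_nonneg (A.fwd_nonneg _),
      abs_of_nonneg (A.bwd_nonneg _), abs_of_nonneg (A.kk_nonneg _)]
    calc _ ≤ 1 * 1 * A.Ck := mul_le_mul (mul_le_mul (A.fwd_le_one _) (A.bwd_le_one _)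
          (A.bwd_nonneg _) zero_le_one) (A.kk_le _) (A.kk_nonneg _) (by norm_num)
      _ = _ := by ring
  · rw [indicator_of_notMem hp, amplitude, A.kk_zero (p.1, p.2.2, p.2.1) hp]
    simp

/-- For non-parallel directions the factor `θ · θ'_⊥` cancels and the test function reduces to `φ(t
/ γ₁) / γ₁`, with `t` the distance of the collision from `x` along the chord. The substitution `t =
γ₁ s` does the rest. -/
lemma throughOnce_eq_amplitude (hφ : IsProfile φ) (hh : IsCutoff h) {γ₁ : ℝ} (hγ : 0 < γ₁)
    {p : Space n × Dir n × Dir n} (hp : p ∈ nonparallelSet Ω) :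
    A.throughOnce (testAt Ω φ h γ₁ 1) p =
      ∫ s : ℝ, φ s * A.amplitude (p.1 + (γ₁ * s) • (p.2.1 : Space n), p.2) := by
  have hperp : ⟪(p.2.1 : Space n), perpDir p.2.1 p.2.2⟫ ≠ 0 := by
    intro h0
    rw [perpDir, real_inner_smul_right] at h0
    set w := (p.2.1 : Space n) - ⟪(p.2.1 : Space n), (p.2.2 : Space n)⟫ • (p.2.2 : Space n) with hw
    have h1 : ⟪(p.2.1 : Space n), w⟫ = ‖w‖ ^ 2 := by
      have h2 : ⟪(p.2.2 : Space n), w⟫ = 0 := by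
        rw [hw, inner_sub_right, real_inner_smul_right, real_inner_self_eq_norm_sq, norm_dir,
          real_inner_comm]
        ring
      have h3 : (p.2.1 : Space n) =
          w + ⟪(p.2.1 : Space n), (p.2.2 : Space n)⟫ • (p.2.2 : Space n) := by
        rw [hw]; abel
      conv_lhs => rw [h3]
      rw [inner_add_left, real_inner_smul_left, h2, real_inner_self_eq_norm_sq]
      ring
    have hw0 : w ≠ 0 := by
      intro hw0
      have h2 := LinearIndependent.pair_iff.1 hp.2 1 (-⟪(p.2.1 : Space n), (p.2.2 : Space n)⟫)
        (by rw [one_smul, neg_smul, ← sub_eq_add_neg, ← hw, hw0])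
      exact one_ne_zero h2.1
    rw [h1] at h0
    have : 0 < ‖w‖ := norm_pos_iff.2 hw0
    exact absurd h0 (by positivity)
  rw [A.throughOnce_testAt_eq hφ hh]
  have h1 : ∀ t : ℝ, A.exitDensity ((p.1, p.2.1), t) *
      (A.kk (p.1 + t • (p.2.1 : Space n), p.2.2, p.2.1) *
        A.bwd (p.1 + t • (p.2.1 : Space n), p.2.2) *
        (1 / γ₁ * φ (t * ⟪(p.2.1 : Space n), perpDir p.2.1 p.2.2⟫ /
          (γ₁ * ⟪(p.2.1 : Space n), perpDir p.2.1 p.2.2⟫)))) =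
      γ₁⁻¹ * (fun s => φ s * A.amplitude (p.1 + (γ₁ * s) • (p.2.1 : Space n), p.2)) (γ₁⁻¹ * t) := by
    intro t
    rw [mul_div_mul_right _ _ hperp]
    simp only
    rw [← mul_assoc γ₁, mul_inv_cancel₀ hγ.ne', one_mul, amplitude, exitDensity, ind_mem hp.1,
      one_mul, one_div, div_eq_inv_mul]
    by_cases ht : p.1 + t • (p.2.1 : Space n) ∈ Ω
    · rw [ind_mem ht]
      ring
    · rw [A.kk_zero (p.1 + t • (p.2.1 : Space n), p.2.2, p.2.1) ht]
      ring
  simp_rw [h1]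
  have h2 := Measure.integral_comp_mul_left
    (fun s => φ s * A.amplitude (p.1 + (γ₁ * s) • (p.2.1 : Space n), p.2)) γ₁⁻¹
  rw [integral_const_mul, h2, inv_inv, abs_of_pos hγ, smul_eq_mul,
    ← mul_assoc, inv_mul_cancel₀ hγ.ne', one_mul]

/-- The limit of short test functions. -/
theorem tendstoL1Loc_short [NeZero n] (hφ : IsProfile φ) (hh : IsCutoff h) :
    TendstoL1Loc Ω (fun γ₁ => A.throughOnce (testAt Ω φ h γ₁ 1)) A.amplitude := by
  have hfin := isFiniteMeasure_restrict A.bounded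
  have hmeas : ∀ γ₁ : ℝ, Measurable (testAt Ω φ h γ₁ 1) := fun γ₁ =>
    measurable_testAt A.isOpen hφ hh γ₁ 1
  have hampB : ∀ p, |A.amplitude p| ≤ A.Ck := fun p => (A.abs_amplitude_le p).trans
    (indicator_le_self' (fun _ _ => A.Ck_nonneg) _)
  have hφi : Integrable φ := hφ.smooth.continuous.integrable_of_hasCompactSupport hφ.compact
  have hφm := hφ.smooth.continuous.measurable
  refine tendstoL1Loc_of ?_ (Integrable.of_bound A.measurable_amplitude.aestronglyMeasurable A.Ck
    (ae_of_all _ hampB)) ?_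
  · filter_upwards [self_mem_nhdsWithin] with γ₁ hγ
    have hγ' : (0 : ℝ) < γ₁ := hγ
    exact Integrable.of_bound (A.measurable_throughOnce (hmeas γ₁)).aestronglyMeasurable _
      (ae_of_all _ fun p => A.abs_throughOnce_le p (by positivity : 0 ≤ 1 / γ₁)
        fun y _ => abs_testAt_le hφ hh hγ' _)
  intro K hK hKc
  -- the increments of the amplitude
  set I : ℝ → (Dir n × Dir n) → ℝ → ℝ≥0∞ := fun γ w s =>
    ∫⁻ x, ‖A.amplitude ((γ * s) • (w.1 : Space n) + x, w) - A.amplitude (x, w)‖ₑ with hI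
  have hIm : ∀ γ, Measurable fun q : (Dir n × Dir n) × ℝ => I γ q.1 q.2 := fun γ => by
    have h1 : Measurable fun q : ((Dir n × Dir n) × ℝ) × Space n =>
        A.amplitude ((γ * q.1.2) • (q.1.1.1 : Space n) + q.2, q.1.1) :=
      A.measurable_amplitude.comp (by fun_prop)
    have h2 : Measurable fun q : ((Dir n × Dir n) × ℝ) × Space n =>
        A.amplitude (q.2, q.1.1) := A.measurable_amplitude.comp (by fun_prop)
    exact (h1.sub h2).enorm.lintegral_prod_right'
  have hampi : ∀ w : Dir n × Dir n, Integrable fun x => A.amplitude (x, w) := fun w => by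
    have h1 : Integrable (Ω.indicator fun _ => A.Ck) (volume : Measure (Space n)) :=
      (integrable_indicator_iff A.isOpen.measurableSet).2
        (integrableOn_const A.bounded.measure_lt_top.ne)
    exact h1.mono' (A.measurable_amplitude.comp (by fun_prop)).aestronglyMeasurable
      (ae_of_all _ fun x => A.abs_amplitude_le (x, w))
  have hIle : ∀ γ w s, I γ w s ≤ 2 * ENNReal.ofReal (A.Ck * volume.real Ω) := fun γ w s => by
    have h0 : ∫⁻ x, ‖A.amplitude (x, w)‖ₑ ≤ ENNReal.ofReal (A.Ck * volume.real Ω) := by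
      calc _ ≤ ∫⁻ x, Ω.indicator (fun _ => ENNReal.ofReal A.Ck) x := by
            refine lintegral_mono fun x => ?_
            rw [← ofReal_norm]
            refine (ENNReal.ofReal_le_ofReal (A.abs_amplitude_le (x, w))).trans (le_of_eq ?_)
            by_cases hx : x ∈ Ω <;> simp [hx]
        _ = _ := by
            rw [lintegral_indicator_const A.isOpen.measurableSet, ENNReal.ofReal_mul A.Ck_nonneg,
              ofReal_measureReal A.bounded.measure_lt_top.ne]
    have hm : Measurable fun x => ‖A.amplitude (x, w)‖ₑ :=
      (A.measurable_amplitude.comp (by fun_prop)).enorm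
    have hsh : ∫⁻ x, ‖A.amplitude ((γ * s) • (w.1 : Space n) + x, w)‖ₑ =
        ∫⁻ x, ‖A.amplitude (x, w)‖ₑ :=
      lintegral_add_left_eq_self (μ := (volume : Measure (Space n)))
        (fun x => ‖A.amplitude (x, w)‖ₑ) _
    calc _ ≤ ∫⁻ x, (‖A.amplitude ((γ * s) • (w.1 : Space n) + x, w)‖ₑ + ‖A.amplitude (x, w)‖ₑ) :=
          lintegral_mono fun x => enorm_sub_le
      _ = (∫⁻ x, ‖A.amplitude (x, w)‖ₑ) + ∫⁻ x, ‖A.amplitude (x, w)‖ₑ := by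
          rw [lintegral_add_right _ hm, hsh]
      _ ≤ _ := by rw [two_mul]; exact add_le_add h0 h0
  have hlim : Tendsto (fun γ => ∫⁻ q : (Dir n × Dir n) × ℝ, ENNReal.ofReal (φ q.2) * I γ q.1 q.2
      ∂(((sphereMeasure n).prod (sphereMeasure n)).prod volume)) (𝓝[>] 0) (𝓝 0) := by
    have h0 : (0 : ℝ≥0∞) = ∫⁻ _ : (Dir n × Dir n) × ℝ, 0
      ∂(((sphereMeasure n).prod (sphereMeasure n)).prod volume) := by simp
    rw [h0]
    have hφm2 : Measurable fun q : (Dir n × Dir n) × ℝ => ENNReal.ofReal (φ q.2) :=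
      (hφm.comp measurable_snd).ennreal_ofReal
    refine tendsto_lintegral_filter_of_dominated_convergence
      (fun q => ENNReal.ofReal (φ q.2) * (2 * ENNReal.ofReal (A.Ck * volume.real Ω))) ?_ ?_ ?_ ?_
    · exact Eventually.of_forall fun γ => hφm2.mul (hIm γ)
    · exact Eventually.of_forall fun γ => ae_of_all _ fun q => by gcongr; exact hIle _ _ _
    · rw [lintegral_mul_const _ hφm2]
      refine ENNReal.mul_ne_top ?_ (ENNReal.mul_ne_top (by simp) ENNReal.ofReal_ne_top)
      rw [lintegral_prod _ hφm2.aemeasurable]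
      simp only [lintegral_const, measure_univ, mul_one]
      rw [← ofReal_integral_eq_lintegral_ofReal hφi (ae_of_all _ hφ.nonneg)]
      exact ENNReal.ofReal_ne_top
    · refine ae_of_all _ fun q => ?_
      have h1 : Tendsto (fun γ : ℝ => (γ * q.2) • (q.1.1 : Space n)) (𝓝[>] 0) (𝓝 0) := by
        have h2 : Continuous fun γ : ℝ => (γ * q.2) • (q.1.1 : Space n) := by fun_prop
        have h3 := (h2.tendsto 0).mono_left (nhdsWithin_le_nhds (s := Ioi 0))
        simpa using h3
      have h2 := (tendsto_translate (hampi q.1)).comp h1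
      have h3 := ENNReal.Tendsto.const_mul (a := ENNReal.ofReal (φ q.2)) h2
        (Or.inr ENNReal.ofReal_ne_top)
      rwa [mul_zero] at h3
  refine tendsto_of_tendsto_of_tendsto_of_le_of_le' tendsto_const_nhds hlim
    (Eventually.of_forall fun _ => zero_le) ?_
  filter_upwards [self_mem_nhdsWithin] with γ hγ
  have hγ' : (0 : ℝ) < γ := hγ
  have hm3 : Measurable fun q : (Space n × Dir n × Dir n) × ℝ => ENNReal.ofReal (φ q.2) *
      ‖A.amplitude ((γ * q.2) • (q.1.2.1 : Space n) + q.1.1, q.1.2) - A.amplitude q.1‖ₑ := by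
    have h1 : Measurable fun q : (Space n × Dir n × Dir n) × ℝ =>
      A.amplitude ((γ * q.2) • (q.1.2.1 : Space n) + q.1.1, q.1.2) :=
      A.measurable_amplitude.comp (by fun_prop)
    exact (hφm.comp measurable_snd).ennreal_ofReal.mul
      (h1.sub (A.measurable_amplitude.comp measurable_fst)).enorm
  calc _ ≤ ∫⁻ p in K, (∫⁻ s : ℝ, ENNReal.ofReal (φ s) *
        ‖A.amplitude ((γ * s) • (p.2.1 : Space n) + p.1, p.2) - A.amplitude p‖ₑ)
        ∂(tripleOn Ω) := by
        refine setLIntegral_mono' hKc.measurableSet fun p hp => ?_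
        rw [A.throughOnce_eq_amplitude hφ hh hγ' (hK hp)]
        have h1 : A.amplitude p = ∫ s, φ s * A.amplitude p := by
          rw [integral_mul_const, hφ.integral, one_mul]
        have h2 : Integrable fun s =>
            φ s * A.amplitude (p.1 + (γ * s) • (p.2.1 : Space n), p.2) := by
          refine hφi.mul_bdd (c := A.Ck)
            (A.measurable_amplitude.comp (by fun_prop)).aestronglyMeasurable
            (ae_of_all _ fun s => hampB _)
        conv_lhs => rw [h1]
        rw [← integral_sub h2 (hφi.mul_const _)]
        refine (enorm_integral_le_lintegral_enorm _).trans (le_of_eq ?_)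
        refine lintegral_congr fun s => ?_
        rw [← mul_sub, enorm_mul, Real.enorm_of_nonneg (hφ.nonneg _), add_comm]
    _ ≤ ∫⁻ p, (∫⁻ s : ℝ, ENNReal.ofReal (φ s) *
        ‖A.amplitude ((γ * s) • (p.2.1 : Space n) + p.1, p.2) - A.amplitude p‖ₑ)
        ∂(tripleMeasure n) := by
        rw [tripleOn_eq]
        exact (setLIntegral_le_lintegral _ _).trans (setLIntegral_le_lintegral _ _)
    _ = ∫⁻ w, (∫⁻ x : Space n, (∫⁻ s : ℝ, ENNReal.ofReal (φ s) *
        ‖A.amplitude ((γ * s) • (w.1 : Space n) + x, w) - A.amplitude (x, w)‖ₑ))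
        ∂((sphereMeasure n).prod (sphereMeasure n)) := by
        rw [tripleMeasure, lintegral_prod_symm' _ hm3.lintegral_prod_right']
    _ = ∫⁻ w, (∫⁻ s : ℝ, ENNReal.ofReal (φ s) * I γ w s)
        ∂((sphereMeasure n).prod (sphereMeasure n)) := by
        refine lintegral_congr fun w => ?_
        have hm4 : Measurable fun q : Space n × ℝ => ENNReal.ofReal (φ q.2) *
            ‖A.amplitude ((γ * q.2) • (w.1 : Space n) + q.1, w) - A.amplitude (q.1, w)‖ₑ := by
          have hmap : Measurable fun q : Space n × ℝ => ((q.1, w), q.2) := by fun_prop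
          exact hm3.comp hmap
        rw [lintegral_lintegral_swap hm4.aemeasurable]
        refine lintegral_congr fun s => ?_
        rw [lintegral_const_mul' _ _ ENNReal.ofReal_ne_top]
    _ = _ := by
        have hm5 : Measurable fun q : (Dir n × Dir n) × ℝ => ENNReal.ofReal (φ q.2) * I γ q.1 q.2 :=
          (hφm.comp measurable_snd).ennreal_ofReal.mul (hIm γ)
        rw [lintegral_prod _ hm5.aemeasurable]

end Medium
end RTE

/-! ### The limit `δ → 0`. -/

namespace RTE
open ProbabilityTheory
variable {n : ℕ} {Ω : Set (Space n)}

/-- The variables `(x, θ, θ', x')` regrouped as `((x, θ), (x', θ'))`. -/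
def regroup (q : (Space n × Dir n × Dir n) × Space n) : (Space n × Dir n) × (Space n × Dir n) :=
  ((q.1.1, q.1.2.1), (q.2, q.1.2.2))

/-- Estimates for the solutions hold for a fixed source `(x', θ')` in `L¹` of `(x, θ)`, whereas the
limit is taken in `(x, θ, θ')` after integration over `x'`. -/
lemma measurePreserving_regroup [NeZero n] (Ω : Set (Space n)) (μ : Measure (Space n)) [SFinite μ] :
    MeasurePreserving regroup ((tripleOn Ω).prod μ)
      ((phaseMeasure Ω).prod (μ.prod (sphereMeasure n))) := by
  have hsf : SFinite (phaseMeasure Ω) := by rw [phaseMeasure]; infer_instance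
  have h1 : MeasurePreserving (MeasurableEquiv.prodAssoc.symm : Space n × Dir n × Dir n → _)
      (tripleOn Ω) ((phaseMeasure Ω).prod (sphereMeasure n)) :=
    (measurePreserving_prodAssoc (volume.restrict Ω) (sphereMeasure n) (sphereMeasure n)).symm
  have h2 := h1.prod (MeasurePreserving.id μ)
  have h3 := measurePreserving_prodAssoc (phaseMeasure Ω) (sphereMeasure n) μ
  have h4 : MeasurePreserving (Prod.map id Prod.swap : (Space n × Dir n) × (Dir n × Space n) → _)
      ((phaseMeasure Ω).prod ((sphereMeasure n).prod μ))
      ((phaseMeasure Ω).prod (μ.prod (sphereMeasure n))) :=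
    (MeasurePreserving.id _).prod Measure.measurePreserving_swap
  exact h4.comp (h3.comp h2)

namespace Medium
variable (A : Medium Ω)

section Family
variable {W : Type*} [MeasurableSpace W] {f : W → Space n → Dir n → ℝ}

lemma measurable_ball_family (hf : Measurable fun q : W × Space n × Dir n => f q.1 q.2.1 q.2.2) :
    Measurable fun q : (Space n × Dir n) × W => A.ball (f q.2) q.1 := by
  have h1 : Measurable fun q : (Space n × Dir n) × W => (q.2, ent Ω q.1, q.1.2) :=
    measurable_snd.prodMk (((measurable_ent A.isOpen).comp measurable_fst).prodMk (by fun_prop))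
  exact (hf.comp h1).mul (A.measurable_bwd.comp measurable_fst)

lemma measurable_scat_ball_family
    (hf : Measurable fun q : W × Space n × Dir n => f q.1 q.2.1 q.2.2) :
    Measurable fun q : (Space n × Dir n) × W => A.scat (A.ball (f q.2)) q.1 := by
  have h1 : Measurable fun q : ((Space n × Dir n) × W) × Dir n =>
      A.ball (f q.1.2) (q.1.1.1, q.2) := (A.measurable_ball_family hf).comp
    (by fun_prop : Measurable fun q : ((Space n × Dir n) × W) × Dir n => ((q.1.1.1, q.2), q.1.2))
  have h2 : Measurable fun q : ((Space n × Dir n) × W) × Dir n =>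
      A.kk (q.1.1.1, q.2, q.1.1.2) * A.ball (f q.1.2) (q.1.1.1, q.2) :=
    (A.kk_meas.comp (by fun_prop)).mul h1
  exact h2.stronglyMeasurable.integral_prod_right'.measurable

lemma measurable_linExit_family [NeZero n]
    (hf : Measurable fun q : W × Space n × Dir n => f q.1 q.2.1 q.2.2) :
    Measurable fun q : (Space n × Dir n) × W => A.linExit (f q.2) q.1 := by
  have h1 : StronglyMeasurable (Function.uncurry fun (q : (Space n × Dir n) × W)
      (z : Space n × Dir n) => A.scat (A.ball (f q.2)) z) :=
    ((A.measurable_scat_ball_family hf).comp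
      (by fun_prop : Measurable fun q : ((Space n × Dir n) × W) × (Space n × Dir n) =>
        (q.2, q.1.2))).stronglyMeasurable
  have h2 := StronglyMeasurable.integral_kernel_prod_right
    (κ := A.totalKernel.comap (Prod.fst : (Space n × Dir n) × W → _) measurable_fst) h1
  exact ((A.measurable_ball_family hf).mul (A.measurable_fwd.comp measurable_fst)).add h2.measurable

end Family

lemma abs_linExit_le [NeZero n] {f : Space n → Dir n → ℝ} {c : ℝ} (hf : ∀ x θ, |f x θ| ≤ c)
    (p : Space n × Dir n) : |A.linExit f p| ≤ c + A.Ck * c * A.bound.toReal := by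
  have hc : 0 ≤ c := (abs_nonneg _).trans (hf 0 p.2)
  refine (abs_add_le _ _).trans (add_le_add ?_ ?_)
  · rw [abs_mul, abs_of_nonneg (A.fwd_nonneg p)]
    exact (mul_le_of_le_one_right (abs_nonneg _) (A.fwd_le_one p)).trans (A.abs_ball_le hf p)
  · rw [← Real.norm_eq_abs]
    refine (norm_integral_le_of_norm_le_const (f := fun z => A.scat (A.ball f) z) (C := A.Ck * c)
      (ae_of_all _ fun z => A.abs_scat_le (A.abs_ball_le hf) z)).trans ?_
    exact mul_le_mul_of_nonneg_left (ENNReal.toReal_mono A.bound_ne_top (A.totalKernel_univ_le _))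
      (mul_nonneg A.Ck_nonneg hc)

lemma linExit_const_mul [NeZero n] (a : ℝ) (f : Space n → Dir n → ℝ) (p : Space n × Dir n) :
    A.linExit (fun x θ => a * f x θ) p = a * A.linExit f p := by
  have h1 : A.ball (fun x θ => a * f x θ) = fun q => a * A.ball f q := by
    funext q; simp only [ball]; ring
  have h2 : A.scat (A.ball fun x θ => a * f x θ) = fun z => a * A.scat (A.ball f) z := by
    funext z
    rw [h1, scat, scat, ← integral_const_mul]
    congr 1; funext θ'; ring
  rw [linExit, linExit, h2, h1, integral_const_mul]
  ring

/-- In the limit of weak sources the nonlinearity disappears. -/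
theorem tendstoL1Loc_linearize [NeZero n] [IsFiniteMeasure (boundaryMeasure Ω)]
    {f : Space n × Dir n → Space n → Dir n → ℝ}
    (hf : Measurable fun q : (Space n × Dir n) × Space n × Dir n => f q.1 q.2.1 q.2.2) {c : ℝ}
    (hfc : ∀ w x θ, |f w x θ| ≤ c) {U : ℝ → (Space n × Dir n) × (Space n × Dir n) → ℝ}
    (hU : ∀ᶠ δ in 𝓝[>] (0 : ℝ), AEStronglyMeasurable (U δ)
      ((phaseMeasure Ω).prod ((boundaryMeasure Ω).prod (sphereMeasure n))))
    {C : ℝ≥0∞} (hC : C ≠ ∞)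
    (hest : ∀ᶠ δ in 𝓝[>] (0 : ℝ), ∀ w : Space n × Dir n, w.1 ∈ frontier Ω →
      ∫⁻ p, ‖U δ (p, w) - δ * A.linExit (f w) p‖ₑ ∂(phaseMeasure Ω) ≤ C * ENNReal.ofReal (δ ^ 2))
    {Ψ : (Space n × Dir n × Dir n) × Space n → ℝ} (hΨ : Measurable Ψ) {B : ℝ} (hB0 : 0 ≤ B)
    (hB : ∀ q, |Ψ q| ≤ B) {s : ℝ} (hs : 0 < s) {F : ℝ → Space n × Dir n × Dir n → ℝ}
    (hF : ∀ᵐ p ∂(tripleOn Ω), ∀ δ, F δ p =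
      ∫ x', U δ ((p.1, p.2.1), (x', p.2.2)) / (s * δ) * Ψ (p, x') ∂(boundaryMeasure Ω)) :
    TendstoL1Loc Ω F fun p =>
      ∫ x', A.linExit (f (x', p.2.2)) (p.1, p.2.1) / s * Ψ (p, x') ∂(boundaryMeasure Ω) := by
  have hfin := isFiniteMeasure_phase A.bounded
  have hfinΩ := isFiniteMeasure_restrict A.bounded
  have hfinT : IsFiniteMeasure (tripleOn Ω) := by rw [tripleOn]; infer_instance
  set μ := boundaryMeasure Ω with hμ
  set E : (Space n × Dir n) × (Space n × Dir n) → ℝ := fun q => A.linExit (f q.2) q.1 with hE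
  have hEm : Measurable E := A.measurable_linExit_family hf
  have hreg := measurePreserving_regroup Ω μ
  have hfr : ∀ᵐ w ∂(μ.prod (sphereMeasure n)), w.1 ∈ frontier Ω :=
    Measure.quasiMeasurePreserving_fst.ae (ae_restrict_mem isClosed_frontier.measurableSet)
  have hEi : Integrable (fun q => E (regroup q)) ((tripleOn Ω).prod μ) :=
    Integrable.of_bound (hEm.comp hreg.measurable).aestronglyMeasurable
      (c + A.Ck * c * A.bound.toReal) (ae_of_all _ fun q => A.abs_linExit_le (hfc _) _)
  have hΨi : ∀ g : (Space n × Dir n × Dir n) × Space n → ℝ, Integrable g ((tripleOn Ω).prod μ) →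
      Integrable (fun q => g q * Ψ q) ((tripleOn Ω).prod μ) := fun g hg =>
    hg.mul_bdd (c := B) hΨ.aestronglyMeasurable (ae_of_all _ hB)
  have hGi : Integrable (fun q => E (regroup q) / s * Ψ q) ((tripleOn Ω).prod μ) :=
    hΨi _ (hEi.div_const s)
  have hV : ∀ᶠ δ in 𝓝[>] (0 : ℝ), Integrable (fun q => U δ (regroup q) - δ * E (regroup q))
      ((tripleOn Ω).prod μ) ∧ ∫⁻ q, ‖U δ (regroup q) - δ * E (regroup q)‖ₑ ∂((tripleOn Ω).prod μ) ≤
        C * ENNReal.ofReal (δ ^ 2) * (μ.prod (sphereMeasure n)) univ := by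
    filter_upwards [hU, hest] with δ h1 h2
    have h3 : AEStronglyMeasurable (fun q => U δ q - δ * E q)
        ((phaseMeasure Ω).prod (μ.prod (sphereMeasure n))) :=
      h1.sub (hEm.const_mul δ).aestronglyMeasurable
    have h4 : ∫⁻ q, ‖U δ (regroup q) - δ * E (regroup q)‖ₑ ∂((tripleOn Ω).prod μ) ≤
        C * ENNReal.ofReal (δ ^ 2) * (μ.prod (sphereMeasure n)) univ := by
      have h5 := lintegral_map' (μ := (tripleOn Ω).prod μ) (g := regroup)
        (f := fun q => ‖U δ q - δ * E q‖ₑ) (by rw [hreg.map_eq]; exact h3.enorm)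
        hreg.measurable.aemeasurable
      rw [hreg.map_eq] at h5
      rw [← h5, lintegral_prod_symm _ h3.enorm]
      calc _ ≤ ∫⁻ _, C * ENNReal.ofReal (δ ^ 2) ∂(μ.prod (sphereMeasure n)) := by
            refine lintegral_mono_ae ?_
            filter_upwards [hfr] with w hw
            exact h2 w hw
        _ = _ := lintegral_const _
    refine ⟨⟨h3.comp_measurePreserving hreg, h4.trans_lt ?_⟩, h4⟩
    exact ENNReal.mul_lt_top (ENNReal.mul_lt_top hC.lt_top ENNReal.ofReal_lt_top)
      (measure_lt_top _ _)
  have hFi : ∀ᶠ δ in 𝓝[>] (0 : ℝ),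
      Integrable (fun q => U δ (regroup q) / (s * δ) * Ψ q) ((tripleOn Ω).prod μ) := by
    filter_upwards [hV] with δ h1
    refine hΨi _ (Integrable.div_const ?_ _)
    refine (h1.1.add (hEi.const_mul δ)).congr (ae_of_all _ fun q => ?_)
    simp
  refine tendstoL1Loc_of_global ?_ hGi.integral_prod_left ?_
  · filter_upwards [hFi] with δ h1
    refine h1.integral_prod_left.congr ?_
    filter_upwards [hF] with p hp
    rw [hp]
    rfl
  · set K := C * (μ.prod (sphereMeasure n)) univ * ENNReal.ofReal (B / s) with hK
    have hKtop : K ≠ ∞ := ENNReal.mul_ne_top (ENNReal.mul_ne_top hC (measure_ne_top _ _))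
      ENNReal.ofReal_ne_top
    have hlim : Tendsto (fun δ : ℝ => K * ENNReal.ofReal δ) (𝓝[>] 0) (𝓝 0) := by
      have h1 : Tendsto (fun δ : ℝ => ENNReal.ofReal δ) (𝓝[>] 0) (𝓝 0) := by
        have := (ENNReal.tendsto_ofReal (tendsto_id (α := ℝ) (x := 𝓝 0))).mono_left
          (nhdsWithin_le_nhds (s := Ioi (0:ℝ)))
        simpa using this
      simpa using ENNReal.Tendsto.const_mul h1 (Or.inr hKtop)
    refine tendsto_of_tendsto_of_tendsto_of_le_of_le' tendsto_const_nhds hlim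
      (Eventually.of_forall fun _ => zero_le) ?_
    filter_upwards [hV, hFi, self_mem_nhdsWithin] with δ h1 h2 hδ
    have hδ0 : (0 : ℝ) < δ := hδ
    have h3 : ∀ᵐ p ∂(tripleOn Ω), ‖F δ p -
        ∫ x', A.linExit (f (x', p.2.2)) (p.1, p.2.1) / s * Ψ (p, x') ∂μ‖ₑ ≤
        ENNReal.ofReal (B / (s * δ)) *
          ∫⁻ x', ‖U δ (regroup (p, x')) - δ * E (regroup (p, x'))‖ₑ ∂μ := by
      filter_upwards [hF, h2.prod_right_ae, hGi.prod_right_ae] with p h4 h5 h6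
      have h7 : F δ p - ∫ x', A.linExit (f (x', p.2.2)) (p.1, p.2.1) / s * Ψ (p, x') ∂μ =
          ∫ x', (U δ (regroup (p, x')) / (s * δ) * Ψ (p, x') -
            E (regroup (p, x')) / s * Ψ (p, x')) ∂μ := by
        rw [integral_sub h5 h6, h4]
        rfl
      rw [h7, ← lintegral_const_mul' _ _ ENNReal.ofReal_ne_top]
      refine (enorm_integral_le_lintegral_enorm _).trans (lintegral_mono fun x' => ?_)
      -- Dividing by `s * δ` leaves an error of order `δ² / δ = δ`.
      have h8 : U δ (regroup (p, x')) / (s * δ) * Ψ (p, x') - E (regroup (p, x')) / s * Ψ (p, x') =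
          (Ψ (p, x') / (s * δ)) * (U δ (regroup (p, x')) - δ * E (regroup (p, x'))) := by
        field_simp
      rw [h8, enorm_mul]
      gcongr
      rw [← ofReal_norm, Real.norm_eq_abs, abs_div, abs_of_pos (mul_pos hs hδ0)]
      refine ENNReal.ofReal_le_ofReal ?_
      gcongr
      exact hB _
    calc _ ≤ ∫⁻ p, ENNReal.ofReal (B / (s * δ)) *
          ∫⁻ x', ‖U δ (regroup (p, x')) - δ * E (regroup (p, x'))‖ₑ ∂μ ∂(tripleOn Ω) :=
          lintegral_mono_ae h3
      _ = ENNReal.ofReal (B / (s * δ)) *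
          ∫⁻ q, ‖U δ (regroup q) - δ * E (regroup q)‖ₑ ∂((tripleOn Ω).prod μ) := by
          rw [lintegral_const_mul' _ _ ENNReal.ofReal_ne_top, lintegral_prod _ h1.1.1.enorm]
      _ ≤ ENNReal.ofReal (B / (s * δ)) *
          (C * ENNReal.ofReal (δ ^ 2) * (μ.prod (sphereMeasure n)) univ) := by gcongr; exact h1.2
      _ = C * (μ.prod (sphereMeasure n)) univ *
          (ENNReal.ofReal (B / (s * δ)) * ENNReal.ofReal (δ ^ 2)) := by ring
      _ = K * ENNReal.ofReal δ := by
          rw [hK, ← ENNReal.ofReal_mul (by positivity), mul_assoc (C * _),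
            ← ENNReal.ofReal_mul (by positivity)]
          congr 2
          field_simp

end Medium
end RTE

/-! ### The limit `ε → 0`. -/

namespace RTE
open ProbabilityTheory
variable {n : ℕ} {Ω : Set (Space n)} {h : Space n → ℝ} {L : NNReal} {ω c ε r : ℝ}

/-- The mollifier on the boundary of `Ω`. -/
noncomputable def boundaryMoll (h : Space n → ℝ) (c r : ℝ) (x x' : Space n) : ℝ :=
  1 / (c * r ^ (n - 1)) * h (r⁻¹ • (x - x'))

/-- The source concentrated near `w`, normalized in position and direction. -/
noncomputable def pointSource (h : Space n → ℝ) (ω c ε r : ℝ) (w : Space n × Dir n) (x : Space n)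
    (θ : Dir n) : ℝ :=
  moll h ω ε θ w.2 * boundaryMoll h c r x w.1

/-- Both mollifiers are normalized, the angular one with `ω` and the boundary one with `ω̃`; the
surplus `δ ε' ^ (n - 1)` is what the tested data are divided by. -/
lemma source_eq_mul_pointSource (hr : r ≠ 0) (δ : ℝ) (x' x : Space n) (θ' θ : Dir n) :
    source h ω ε r δ x' θ' x θ =
      δ * (r ^ (n - 1) * pointSource h ω (sphereArea n * ω) ε r (x', θ') x θ) := by
  have h1 : r ^ (n - 1) * (1 / (sphereArea n * ω * r ^ (n - 1))) = 1 / (sphereArea n * ω) := by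
    rw [one_div, mul_inv, mul_comm (_)⁻¹, ← mul_assoc, mul_inv_cancel₀ (pow_ne_zero _ hr), one_mul,
      one_div]
  simp only [source, pointSource, moll, boundaryMoll]
  calc _ = δ * (1 / (sphereArea n * ω)) * (1 / (ω * ε ^ (n - 1))) * h (r⁻¹ • (x - x')) *
        h (ε⁻¹ • ((θ : Space n) - θ')) := by
        rw [div_eq_mul_inv, mul_inv, mul_inv, one_div, one_div, mul_inv ω (ε ^ (n - 1))]
        ring
    _ = _ := by rw [← h1]; ring

lemma measurable_boundaryMoll (hh : IsBump h L) (c r : ℝ) :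
    Measurable fun q : Space n × Space n => boundaryMoll h c r q.1 q.2 := by
  have h1 : Measurable fun q : Space n × Space n => r⁻¹ • (q.1 - q.2) := by fun_prop
  exact (hh.lip.continuous.measurable.comp h1).const_mul _

lemma boundaryMoll_nonneg (hh : IsBump h L) (hc : 0 < c) (hr : 0 < r) (x x' : Space n) :
    0 ≤ boundaryMoll h c r x x' := mul_nonneg (by positivity) (hh.nonneg _)

lemma boundaryMoll_le (hh : IsBump h L) (hc : 0 < c) (hr : 0 < r) (x x' : Space n) :
    boundaryMoll h c r x x' ≤ 1 / (c * r ^ (n - 1)) :=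
  mul_le_of_le_one_right (by positivity) (hh.le_one _)

lemma measurable_pointSource (hh : IsBump h L) (ω c ε r : ℝ) :
    Measurable fun q : (Space n × Dir n) × Space n × Dir n =>
      pointSource h ω c ε r q.1 q.2.1 q.2.2 :=
  ((measurable_moll hh ω ε).comp
    (by fun_prop : Measurable fun q : (Space n × Dir n) × Space n × Dir n => (q.2.2, q.1.2))).mul
  ((measurable_boundaryMoll hh c r).comp
    (by fun_prop : Measurable fun q : (Space n × Dir n) × Space n × Dir n => (q.2.1, q.1.1)))

lemma abs_pointSource_le (hh : IsBump h L) (hω : 0 < ω) (hc : 0 < c) (hε : 0 < ε) (hr : 0 < r)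
    (w : Space n × Dir n) (x : Space n) (θ : Dir n) :
    |pointSource h ω c ε r w x θ| ≤ 1 / (ω * ε ^ (n - 1)) * (1 / (c * r ^ (n - 1))) := by
  rw [pointSource, abs_mul, abs_of_nonneg (moll_nonneg hh hω hε _ _),
    abs_of_nonneg (boundaryMoll_nonneg hh hc hr _ _)]
  exact mul_le_mul (moll_le hh hω hε _ _) (boundaryMoll_le hh hc hr _ _)
    (boundaryMoll_nonneg hh hc hr _ _) (by positivity)

namespace Medium
variable (A : Medium Ω)

/-- The density at `z` of the first collisions of the particles that enter `Ω` near `x'` with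
direction `θ'`. -/
noncomputable def arrival (h : Space n → ℝ) (c r : ℝ)
    (q : ((Space n × Dir n) × Space n) × Dir n) : ℝ :=
  A.kk (q.1.1.1, q.2, q.1.1.2) * A.bwd (q.1.1.1, q.2) *
    boundaryMoll h c r (ent Ω (q.1.1.1, q.2)) q.1.2

lemma measurable_arrival (hh : IsBump h L) (c r : ℝ) : Measurable (A.arrival h c r) := by
  have h1 : Measurable fun q : ((Space n × Dir n) × Space n) × Dir n =>
      (ent Ω (q.1.1.1, q.2), q.1.2) :=
    ((measurable_ent A.isOpen).comp (by fun_prop)).prodMk (by fun_prop)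
  have h2 : Measurable fun q : ((Space n × Dir n) × Space n) × Dir n =>
      (q.1.1.1, q.2, q.1.1.2) := by fun_prop
  have h3 : Measurable fun q : ((Space n × Dir n) × Space n) × Dir n => (q.1.1.1, q.2) := by
    fun_prop
  have h4 := ((A.kk_meas.comp h2).mul (A.measurable_bwd.comp h3)).mul
    ((measurable_boundaryMoll hh c r).comp h1)
  exact h4

lemma abs_arrival_le (hh : IsBump h L) (hc : 0 < c) (hr : 0 < r)
    (q : ((Space n × Dir n) × Space n) × Dir n) :
    |A.arrival h c r q| ≤ A.Ck * (1 / (c * r ^ (n - 1))) := by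
  rw [arrival, abs_mul, abs_mul, abs_of_nonneg (A.kk_nonneg _), abs_of_nonneg (A.bwd_nonneg _),
    abs_of_nonneg (boundaryMoll_nonneg hh hc hr _ _)]
  refine mul_le_mul ?_ (boundaryMoll_le hh hc hr _ _) (boundaryMoll_nonneg hh hc hr _ _)
    A.Ck_nonneg
  exact (mul_le_of_le_one_right (A.kk_nonneg _) (A.bwd_le_one _)).trans (A.kk_le _)

lemma scat_ball_pointSource (w : Space n × Dir n) (z : Space n × Dir n) :
    A.scat (A.ball (pointSource h ω c ε r w)) z =
      ∫ θ, moll h ω ε θ w.2 * A.arrival h c r ((z, w.1), θ) ∂(sphereMeasure n) := by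
  rw [scat]
  congr 1
  funext θ
  simp only [ball, pointSource, arrival]
  ring

lemma measurable_scat_ball_pointSource (hh : IsBump h L) (ω c ε r : ℝ) :
    Measurable fun q : (Space n × Dir n) × (Space n × Dir n) =>
      A.scat (A.ball (pointSource h ω c ε r q.2)) q.1 :=
  A.measurable_scat_ball_family (measurable_pointSource hh ω c ε r)

/-- For a fixed point of phase space and a fixed `x'`, scattering the ballistic part is
mollification of `arrival` in the incoming direction, which converges in `L¹` of the sphere. The
other variables range over a finite measure space with a bound that does not depend on `ε`. -/
lemma tendsto_lintegral_arrival [NeZero n] [IsFiniteMeasure (boundaryMeasure Ω)] (hh : IsBump h L)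
    (hω0 : 0 < ω) (hω : IsMollifierConstant h ω) (hc : 0 < c) (hr : 0 < r) :
    Tendsto (fun ε => ∫⁻ q : (Space n × Dir n) × Space n, ∫⁻ θ',
      ‖A.scat (A.ball (pointSource h ω c ε r (q.2, θ'))) q.1 - A.arrival h c r (q, θ')‖ₑ
        ∂(sphereMeasure n) ∂((phaseMeasure Ω).prod (boundaryMeasure Ω))) (𝓝[>] 0) (𝓝 0) := by
  have hfin := isFiniteMeasure_phase A.bounded
  obtain ⟨C, hC0, hC⟩ := exists_lintegral_moll_le hh hω0
  set b := A.Ck * (1 / (c * r ^ (n - 1))) with hb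
  have hb0 : 0 ≤ b := mul_nonneg A.Ck_nonneg (by positivity)
  have hRm := A.measurable_arrival hh c r
  have hz : (0 : ℝ≥0∞) = ∫⁻ _ : (Space n × Dir n) × Space n, 0
    ∂((phaseMeasure Ω).prod (boundaryMeasure Ω)) := by simp
  suffices H : Tendsto (fun ε => ∫⁻ q : (Space n × Dir n) × Space n, ∫⁻ θ',
      ‖A.scat (A.ball (pointSource h ω c ε r (q.2, θ'))) q.1 - A.arrival h c r (q, θ')‖ₑ
        ∂(sphereMeasure n) ∂((phaseMeasure Ω).prod (boundaryMeasure Ω))) (𝓝[>] 0)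
      (𝓝 (∫⁻ _ : (Space n × Dir n) × Space n, 0 ∂((phaseMeasure Ω).prod (boundaryMeasure Ω)))) by
    rwa [← hz] at H
  refine tendsto_lintegral_filter_of_dominated_convergence
    (fun _ => ENNReal.ofReal C * ENNReal.ofReal b + ENNReal.ofReal b) ?_ ?_ ?_ ?_
  · refine Eventually.of_forall fun ε => ?_
    have h1 : Measurable fun q : ((Space n × Dir n) × Space n) × Dir n =>
        A.scat (A.ball (pointSource h ω c ε r (q.1.2, q.2))) q.1.1 :=
      (A.measurable_scat_ball_pointSource hh ω c ε r).comp
        (by fun_prop : Measurable fun q : ((Space n × Dir n) × Space n) × Dir n =>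
          (q.1.1, (q.1.2, q.2)))
    exact (h1.sub hRm).enorm.lintegral_prod_right'
  · filter_upwards [self_mem_nhdsWithin] with ε hε
    refine ae_of_all _ fun q => ?_
    calc _ ≤ ∫⁻ _ : Dir n, (ENNReal.ofReal C * ENNReal.ofReal b + ENNReal.ofReal b)
          ∂(sphereMeasure n) := by
          refine lintegral_mono fun θ' => enorm_sub_le.trans (add_le_add ?_ ?_)
          · rw [scat_ball_pointSource]
            exact enorm_integral_moll_le hh hω0 hC hε θ' fun θ => A.abs_arrival_le hh hc hr _
          · rw [← ofReal_norm]
            exact ENNReal.ofReal_le_ofReal (A.abs_arrival_le hh hc hr _)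
      _ = _ := by rw [lintegral_const, measure_univ, mul_one]
  · rw [lintegral_const]
    exact ENNReal.mul_ne_top (ENNReal.add_ne_top.2 ⟨ENNReal.mul_ne_top ENNReal.ofReal_ne_top
      ENNReal.ofReal_ne_top, ENNReal.ofReal_ne_top⟩) (measure_ne_top _ _)
  · refine ae_of_all _ fun q => ?_
    have hF : Integrable (fun θ => A.arrival h c r (q, θ)) (sphereMeasure n) :=
      Integrable.of_bound (hRm.comp measurable_prodMk_left).aestronglyMeasurable b
        (ae_of_all _ fun θ => A.abs_arrival_le hh hc hr _)
    simp_rw [scat_ball_pointSource]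
    exact tendsto_moll hh hω0 hω hF

/-- The response to point sources, integrated against `smear`, by Fubini's theorem. -/
lemma through_smear [NeZero n] [IsFiniteMeasure (boundaryMeasure Ω)] (hh : IsBump h L) (hc : 0 < c)
    (hr : 0 < r) {Ψ : (Space n × Dir n × Dir n) × Space n → ℝ} (hΨ : Measurable Ψ) {B : ℝ}
    (hB : ∀ q, |Ψ q| ≤ B) (p : Space n × Dir n × Dir n) :
    A.through (smear Ω h c r Ψ) p = ∫ x', (∫ z, A.arrival h c r ((z, x'), p.2.2)
      ∂(A.totalKernel (p.1, p.2.1))) * Ψ (p, x') ∂(boundaryMeasure Ω) := by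
  set κ := A.totalKernel (p.1, p.2.1)
  have hm : Measurable fun q : (Space n × Dir n) × Space n =>
      A.arrival h c r (q, p.2.2) * Ψ (p, q.2) :=
    ((A.measurable_arrival hh c r).comp (by fun_prop)).mul (hΨ.comp (by fun_prop))
  have hi : Integrable (fun q : (Space n × Dir n) × Space n =>
      A.arrival h c r (q, p.2.2) * Ψ (p, q.2)) (κ.prod (boundaryMeasure Ω)) := by
    refine Integrable.of_bound hm.aestronglyMeasurable (A.Ck * (1 / (c * r ^ (n - 1))) * B)
      (ae_of_all _ fun q => ?_)
    rw [norm_mul]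
    exact mul_le_mul (A.abs_arrival_le hh hc hr _) (hB _) (norm_nonneg _)
      (mul_nonneg A.Ck_nonneg (by positivity))
  calc _ = ∫ z, ∫ x', A.arrival h c r ((z, x'), p.2.2) * Ψ (p, x') ∂(boundaryMeasure Ω) ∂κ := by
        rw [through]
        refine integral_congr_ae (ae_of_all _ fun z => ?_)
        simp only [firstColl, smear]
        rw [← integral_const_mul]
        congr 1
        funext x'
        simp only [arrival, boundaryMoll]
        ring
    _ = _ := by
        rw [integral_integral_swap hi]
        congr 1
        funext x'
        rw [integral_mul_const]

/-- The angular support of the source misses the outgoing direction, so no particle leaves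
unscattered in that direction. -/
lemma linExit_pointSource_eq [NeZero n] (hh : IsBump h L) (hε : 0 < ε) {w : Space n × Dir n}
    {p : Space n × Dir n} (hp : ε ≤ dist p.2 w.2) :
    A.linExit (pointSource h ω c ε r w) p =
      ∫ z, A.scat (A.ball (pointSource h ω c ε r w)) z ∂(A.totalKernel p) := by
  rw [linExit, ball, pointSource, moll_eq_zero hh hε hp]
  ring

/-- Equal directions are dependent, so the distance of the two directions is positive on `K`, and
compactness bounds it below. -/
lemma exists_le_dist_of_isCompact {K : Set (Space n × Dir n × Dir n)} (hK : IsCompact K)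
    (hsub : K ⊆ nonparallelSet Ω) : ∃ d > 0, ∀ p ∈ K, d ≤ dist p.2.1 p.2.2 := by
  rcases K.eq_empty_or_nonempty with rfl | hne
  · exact ⟨1, one_pos, by simp⟩
  obtain ⟨p₀, hp₀, hmin⟩ := hK.exists_isMinOn hne
    (f := fun p : Space n × Dir n × Dir n => dist p.2.1 p.2.2) (by fun_prop)
  refine ⟨dist p₀.2.1 p₀.2.2, dist_pos.2 fun h0 => ?_, fun p hp => hmin hp⟩
  have h1 := (hsub hp₀).2
  rw [h0] at h1
  have h2 := h1.injective.eq_iff (a := 0) (b := 1)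
  simp at h2

/-- In the limit of sources concentrated in direction, the first collisions are those of particles
with a single incoming direction. -/
theorem tendstoL1Loc_angular [NeZero n] [IsFiniteMeasure (boundaryMeasure Ω)] (hh : IsBump h L)
    (hω0 : 0 < ω) (hω : IsMollifierConstant h ω) (hc : 0 < c) (hr : 0 < r)
    {Ψ : (Space n × Dir n × Dir n) × Space n → ℝ} (hΨ : Measurable Ψ) {B : ℝ}
    (hB : ∀ q, |Ψ q| ≤ B) :
    TendstoL1Loc Ω (fun ε p => ∫ x', A.linExit (pointSource h ω c ε r (x', p.2.2)) (p.1, p.2.1) *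
      Ψ (p, x') ∂(boundaryMeasure Ω)) (A.through (smear Ω h c r Ψ)) := by
  have hfin := isFiniteMeasure_phase A.bounded
  have hfinΩ := isFiniteMeasure_restrict A.bounded
  have hfinT : IsFiniteMeasure (tripleOn Ω) := by rw [tripleOn]; infer_instance
  set μ := boundaryMeasure Ω with hμ
  have hreg := measurePreserving_regroup Ω μ
  set b := A.Ck * (1 / (c * r ^ (n - 1))) with hb
  have hRm := A.measurable_arrival hh c r
  have hEi : ∀ ε > 0, Integrable (fun q : (Space n × Dir n × Dir n) × Space n =>
      A.linExit (pointSource h ω c ε r (q.2, q.1.2.2)) (q.1.1, q.1.2.1) * Ψ q)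
      ((tripleOn Ω).prod μ) := fun ε hε => by
    have h1' := (A.measurable_linExit_family (measurable_pointSource hh ω c ε r)).comp
      hreg.measurable
    have h1 : Measurable fun q : (Space n × Dir n × Dir n) × Space n =>
        A.linExit (pointSource h ω c ε r (q.2, q.1.2.2)) (q.1.1, q.1.2.1) := h1'
    set e := 1 / (ω * ε ^ (n - 1)) * (1 / (c * r ^ (n - 1))) with he
    have he0 : 0 ≤ e := by positivity
    refine Integrable.of_bound (h1.mul hΨ).aestronglyMeasurable
      ((e + A.Ck * e * A.bound.toReal) * B) (ae_of_all _ fun q => ?_)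
    rw [norm_mul]
    exact mul_le_mul (A.abs_linExit_le (abs_pointSource_le hh hω0 hc hε hr _) _) (hB _)
      (norm_nonneg _) (add_nonneg he0 (mul_nonneg (mul_nonneg A.Ck_nonneg he0)
        ENNReal.toReal_nonneg))
  -- the integrated response to a single incoming direction
  have hAm : Measurable fun q : ((Space n × Dir n) × (Space n × Dir n)) × (Space n × Dir n) =>
      A.arrival h c r ((q.2, q.1.2.1), q.1.2.2) :=
    hRm.comp (by fun_prop : Measurable
      fun q : ((Space n × Dir n) × (Space n × Dir n)) × (Space n × Dir n) =>
        (((q.2, q.1.2.1), q.1.2.2) : ((Space n × Dir n) × Space n) × Dir n))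
  have hJm : Measurable fun q : (Space n × Dir n) × (Space n × Dir n) =>
      ∫ z, A.arrival h c r ((z, q.2.1), q.2.2) ∂(A.totalKernel q.1) := by
    have h1 : StronglyMeasurable (Function.uncurry fun (q : (Space n × Dir n) × (Space n × Dir n))
      (z : Space n × Dir n) => A.arrival h c r ((z, q.2.1), q.2.2)) := hAm.stronglyMeasurable
    exact (StronglyMeasurable.integral_kernel_prod_right
      (κ := A.totalKernel.comap (Prod.fst : (Space n × Dir n) × (Space n × Dir n) → _)
        measurable_fst) h1).measurable
  have hJle : ∀ q : (Space n × Dir n) × (Space n × Dir n),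
      |∫ z, A.arrival h c r ((z, q.2.1), q.2.2) ∂(A.totalKernel q.1)| ≤ b * A.bound.toReal := by
    intro q
    rw [← Real.norm_eq_abs]
    refine (norm_integral_le_of_norm_le_const (f := fun z => A.arrival h c r ((z, q.2.1), q.2.2))
      (C := b) (ae_of_all _ fun z => A.abs_arrival_le hh hc hr _)).trans ?_
    exact mul_le_mul_of_nonneg_left (ENNReal.toReal_mono A.bound_ne_top (A.totalKernel_univ_le _))
      (mul_nonneg A.Ck_nonneg (by positivity))
  have hJi : Integrable (fun q : (Space n × Dir n × Dir n) × Space n =>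
      (∫ z, A.arrival h c r ((z, q.2), q.1.2.2) ∂(A.totalKernel (q.1.1, q.1.2.1))) * Ψ q)
      ((tripleOn Ω).prod μ) := by
    have h1' := hJm.comp hreg.measurable
    have h1 : Measurable fun q : (Space n × Dir n × Dir n) × Space n =>
        ∫ z, A.arrival h c r ((z, q.2), q.1.2.2) ∂(A.totalKernel (q.1.1, q.1.2.1)) := h1'
    refine Integrable.of_bound (h1.mul hΨ).aestronglyMeasurable
      (b * A.bound.toReal * B) (ae_of_all _ fun q => ?_)
    rw [norm_mul]
    exact mul_le_mul (hJle (regroup q)) (hB _) (norm_nonneg _)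
      (mul_nonneg (mul_nonneg A.Ck_nonneg (by positivity)) ENNReal.toReal_nonneg)
  have hthrough : A.through (smear Ω h c r Ψ) = fun p => ∫ x', (∫ z, A.arrival h c r
      ((z, x'), p.2.2) ∂(A.totalKernel (p.1, p.2.1))) * Ψ (p, x') ∂μ := by
    funext p
    exact A.through_smear hh hc hr hΨ hB p
  -- the error made by the angular mollifier
  set D : ℝ → (Space n × Dir n) × (Space n × Dir n) → ℝ≥0∞ := fun ε q =>
    ‖A.scat (A.ball (pointSource h ω c ε r q.2)) q.1 - A.arrival h c r ((q.1, q.2.1), q.2.2)‖ₑ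
    with hD
  have hDm : ∀ ε, Measurable (D ε) := fun ε =>
    ((A.measurable_scat_ball_pointSource hh ω c ε r).sub (hRm.comp (by fun_prop : Measurable
      fun q : (Space n × Dir n) × (Space n × Dir n) =>
        (((q.1, q.2.1), q.2.2) : ((Space n × Dir n) × Space n) × Dir n)))).enorm
  have hDκ : ∀ ε, Measurable fun q : (Space n × Dir n) × (Space n × Dir n) =>
      ∫⁻ z, D ε (z, q.2) ∂(A.totalKernel q.1) := fun ε => by
    have h1 : Measurable (Function.uncurry fun (q : (Space n × Dir n) × (Space n × Dir n))
        (z : Space n × Dir n) => D ε (z, q.2)) := (hDm ε).comp (by fun_prop : Measurable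
          fun q : ((Space n × Dir n) × (Space n × Dir n)) × (Space n × Dir n) => (q.2, q.1.2))
    exact h1.lintegral_kernel_prod_right
      (κ := A.totalKernel.comap (Prod.fst : (Space n × Dir n) × (Space n × Dir n) → _)
        measurable_fst)
  -- For a fixed source the `L¹` bound of the total kernel removes the path. It is therefore enough
  -- that the density of first collisions converges in `L¹` of phase space.
  have hglobal : ∀ ε, ∫⁻ p, ∫⁻ x', ∫⁻ z, D ε (z, (x', p.2.2)) ∂(A.totalKernel (p.1, p.2.1)) ∂μ
      ∂(tripleOn Ω) ≤ A.bound * ∫⁻ q : (Space n × Dir n) × Space n, ∫⁻ θ',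
      ‖A.scat (A.ball (pointSource h ω c ε r (q.2, θ'))) q.1 - A.arrival h c r (q, θ')‖ₑ
        ∂(sphereMeasure n) ∂((phaseMeasure Ω).prod μ) := fun ε => by
    have hg' := (hDκ ε).comp hreg.measurable
    have hg : Measurable fun q : (Space n × Dir n × Dir n) × Space n =>
        ∫⁻ z, D ε (z, (q.2, q.1.2.2)) ∂(A.totalKernel (q.1.1, q.1.2.1)) := hg'
    have h1 := lintegral_map (μ := (tripleOn Ω).prod μ) (hDκ ε) hreg.measurable
    rw [hreg.map_eq] at h1
    calc _ = ∫⁻ q, ∫⁻ z, D ε (z, (regroup q).2) ∂(A.totalKernel (regroup q).1)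
          ∂((tripleOn Ω).prod μ) := (lintegral_prod _ hg.aemeasurable).symm
      _ = ∫⁻ w, ∫⁻ p, ∫⁻ z, D ε (z, w) ∂(A.totalKernel p) ∂(phaseMeasure Ω)
          ∂(μ.prod (sphereMeasure n)) := by
          rw [← h1, lintegral_prod_symm _ (hDκ ε).aemeasurable]
      _ ≤ ∫⁻ w, A.bound * ∫⁻ z, D ε (z, w) ∂(phaseMeasure Ω) ∂(μ.prod (sphereMeasure n)) :=
          lintegral_mono fun w => A.lintegral_totalKernel_le
            ((hDm ε).comp (by fun_prop : Measurable fun z : Space n × Dir n => (z, w)))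
      _ = A.bound * ∫⁻ q, D ε q ∂((phaseMeasure Ω).prod (μ.prod (sphereMeasure n))) := by
          rw [lintegral_const_mul' _ _ A.bound_ne_top, lintegral_prod_symm _ (hDm ε).aemeasurable]
      _ = _ := by
          congr 1
          have h2 := (measurePreserving_prodAssoc (phaseMeasure Ω) μ (sphereMeasure n))
          have h3 := lintegral_prod (μ := (phaseMeasure Ω).prod μ) (ν := sphereMeasure n)
            (fun a => D ε (MeasurableEquiv.prodAssoc a)) ((hDm ε).comp h2.measurable).aemeasurable
          rw [← h2.lintegral_comp (hDm ε), h3]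
          rfl
  refine tendstoL1Loc_of ?_ ?_ fun K hK hKc => ?_
  · filter_upwards [self_mem_nhdsWithin] with ε hε
    exact (hEi ε hε).integral_prod_left
  · rw [hthrough]
    exact hJi.integral_prod_left
  · obtain ⟨d, hd0, hd⟩ := exists_le_dist_of_isCompact hKc hK
    have hlim := ENNReal.Tendsto.const_mul (a := ENNReal.ofReal B * A.bound)
      (A.tendsto_lintegral_arrival hh hω0 hω hc hr)
      (Or.inr (ENNReal.mul_ne_top ENNReal.ofReal_ne_top A.bound_ne_top))
    rw [mul_zero] at hlim
    refine tendsto_of_tendsto_of_tendsto_of_le_of_le' tendsto_const_nhds hlim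
      (Eventually.of_forall fun _ => zero_le) ?_
    filter_upwards [self_mem_nhdsWithin, mem_nhdsWithin_of_mem_nhds (Iio_mem_nhds hd0)]
      with ε hε hεd
    have hε0 : 0 < ε := hε
    have h3 : ∀ᵐ p ∂((tripleOn Ω).restrict K),
        ‖(∫ x', A.linExit (pointSource h ω c ε r (x', p.2.2)) (p.1, p.2.1) * Ψ (p, x') ∂μ) -
          A.through (smear Ω h c r Ψ) p‖ₑ ≤ ENNReal.ofReal B *
          ∫⁻ x', ∫⁻ z, D ε (z, (x', p.2.2)) ∂(A.totalKernel (p.1, p.2.1)) ∂μ := by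
      filter_upwards [ae_restrict_of_ae (hEi ε hε0).prod_right_ae,
        ae_restrict_of_ae hJi.prod_right_ae, ae_restrict_mem hKc.measurableSet] with p h4 h5 hpK
      rw [hthrough]
      simp only
      rw [← integral_sub h4 h5, ← lintegral_const_mul' _ _ ENNReal.ofReal_ne_top]
      refine (enorm_integral_le_lintegral_enorm _).trans (lintegral_mono fun x' => ?_)
      have h6 : ε ≤ dist ((p.1, p.2.1) : Space n × Dir n).2 ((x', p.2.2) : Space n × Dir n).2 :=
        (le_of_lt hεd).trans (hd p hpK)
      have hsi : Integrable (A.scat (A.ball (pointSource h ω c ε r (x', p.2.2))))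
          (A.totalKernel (p.1, p.2.1)) :=
        Integrable.of_bound ((A.measurable_scat_ball_pointSource hh ω c ε r).comp
          (by fun_prop : Measurable fun z : Space n × Dir n =>
            (z, (x', p.2.2)))).aestronglyMeasurable
          _ (ae_of_all _ fun z => A.abs_scat_le
            (A.abs_ball_le (abs_pointSource_le hh hω0 hc hε0 hr _)) z)
      have hri : Integrable (fun z => A.arrival h c r ((z, x'), p.2.2))
          (A.totalKernel (p.1, p.2.1)) :=
        Integrable.of_bound (hRm.comp (by fun_prop : Measurable fun z : Space n × Dir n =>
            (((z, x'), p.2.2) : ((Space n × Dir n) × Space n) × Dir n))).aestronglyMeasurable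
          b (ae_of_all _ fun z => A.abs_arrival_le hh hc hr _)
      rw [← sub_mul, mul_comm, enorm_mul, A.linExit_pointSource_eq hh hε0 h6,
        ← integral_sub hsi hri]
      gcongr
      · rw [← ofReal_norm]
        exact ENNReal.ofReal_le_ofReal (hB _)
      · exact enorm_integral_le_lintegral_enorm _
    calc _ ≤ ∫⁻ p in K, ENNReal.ofReal B *
          ∫⁻ x', ∫⁻ z, D ε (z, (x', p.2.2)) ∂(A.totalKernel (p.1, p.2.1)) ∂μ ∂(tripleOn Ω) :=
          lintegral_mono_ae h3
      _ ≤ ENNReal.ofReal B * ∫⁻ p, ∫⁻ x', ∫⁻ z, D ε (z, (x', p.2.2))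
          ∂(A.totalKernel (p.1, p.2.1)) ∂μ ∂(tripleOn Ω) := by
          rw [lintegral_const_mul' _ _ ENNReal.ofReal_ne_top]
          exact mul_le_mul' le_rfl (setLIntegral_le_lintegral _ _)
      _ ≤ _ := by
          rw [mul_assoc]
          gcongr
          exact hglobal ε

end Medium
end RTE

/-! ### Measurable representatives and assembly of the limits. -/

namespace RTE
open ProbabilityTheory

/-- A measurable version is truncated at zero and at the `L^∞` norm and cut off outside `S`;
properties valid almost everywhere then hold at every point, as the kernels need. -/
lemma exists_measurable_bounded_rep {X : Type*} [MeasurableSpace X] {ν : Measure X} {f : X → ℝ}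
    (hf : MemLp f ∞ ν) (h0 : ∀ᵐ x ∂ν, 0 ≤ f x) {S : Set X} (hS : MeasurableSet S)
    (hmem : ∀ᵐ x ∂ν, x ∈ S) :
    ∃ g : X → ℝ, Measurable g ∧ (∀ x, 0 ≤ g x) ∧ (∀ x, g x ≤ (eLpNorm f ∞ ν).toReal) ∧
      (∀ x ∉ S, g x = 0) ∧ ∀ᵐ x ∂ν, f x = g x := by
  set C := (eLpNorm f ∞ ν).toReal with hC
  have hC0 : 0 ≤ C := ENNReal.toReal_nonneg
  refine ⟨S.indicator fun x => max 0 (min (hf.1.mk f x) C),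
    ((measurable_const.max (hf.1.stronglyMeasurable_mk.measurable.min measurable_const))).indicator
      hS, indicator_nonneg fun _ _ => le_max_left _ _, fun x => ?_,
    fun x hx => indicator_of_notMem hx _, ?_⟩
  · refine indicator_le' (s := S) (g := fun _ => C) (fun x _ => max_le hC0 (min_le_right _ _))
      (fun x _ => hC0) x
  · filter_upwards [h0, hmem, hf.1.ae_eq_mk, ae_le_eLpNormEssSup (f := f) (μ := ν)]
      with x h1 h2 h3 h4
    rw [indicator_of_mem h2, ← h3]
    have h5 : f x ≤ C := by
      have h6 := ENNReal.toReal_mono hf.2.ne ((eLpNorm_exponent_top (f := f) (μ := ν)).symm ▸ h4)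
      rwa [toReal_enorm, Real.norm_of_nonneg h1] at h6
    rw [min_eq_left h5, max_eq_right h1]

variable {n : ℕ} {Ω : Set (Space n)}

lemma exists_tau_le (ho : IsOpen Ω) (hb : Bornology.IsBounded Ω) :
    ∃ R : ℝ, ∀ x ∈ Ω, ∀ θ : Dir n, 0 ≤ tau Ω x θ ∧ tau Ω x θ ≤ R := by
  obtain ⟨R, hR⟩ := hb.subset_closedBall 0
  refine ⟨2 * R + 2 * R, fun x hx θ => ?_⟩
  rw [tau, tauMinus_eq_tauPlus_neg]
  exact ⟨add_nonneg (tauPlus_nonneg _ _) (tauPlus_nonneg _ _),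
    add_le_add (tauPlus_le ho hb hR hx _) (tauPlus_le ho hb hR hx _)⟩

/-- Measurable representatives of admissible coefficients. -/
lemma Admissible.exists_medium [NeZero n] {σa σb : Space n → Dir n → ℝ}
    {k : Space n → Dir n → Dir n → ℝ} {f : Space n → Dir n → ℝ} (ho : IsOpen Ω)
    (hb : Bornology.IsBounded Ω) (hc : Convex ℝ Ω) (h : Admissible Ω σa σb k f) :
    ∃ A : Medium Ω, (∀ᵐ p ∂(phaseMeasure Ω), σa p.1 p.2 = A.sg p) ∧
      ∀ᵐ q ∂(tripleOn Ω), k q.1 q.2.1 q.2.2 = A.kk q := by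
  obtain ⟨sg, s1, s2, s3, s4, s5⟩ := exists_measurable_bounded_rep h.sigma_a_mem h.sigma_a_nonneg
    (ho.measurableSet.prod MeasurableSet.univ)
    ((ae_phase_mem ho).mono fun p hp => ⟨hp, mem_univ _⟩)
  obtain ⟨kk, k1, k2, k3, k4, k5⟩ := exists_measurable_bounded_rep h.k_mem h.k_nonneg
    (ho.measurableSet.prod MeasurableSet.univ)
    ((ae_tripleOn_mem ho).mono fun p hp => ⟨hp, mem_univ _⟩)
  set N := eLpNorm (fun p : Space n × Dir n => tau Ω p.1 p.2) ∞ (phaseMeasure Ω) with hN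
  have hNtop : N ≠ ∞ := by
    obtain ⟨R, hR⟩ := exists_tau_le ho hb
    refine ne_top_of_le_ne_top (ENNReal.ofReal_ne_top (r := R)) ?_
    rw [hN, eLpNorm_exponent_top]
    refine eLpNormEssSup_le_of_ae_bound ?_
    filter_upwards [ae_phase_mem ho] with p hp
    rw [Real.norm_of_nonneg (hR _ hp _).1]
    exact (hR _ hp _).2
  have hτ : ∀ᵐ p ∂phaseMeasure Ω, tau Ω p.1 p.2 ≤ N.toReal := by
    obtain ⟨R, hR⟩ := exists_tau_le ho hb
    filter_upwards [ae_phase_mem ho, ae_le_eLpNormEssSup (μ := phaseMeasure Ω)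
      (f := fun p : Space n × Dir n => tau Ω p.1 p.2)] with p hp h1
    have h2 := ENNReal.toReal_mono hNtop ((eLpNorm_exponent_top (μ := phaseMeasure Ω)
      (f := fun p : Space n × Dir n => tau Ω p.1 p.2)).symm ▸ h1)
    rwa [toReal_enorm, Real.norm_of_nonneg (hR _ hp _).1] at h2
  obtain ⟨m, -, hm0, hm1, -, -, hm, -⟩ := h.small
  refine ⟨⟨ho, hb, hc, sg, kk, _, _, N.toReal, s1, s2, s3, fun p hp => s4 p fun h => hp h.1, k1, k2,
    k3, fun p hp => k4 p fun h => hp h.1, ENNReal.toReal_nonneg, ENNReal.toReal_nonneg,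
    fun x hx θ => tau_le_of_ae ho hb hc hτ hx θ, ?_⟩, s5, k5⟩
  -- The contraction `Ck * M < 1` is the admissibility bound for the product of the norms of `k` and
  -- `τ`.
  rw [mul_comm, ← ENNReal.toReal_mul]
  refine lt_of_le_of_lt (ENNReal.toReal_le_of_le_ofReal hm0 hm) hm1

lemma MemLp.exists_ae_le {X : Type*} [MeasurableSpace X] {ν : Measure X} {f : X → ℝ}
    (hf : MemLp f ∞ ν) : ∃ C : ℝ, 0 ≤ C ∧ ∀ᵐ x ∂ν, f x ≤ C := by
  refine ⟨(eLpNorm f ∞ ν).toReal, ENNReal.toReal_nonneg, ?_⟩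
  filter_upwards [ae_le_eLpNormEssSup (f := f) (μ := ν)] with x h4
  have h6 := ENNReal.toReal_mono hf.2.ne ((eLpNorm_exponent_top (f := f) (μ := ν)).symm ▸ h4)
  rw [toReal_enorm] at h6
  exact (le_abs_self _).trans h6

/-- Attenuation factors written with the original absorption coefficient. -/
lemma Medium.ae_exp_eq [NeZero n] (A : Medium Ω) {σa : Space n → Dir n → ℝ}
    (hσ : ∀ᵐ p ∂(phaseMeasure Ω), σa p.1 p.2 = A.sg p) :
    ∀ᵐ p ∂(phaseMeasure Ω),
      A.fwd p = Real.exp (-∫ s in (0 : ℝ)..tauPlus Ω p.1 p.2, σa (p.1 + s • (p.2 : Space n)) p.2) ∧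
      A.bwd p =
        Real.exp (-∫ s in (0 : ℝ)..tauMinus Ω p.1 p.2, σa (p.1 - s • (p.2 : Space n)) p.2) := by
  filter_upwards [A.ae_chord hσ, ae_phase_mem A.isOpen] with p h1 hp
  have hpos := tauPlus_pos A.isOpen A.bounded A.convex hp p.2
  have hneg := tauMinus_pos A.isOpen A.bounded A.convex hp p.2
  constructor
  · have h2 := A.fwd_eq hp hpos.le
    rw [zero_smul, add_zero] at h2
    rw [h2]
    congr 2
    refine intervalIntegral.integral_congr_ae ?_
    filter_upwards [h1, Measure.ae_ne volume (tauPlus Ω p.1 p.2)] with t h3 h4 h5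
    rw [uIoc_of_le hpos.le] at h5
    rw [A.onChord_sg, h3]
    rw [chord_mem_iff A.isOpen A.bounded A.convex hp]
    exact ⟨by linarith [h5.1], lt_of_le_of_ne h5.2 h4⟩
  · rw [A.bwd_eq hp]
    congr 2
    have h6 := intervalIntegral.integral_comp_neg (a := 0) (b := tauMinus Ω p.1 p.2)
      (f := fun r => σa (p.1 + r • (p.2 : Space n)) p.2)
    rw [neg_zero] at h6
    simp only [neg_smul, ← sub_eq_add_neg] at h6
    rw [h6]
    refine intervalIntegral.integral_congr_ae ?_
    filter_upwards [h1] with t h3 h5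
    rw [uIoc_of_le (by linarith)] at h5
    rw [A.onChord_sg, h3]
    rw [chord_mem_iff A.isOpen A.bounded A.convex hp]
    exact ⟨h5.1, by linarith [h5.2]⟩

lemma quasiMeasurePreserving_left [NeZero n] (Ω : Set (Space n)) :
    Measure.QuasiMeasurePreserving (fun p : Space n × Dir n × Dir n => (p.1, p.2.1))
      (tripleOn Ω) (phaseMeasure Ω) :=
  Measure.quasiMeasurePreserving_fst.comp
    (measurePreserving_prodAssoc (volume.restrict Ω) (sphereMeasure n)
      (sphereMeasure n)).symm.quasiMeasurePreserving

lemma measurePreserving_flip [NeZero n] (Ω : Set (Space n)) :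
    MeasurePreserving (fun p : Space n × Dir n × Dir n => (p.1, p.2.2, p.2.1))
      (tripleOn Ω) (tripleOn Ω) :=
  (MeasurePreserving.id (volume.restrict Ω)).prod
    (Measure.measurePreserving_swap (μ := sphereMeasure n) (ν := sphereMeasure n))

/-- The forward factor depends on `(x, θ)` and the backward one on `(x, θ')`, while `k` takes its
incoming direction first; this accounts for the flip of the directions. -/
lemma Medium.ae_amplitude_eq [NeZero n] (A : Medium Ω) {σa : Space n → Dir n → ℝ}
    {k : Space n → Dir n → Dir n → ℝ}
    (hσ : ∀ᵐ p ∂(phaseMeasure Ω), σa p.1 p.2 = A.sg p)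
    (hk : ∀ᵐ q ∂(tripleOn Ω), k q.1 q.2.1 q.2.2 = A.kk q) :
    ∀ᵐ p ∂(tripleOn Ω), A.amplitude p =
        Real.exp (-∫ s in (0 : ℝ)..tauPlus Ω p.1 p.2.1,
            σa (p.1 + s • (p.2.1 : Space n)) p.2.1) *
          Real.exp (-∫ s in (0 : ℝ)..tauMinus Ω p.1 p.2.2,
            σa (p.1 - s • (p.2.2 : Space n)) p.2.2) *
          k p.1 p.2.2 p.2.1 := by
  have h := A.ae_exp_eq hσ
  have hflip := (measurePreserving_flip Ω).quasiMeasurePreserving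
  filter_upwards [(quasiMeasurePreserving_left Ω).ae h,
    ((quasiMeasurePreserving_left Ω).comp hflip).ae h, hflip.ae hk] with p h1 h2 h3
  exact congrArg₂ (· * ·) (congrArg₂ (· * ·) h1.1 h2.2) h3.symm

lemma TendstoL1Loc.congr_limit [NeZero n] {F : ℝ → Space n × Dir n × Dir n → ℝ}
    {G G' : Space n × Dir n × Dir n → ℝ} (h : TendstoL1Loc Ω F G)
    (hG : ∀ᵐ p ∂(tripleOn Ω), G p = G' p) : TendstoL1Loc Ω F G' := by
  rw [tripleOn_eq] at hG
  have hsub : nonparallelSet Ω ⊆ Ω ×ˢ univ := fun p hp => ⟨hp.1, mem_univ _⟩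
  have hK : ∀ K ⊆ nonparallelSet Ω, ∀ᵐ p ∂((tripleMeasure n).restrict K), G p = G' p :=
    fun K hK => ae_mono (Measure.restrict_mono (hK.trans hsub) le_rfl) hG
  refine ⟨h.1, fun x hx => ?_, fun K hKs hKc => (h.2.2 K hKs hKc).congr fun t => ?_⟩
  · obtain ⟨V, hV, hVi⟩ := h.2.1 x hx
    refine ⟨V ∩ nonparallelSet Ω, inter_mem hV self_mem_nhdsWithin, ?_⟩
    exact (hVi.mono_set inter_subset_left).congr (hK _ inter_subset_right)
  · refine integral_congr_ae ?_
    filter_upwards [hK K hKs] with p hp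
    rw [hp]

/-- Weak sources: the tested outgoing data of the nonlinear problem tend to those of the linear
one. -/
lemma Medium.tendstoL1Loc_testedData [NeZero n] [IsFiniteMeasure (boundaryMeasure Ω)] (A : Medium Ω)
    {σa σb : Space n → Dir n → ℝ} {k : Space n → Dir n → Dir n → ℝ}
    (hσ : ∀ᵐ p ∂(phaseMeasure Ω), σa p.1 p.2 = A.sg p)
    (hk : ∀ᵐ q ∂(tripleOn Ω), k q.1 q.2.1 q.2.2 = A.kk q)
    (hσbm : AEStronglyMeasurable (fun p : Space n × Dir n => σb p.1 p.2) (phaseMeasure Ω))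
    (hσb0 : ∀ᵐ p ∂(phaseMeasure Ω), 0 ≤ σb p.1 p.2) {Cb : ℝ}
    (hσb : ∀ᵐ p ∂(phaseMeasure Ω), σb p.1 p.2 ≤ Cb) (hCb : 0 ≤ Cb)
    {h : Space n → ℝ} (hh : IsCutoff h) {ω : ℝ} (hω : 0 < ω) {φ : ℝ → ℝ} (hφ : IsProfile φ)
    {ε ε' γ₁ γ₂ : ℝ} (hε : 0 < ε) (hε' : 0 < ε') (hγ₁ : 0 < γ₁)
    {u : ℝ → Space n → Dir n → Space n → Dir n → ℝ}
    (hsol : ∀ᶠ δ in 𝓝[>] (0 : ℝ), ∀ x' ∈ frontier Ω, ∀ θ' : Dir n,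
      IsSolution Ω σa σb k (source h ω ε ε' δ x' θ') (u δ x' θ'))
    (hmeas : ∀ᶠ δ in 𝓝[>] (0 : ℝ), AEStronglyMeasurable
        (fun q : (Space n × Dir n) × (Space n × Dir n) =>
          u δ q.2.1 q.2.2 (q.1.1 + tauPlus Ω q.1.1 q.1.2 • (q.1.2 : Space n)) q.1.2)
        ((phaseMeasure Ω).prod ((boundaryMeasure Ω).prod (sphereMeasure n)))) :
    TendstoL1Loc Ω (fun δ => testedData Ω φ h γ₁ γ₂ ε' δ (u δ)) fun p =>
      ∫ x', A.linExit (pointSource h ω (sphereArea n * ω) ε ε' (x', p.2.2)) (p.1, p.2.1) *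
        testAt Ω φ h γ₁ γ₂ (p, x') ∂(boundaryMeasure Ω) := by
  obtain ⟨L, hL⟩ := hh.exists_isBump
  have hc : 0 < sphereArea n * ω := mul_pos sphereArea_pos hω
  have hs : 0 < ε' ^ (n - 1) := by positivity
  set e := 1 / (ω * ε ^ (n - 1)) * (1 / (sphereArea n * ω * ε' ^ (n - 1))) with he
  set f : Space n × Dir n → Space n → Dir n → ℝ := fun w x θ =>
    ε' ^ (n - 1) * pointSource h ω (sphereArea n * ω) ε ε' w x θ with hf
  have hfm : Measurable fun q : (Space n × Dir n) × Space n × Dir n => f q.1 q.2.1 q.2.2 :=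
    (measurable_pointSource hL ω _ ε ε').const_mul _
  have hfc : ∀ w x θ, |f w x θ| ≤ ε' ^ (n - 1) * e := fun w x θ => by
    rw [hf, abs_mul, abs_of_pos hs]
    exact mul_le_mul_of_nonneg_left (abs_pointSource_le hL hω hc hε hε' w x θ) hs.le
  set c₁ := ε' ^ (n - 1) * e with hc₁
  -- The boundary values have size `δ c₁` and the comparison estimate is quadratic in that size,
  -- which produces the factor `δ²`.
  have hest : ∀ᶠ δ in 𝓝[>] (0 : ℝ), ∀ w : Space n × Dir n, w.1 ∈ frontier Ω →
      ∫⁻ p : Space n × Dir n, ‖u δ w.1 w.2 (p.1 + tauPlus Ω p.1 p.2 • (p.2 : Space n)) p.2 -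
        δ * A.linExit (f w) p‖ₑ ∂(phaseMeasure Ω) ≤
      A.bound * ENNReal.ofReal (Cb * (c₁ / (1 - A.Ck * A.M)) ^ 2 * volume.real Ω) *
        ENNReal.ofReal (δ ^ 2) := by
    filter_upwards [hsol, self_mem_nhdsWithin] with δ hδ hδ0 w hw
    have hδ0' : (0 : ℝ) < δ := hδ0
    have hsrc : source h ω ε ε' δ w.1 w.2 = fun x θ => δ * f w x θ := by
      funext x θ
      exact source_eq_mul_pointSource hε'.ne' δ w.1 x w.2 θ
    have h1 := hδ w.1 hw w.2
    rw [hsrc] at h1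
    have h2 : Measurable (Function.uncurry fun x θ => δ * f w x θ) :=
      (hfm.comp measurable_prodMk_left).const_mul δ
    have h3 := A.lintegral_exit_sub_linExit_le hσ hk hσbm hσb0 hσb hCb h2 (c := δ * c₁)
      (fun x θ => by
        rw [abs_mul, abs_of_pos hδ0']
        exact mul_le_mul_of_nonneg_left (hfc w x θ) hδ0'.le) h1
    simp_rw [A.linExit_const_mul] at h3
    refine h3.trans (le_of_eq ?_)
    rw [mul_assoc A.bound, ← ENNReal.ofReal_mul' (sq_nonneg δ)]
    congr 2
    ring
  have key := A.tendstoL1Loc_linearize hfm hfc hmeas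
    (ENNReal.mul_ne_top A.bound_ne_top ENNReal.ofReal_ne_top) hest
    (measurable_testAt A.isOpen hφ hh γ₁ γ₂) (by positivity) (abs_testAt_le hφ hh hγ₁) hs
    (F := fun δ => testedData Ω φ h γ₁ γ₂ ε' δ (u δ)) (by
      filter_upwards [ae_tripleOn_mem A.isOpen] with p hp δ
      rw [testedData]
      congr 1
      funext x'
      rw [testAt, A.ent_eq (p := (p.1, p.2.2)) hp, sub_sub_eq_add_sub, add_sub_right_comm])
  refine key.congr_limit (ae_of_all _ fun p => ?_)
  congr 1
  funext x'
  rw [hf, A.linExit_const_mul, mul_div_cancel_left₀ _ hs.ne']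

lemma tendstoL1Loc_of_eq_empty (hΩ : Ω = ∅) (F : ℝ → Space n × Dir n × Dir n → ℝ)
    (G : Space n × Dir n × Dir n → ℝ) : TendstoL1Loc Ω F G := by
  have h0 : nonparallelSet Ω = ∅ := eq_empty_of_forall_notMem fun p hp => by
    have := hp.1
    rw [hΩ] at this
    exact this
  rw [TendstoL1Loc, h0]
  refine ⟨Eventually.of_forall fun _ x hx => absurd hx (notMem_empty x),
    fun x hx => absurd hx (notMem_empty x), fun K hK _ => ?_⟩
  rw [subset_empty_iff.1 hK]
  simp

end RTE

theorem theorem3p2 {n : ℕ} (hn : 3 ≤ n)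
    (Ω : Set (Space n)) (hΩ_open : IsOpen Ω) (hΩ_bdd : Bornology.IsBounded Ω)
    (hΩ_conv : Convex ℝ Ω) (hΩ_C1 : HasC1Boundary Ω)
    (σa σb : Space n → Dir n → ℝ) (k : Space n → Dir n → Dir n → ℝ)
    (h : Space n → ℝ) (hh : IsCutoff h) (ω : ℝ) (hω : IsMollifierConstant h ω)
    (φ : ℝ → ℝ) (hφ : IsProfile φ)
    -- `u ε ε' δ x' θ'` is the solution with boundary condition `source h ω ε ε' δ x' θ'`
    (u : ℝ → ℝ → ℝ → Space n → Dir n → Space n → Dir n → ℝ)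
    (hadm : ∀ ε > 0, ∀ ε' > 0, ∀ᶠ δ in 𝓝[>] (0 : ℝ), ∀ x' ∈ frontier Ω, ∀ θ' : Dir n,
      Admissible Ω σa σb k (source h ω ε ε' δ x' θ'))
    (hsol : ∀ ε > 0, ∀ ε' > 0, ∀ᶠ δ in 𝓝[>] (0 : ℝ), ∀ x' ∈ frontier Ω, ∀ θ' : Dir n,
      IsSolution Ω σa σb k (source h ω ε ε' δ x' θ') (u ε ε' δ x' θ'))
    -- the outgoing data are jointly measurable in `(x, θ, x', θ')`
    (hmeas : ∀ ε > 0, ∀ ε' > 0, ∀ᶠ δ in 𝓝[>] (0 : ℝ),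
      AEStronglyMeasurable
        (fun q : (Space n × Dir n) × (Space n × Dir n) =>
          u ε ε' δ q.2.1 q.2.2 (q.1.1 + tauPlus Ω q.1.1 q.1.2 • (q.1.2 : Space n)) q.1.2)
        ((phaseMeasure Ω).prod ((boundaryMeasure Ω).prod (sphereMeasure n)))) :
    ∃ (G₁ : ℝ → ℝ → ℝ → ℝ → Space n × Dir n × Dir n → ℝ)
      (G₂ : ℝ → ℝ → ℝ → Space n × Dir n × Dir n → ℝ)
      (G₃ : ℝ → ℝ → Space n × Dir n × Dir n → ℝ)
      (G₄ : ℝ → Space n × Dir n × Dir n → ℝ),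
      -- the limit `δ → 0`
      (∀ γ₁ > 0, ∀ γ₂ > 0, ∀ ε' > 0, ∀ ε > 0,
        TendstoL1Loc Ω (fun δ => testedData Ω φ h γ₁ γ₂ ε' δ (u ε ε' δ)) (G₁ γ₁ γ₂ ε' ε)) ∧
      -- the limit `ε → 0`
      (∀ γ₁ > 0, ∀ γ₂ > 0, ∀ ε' > 0,
        TendstoL1Loc Ω (fun ε => G₁ γ₁ γ₂ ε' ε) (G₂ γ₁ γ₂ ε')) ∧
      -- the limit `ε' → 0`
      (∀ γ₁ > 0, ∀ γ₂ > 0, TendstoL1Loc Ω (fun ε' => G₂ γ₁ γ₂ ε') (G₃ γ₁ γ₂)) ∧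
      -- the limit `γ₂ → 0`
      (∀ γ₁ > 0, TendstoL1Loc Ω (fun γ₂ => G₃ γ₁ γ₂) (G₄ γ₁)) ∧
      -- the limit `γ₁ → 0`
      TendstoL1Loc Ω G₄ (fun p =>
        Real.exp (-∫ s in (0 : ℝ)..tauPlus Ω p.1 p.2.1,
            σa (p.1 + s • (p.2.1 : Space n)) p.2.1) *
          Real.exp (-∫ s in (0 : ℝ)..tauMinus Ω p.1 p.2.2,
            σa (p.1 - s • (p.2.2 : Space n)) p.2.2) *
          k p.1 p.2.2 p.2.1) := by
  have hn0 : NeZero n := ⟨by omega⟩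
  -- A point of `Ω` provides a boundary point, and with it an admissible tuple. For empty `Ω` there
  -- is no such tuple, but all the limits are trivial.
  rcases Ω.eq_empty_or_nonempty with hΩ | ⟨x₀, hx₀⟩
  · exact ⟨fun _ _ _ _ _ => 0, fun _ _ _ _ => 0, fun _ _ _ => 0, fun _ _ => 0,
      fun _ _ _ _ _ _ _ _ => tendstoL1Loc_of_eq_empty hΩ _ _,
      fun _ _ _ _ _ _ => tendstoL1Loc_of_eq_empty hΩ _ _,
      fun _ _ _ _ => tendstoL1Loc_of_eq_empty hΩ _ _,
      fun _ _ => tendstoL1Loc_of_eq_empty hΩ _ _, tendstoL1Loc_of_eq_empty hΩ _ _⟩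
  obtain ⟨L, hL⟩ := hh.exists_isBump
  have hω0 : 0 < ω := hω.pos hL hh.eq_one.self_of_nhds
  have hc : 0 < sphereArea n * ω := mul_pos sphereArea_pos hω0
  have hfin := hΩ_C1.isFiniteMeasure hΩ_open hΩ_bdd
  obtain ⟨v, hv⟩ := (NormedSpace.sphere_nonempty (E := Space n) (x := 0) (r := 1)).2 zero_le_one
  -- The coefficients do not depend on the source, so a single admissible tuple, here with `ε = ε' =
  -- 1`, yields one medium for all the limits.
  obtain ⟨δ₀, hδ₀⟩ := (hadm 1 one_pos 1 one_pos).exists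
  have hA := hδ₀ _ (exit_mem_frontier hΩ_open hΩ_bdd hx₀ ⟨v, hv⟩) ⟨v, hv⟩
  obtain ⟨A, hσ, hk⟩ := hA.exists_medium hΩ_open hΩ_bdd hΩ_conv
  obtain ⟨Cb, hCb, hσb⟩ := MemLp.exists_ae_le hA.sigma_b_mem
  refine ⟨fun γ₁ γ₂ ε' ε p => ∫ x',
      A.linExit (pointSource h ω (sphereArea n * ω) ε ε' (x', p.2.2)) (p.1, p.2.1) *
        testAt Ω φ h γ₁ γ₂ (p, x') ∂(boundaryMeasure Ω),
    fun γ₁ γ₂ ε' => A.through (smear Ω h (sphereArea n * ω) ε' (testAt Ω φ h γ₁ γ₂)),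
    fun γ₁ γ₂ => A.through (testAt Ω φ h γ₁ γ₂), fun γ₁ => A.throughOnce (testAt Ω φ h γ₁ 1),
    fun γ₁ hγ₁ γ₂ _ ε' hε' ε hε => ?_, fun γ₁ hγ₁ γ₂ _ ε' hε' => ?_, fun γ₁ hγ₁ γ₂ _ => ?_,
    fun γ₁ hγ₁ => ?_, ?_⟩
  · exact A.tendstoL1Loc_testedData hσ hk hA.sigma_b_mem.1 hA.sigma_b_nonneg hσb hCb hh hω0 hφ
      hε hε' hγ₁ (hsol ε hε ε' hε') (hmeas ε hε ε' hε')
  · exact A.tendstoL1Loc_angular hL hω0 hω hc hε' (measurable_testAt hΩ_open hφ hh γ₁ γ₂)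
      (abs_testAt_le hφ hh hγ₁)
  · exact A.tendstoL1Loc_smear hΩ_C1 hL hc (hω.integral_tangent hL)
      (measurable_testAt hΩ_open hφ hh γ₁ γ₂) (continuous_testAt hφ hh γ₁ γ₂) (by positivity)
      (abs_testAt_le hφ hh hγ₁)
  · exact A.tendstoL1Loc_thin hn hφ hh hγ₁
  · exact (A.tendstoL1Loc_short hφ hh).congr_limit (A.ae_amplitude_eq hσ hk)
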